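/- **Conventions.** $\lambda$ is the security parameter. A function is negligible if it decays faster than every inverse polynomial in $\lambda$. A quantum polynomial-time (QPT) algorithm is a family of polynomial-size generalized quantum circuits (unitary gates from $\{H,T,\mathrm{CNOT},\mathrm{Toffoli}\}$, initialization of qubits in $|0\rangle$, tracing out of qubits); a classical polynomial-time algorithm is a family of polynomial-size Boolean circuits (probabilistic ones get uniform coins). All adversaries below are QPT. **Ingredients.** Let $\ell=\ell(\lambda)$ be polynomially bounded with $2^{-\ell(\lambda)}$ negligible, and let $n=2\ell$. * $\mathrm{PRG}:\{0,1\}^{\ell}\to\{0,1\}^{n}$ is a pseudorandom generator secure against QPT distinguishers. * $\mathrm{PRF}(k,\cdot):\{0,1\}^n\to\{0,1\}^n$ is a function family that can be punctured at two points: a key punctured at $x_1,x_2$ computes $\mathrm{PRF}(k,x)$ for all $x\notin\{x_1,x_2\}$, and given the punctured key and $x_1,x_2$, the values of $\mathrm{PRF}(k,\cdot)$ at $x_1$ and $x_2$ are indistinguishable from uniform values (one common uniform value if $x_1=x_2$), with an advantage bounded by a negligible function uniformly in $x_1,x_2$. * $\mathsf{iO}$ is a post-quantum indistinguishability obfuscator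 for P/poly with perfect correctness, whose output is a circuit of a size determined by $\lambda$ and the numbers of inputs, outputs and gates of the given circuit. * $\mathrm{UPO}=(\mathrm{Obf},\mathrm{Eval})$ consists of QPT algorithms: $\mathrm{Obf}(1^\lambda,C)$ is a quantum state and $\mathrm{Eval}$ maps this state and $x$ to an output string. *Generalized UPO with respect to $\mathcal D_X$.* A generalized puncturable keyed circuit class in P/poly is a class of polynomial-size circuits $C_k$, $k\in K_\lambda$, with $n'$ input bits, $2^{-n'(\lambda)}$ negligible, together with an efficient algorithm that, given $k$, circuits $\mu_B,\mu_C$ (of a polynomial size fixed with the class) and points $x_B,x_C$, outputs a circuit $C_{k,x_B,x_C}^{\mu_B,\mu_C}$ of the same size as $C_k$ whose value is $\mu_B(x_B)$ at $x_B$, $\mu_C(x_C)$ at $x_C$ (if $x_C\neq x_B$) and $C_k(x)$ elsewhere. UPO is a generalized UPO scheme with respect to $\mathcal D_X$ if for every such class 1. there is a negligible $\delta$ such that for all $k\in K_\lambda$ and all $x$, $\mathrm{Eval}(\mathrm{Obf}(1^\lambda,C_k),x)=C_k(x)$ with probability at least $1-\delta(\lambda)$; and 2. for all non-local QPT adversaries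 $(\mathcal A,\mathcal B,\mathcal C)$ the following experiment outputs 1 with probability at most $\frac12+\mathrm{negl}(\lambda)$: $\mathcal A$ outputs $k\in K_\lambda$ and circuits $\mu_B,\mu_C$; a bit $b$ is drawn uniformly and $(x_B,x_C)$ from $\mathcal D_X$; $\mathcal A$ gets $\mathrm{Obf}(1^\lambda,C_k)$ if $b=0$ and $\mathrm{Obf}(1^\lambda,C_{k,x_B,x_C}^{\mu_B,\mu_C})$ if $b=1$, and prepares a bipartite state for $\mathcal B$ and $\mathcal C$; then $\mathcal B$ gets $x_B$ and $\mathcal C$ gets $x_C$, without communication; the output is 1 if both return $b$. $\mathcal D_X$ is either *independent uniform* ($x_B,x_C$ independent and uniform) or *identical* ($x_B=x_C$ uniform). **Construction.** Messages are $n$-bit strings. All circuits are padded with dummy gates before they are given to $\mathsf{iO}$: the encryption circuit by $p_C(\lambda)$ gates and $\mathrm{PRF}(k,\cdot)$ by $p_F(\lambda)$ gates. * $\mathrm{Gen}(1^\lambda)$: sample a PRF key $k$; let $C$ be the circuit $(r,m)\mapsto(\mathrm{PRG}(r),\,\mathrm{PRF}(k,\mathrm{PRG}(r))\oplus m)$ with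 $r\in\{0,1\}^\ell$; output $sk=k$, $pk=\mathsf{iO}(C)$. * $\mathrm{QKeyGen}(sk)$: $\rho_{sk}=\mathrm{UPO.Obf}(1^\lambda,\mathsf{iO}(\mathrm{PRF}(k,\cdot)))$. * $\mathrm{Enc}(pk,m)$: output $pk(r,m)$ for uniform $r\in\{0,1\}^\ell$. * $\mathrm{Dec}(\rho,(y,z))$: output $\mathrm{UPO.Eval}(\rho,y)\oplus z$. **Theorem.** There is a polynomially bounded function $p_0$, depending only on PRF and PRG, such that for all polynomially bounded $p_C,p_F\ge p_0$, all $\mathsf{iO}$ and all UPO algorithms as above: 0. All algorithms of the scheme are efficient. For every $\delta$: if for all PRF keys $k$, all obfuscations $\tilde F$ of $\mathrm{PRF}(k,\cdot)$ and all $x$, $\mathrm{Eval}(\mathrm{Obf}(1^\lambda,\tilde F),x)=\tilde F(x)$ with probability at least $1-\delta(\lambda)$, then every message is decrypted correctly with probability at least $1-\delta(\lambda)$. 1. If UPO is a generalized UPO scheme with respect to independent uniform challenges for every generalized puncturable keyed circuit class in P/poly, then the scheme * is correct, up to a negligible error; * satisfies independent search anti-piracy: for all non-local QPT adversaries $(\mathcal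 A,\mathcal B,\mathcal C)$, where $\mathcal A$ gets $(\rho_{sk},pk)$ and prepares a bipartite state, and $\mathcal B,\mathcal C$ get encryptions (with independent coins) of independent uniform messages $m_B,m_C$, the probability that $\mathcal B$ outputs $m_B$ and $\mathcal C$ outputs $m_C$ is negligible; * satisfies $\mathcal D_{\text{iden-bit,ind-msg}}$-selective CPA anti-piracy: for all non-local QPT adversaries where $\mathcal A$ first, before any key is generated, outputs messages $m_0^B,m_1^B,m_0^C,m_1^C$, then gets $(\rho_{sk},pk)$ and prepares a bipartite state, after which, for a uniform bit $b$, $\mathcal B$ gets an encryption of $m_b^B$ and $\mathcal C$ an independent encryption of $m_b^C$, the probability that both output $b$ is at most $\frac12+\mathrm{negl}(\lambda)$. 2. If UPO is a generalized UPO scheme with respect to identical challenges for every generalized puncturable keyed circuit class in P/poly, then the scheme is correct, up to a negligible error, and satisfies identical-challenge selective CPA anti-piracy: the same experiment in which $\mathcal B$ and $\mathcal C$ both get the same encryption of $m_b^B$; again the probability that both output $b$ is at most $\frac12+\mathrm{negl}(\lambda)$. -/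

import Mathlib

open Polynomial
open scoped BigOperators

noncomputable section

/-! ## Asymptotics -/

/-- `f` is bounded by a polynomial in the security parameter. -/
def PolyBdd (f : ℕ → ℕ) : Prop := ∃ p : ℕ[X], ∀ lam, f lam ≤ p.eval lam

/-- `f` is negligible: it decays faster than every inverse polynomial. -/
def Negl (f : ℕ → ℝ) : Prop :=
  Asymptotics.SuperpolynomialDecay Filter.atTop (fun lam : ℕ => (lam : ℝ)) f

/-! ## Bit strings -/

abbrev Bits (n : ℕ) : Type := Fin n → Bool

def Bits.left {a b : ℕ} (z : Bits (a + b)) : Bits a := fun i => z (Fin.castAdd b i)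

def Bits.right {a b : ℕ} (z : Bits (a + b)) : Bits b := fun i => z (Fin.natAdd a i)

def Bits.xor {n : ℕ} (x y : Bits n) : Bits n := fun i => Bool.xor (x i) (y i)

/-- The one-bit string `b`. -/
def Bits.single (b : Bool) : Bits 1 := fun _ => b

/-! ## Boolean circuits -/

/-- Boolean circuits with `n` inputs, `m` outputs and `s` NAND gates, in topological order.
Wires `0` and `1` carry the constants false and true, wires `2, …, n + 1` carry the input, and wire
`2 + n + j` carries the output of gate `j`, whose two inputs are earlier wires. -/
structure BCirc (n m s : ℕ) where
  gate : (j : Fin s) → Fin (2 + n + j) × Fin (2 + n + j)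
  out : Fin m → Fin (2 + n + s)

namespace BCirc

/-- The value on wire `w` when the input is `x`. -/
def val {n m s : ℕ} (C : BCirc n m s) (x : Bits n) (w : ℕ) (hw : w < 2 + n + s) : Bool :=
  if _h0 : w < 2 then decide (w = 1)
  else if h : w < 2 + n then x ⟨w - 2, by omega⟩
  else
    let g := C.gate ⟨w - (2 + n), by omega⟩
    !(C.val x g.1 (by have := g.1.2; simp only at this; omega) &&
      C.val x g.2 (by have := g.2.2; simp only at this; omega))
termination_by w
decreasing_by
  · have := (C.gate ⟨w - (2 + n), by omega⟩).1.2
    simp only at this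
    omega
  · have := (C.gate ⟨w - (2 + n), by omega⟩).2.2
    simp only at this
    omega

def eval {n m s : ℕ} (C : BCirc n m s) (x : Bits n) : Bits m :=
  fun i => C.val x (C.out i) (C.out i).2

/-- The wires referred to: first inputs of the gates, second inputs of the gates, outputs. -/
def refs {n m s : ℕ} (C : BCirc n m s) : Fin (s + s + m) → Fin (2 + n + s) :=
  Fin.append
    (Fin.append (fun j => Fin.castLE (by omega) (C.gate j).1)
      (fun j => Fin.castLE (by omega) (C.gate j).2))
    C.out

/-- The length of the description of a circuit. -/
def descLen (n m s : ℕ) : ℕ := (s + s + m) * (2 + n + s)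

/-- The description of a circuit as a bit string: each wire reference is written in one-hot form. -/
def encode {n m s : ℕ} (C : BCirc n m s) : Bits (descLen n m s) :=
  fun i => decide (C.refs (finProdFinEquiv.symm i).1 = (finProdFinEquiv.symm i).2)

theorem encode_injective {n m s : ℕ} :
    Function.Injective (encode : BCirc n m s → Bits (descLen n m s)) := by
  intro C D h
  have hr : C.refs = D.refs := by
    funext i
    have := congrFun h (finProdFinEquiv (i, D.refs i))
    simpa [encode] using this
  have h3 : C.out = D.out := by
    funext j
    have := congrFun hr (Fin.natAdd (s + s) j)
    simpa [refs] using this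
  have h1 : ∀ j, (C.gate j).1 = (D.gate j).1 := by
    intro j
    have := congrFun hr (Fin.castAdd m (Fin.castAdd s j))
    simpa [refs] using this
  have h2 : ∀ j, (C.gate j).2 = (D.gate j).2 := by
    intro j
    have := congrFun hr (Fin.castAdd m (Fin.natAdd s j))
    simp only [refs, Fin.append_left, Fin.append_right] at this
    simpa using this
  cases C
  cases D
  simp only [BCirc.mk.injEq]
  exact ⟨funext fun j => Prod.ext (h1 j) (h2 j), h3⟩

instance {n m s : ℕ} : Fintype (BCirc n m s) := Fintype.ofInjective _ encode_injective

/-- A circuit whose outputs are input bits or constants; it has no gates. -/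
def wires {a b : ℕ} (f : Fin b → Bool ⊕ Fin a) : BCirc a b 0 where
  gate j := j.elim0
  out i :=
    match f i with
    | Sum.inl c => ⟨if c then 1 else 0, by split <;> omega⟩
    | Sum.inr j => ⟨2 + j, by omega⟩

instance {n m s : ℕ} : Inhabited (BCirc n m s) where
  default :=
    { gate := fun j => (⟨0, by omega⟩, ⟨0, by omega⟩)
      out := fun i => ⟨0, by omega⟩ }

/-- The circuit with description `y` (a fixed circuit if `y` is not the description of one). -/
def decode {n m s : ℕ} (y : Bits (descLen n m s)) : BCirc n m s := Function.invFun encode y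

def id (a : ℕ) : BCirc a a 0 := wires Sum.inr

/-- Sequential composition: first `C`, then `D`. -/
def comp {a b c s t : ℕ} (C : BCirc a b s) (D : BCirc b c t) : BCirc a c (s + t) :=
  let reloc : ∀ j : ℕ, Fin (2 + b + j) → Fin (2 + a + (s + j)) := fun j w =>
    if h2 : (w : ℕ) < 2 then ⟨w, by omega⟩
    else if hb : (w : ℕ) < 2 + b then Fin.castLE (by omega) (C.out ⟨w - 2, by omega⟩)
    else ⟨2 + a + s + (w - (2 + b)), by omega⟩
  { gate := fun j =>
      if h : (j : ℕ) < s then C.gate ⟨j, h⟩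
      else
        let g := D.gate ⟨j - s, by omega⟩
        (Fin.castLE (by omega) (reloc (j - s) g.1),
          Fin.castLE (by omega) (reloc (j - s) g.2))
    out := fun i => reloc t (D.out i) }

/-- Parallel composition. -/
def par {a b c d s t : ℕ} (C : BCirc a b s) (D : BCirc c d t) :
    BCirc (a + c) (b + d) (s + t) :=
  let relocC : ∀ j : ℕ, Fin (2 + a + j) → Fin (2 + (a + c) + j) := fun j w =>
    if h : (w : ℕ) < 2 + a then ⟨w, by omega⟩ else ⟨w + c, by omega⟩
  let relocD : ∀ j : ℕ, Fin (2 + c + j) → Fin (2 + (a + c) + (s + j)) := fun j w =>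
    if h2 : (w : ℕ) < 2 then ⟨w, by omega⟩
    else if hc : (w : ℕ) < 2 + c then ⟨a + w, by omega⟩
    else ⟨a + s + w, by omega⟩
  { gate := fun j =>
      if h : (j : ℕ) < s then
        (relocC j (C.gate ⟨j, h⟩).1, relocC j (C.gate ⟨j, h⟩).2)
      else
        let g := D.gate ⟨j - s, by omega⟩
        (Fin.castLE (by omega) (relocD (j - s) g.1),
          Fin.castLE (by omega) (relocD (j - s) g.2))
    out := Fin.append (fun i => Fin.castLE (by omega) (relocC s (C.out i)))
      (fun i => relocD t (D.out i)) }

/-- Bitwise exclusive or of two `n`-bit strings, with four gates for each bit. -/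
def xorCirc (n : ℕ) : BCirc (n + n) n (4 * n) where
  gate j :=
    let i := (j : ℕ) / 4
    let g := 2 + (n + n) + 4 * i
    if _h0 : (j : ℕ) % 4 = 0 then (⟨2 + i, by omega⟩, ⟨2 + n + i, by omega⟩)
    else if _h1 : (j : ℕ) % 4 = 1 then (⟨2 + i, by omega⟩, ⟨g, by omega⟩)
    else if _h2 : (j : ℕ) % 4 = 2 then (⟨2 + n + i, by omega⟩, ⟨g, by omega⟩)
    else (⟨g + 1, by omega⟩, ⟨g + 2, by omega⟩)
  out i := ⟨2 + (n + n) + (4 * i + 3), by omega⟩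

/-- The circuit `C` with `p` unused gates added. -/
def pad {a b s : ℕ} (C : BCirc a b s) (p : ℕ) : BCirc a b (s + p) where
  gate j := if h : (j : ℕ) < s then C.gate ⟨j, h⟩ else (⟨0, by omega⟩, ⟨0, by omega⟩)
  out i := Fin.castLE (by omega) (C.out i)

/-- The circuit `E(k, ·)`, in which `k` is hard-wired. -/
def hardwire {a b c s : ℕ} (E : BCirc (a + b) c s) (k : Bits a) : BCirc b c (0 + s) :=
  comp (wires (Fin.append (fun i => Sum.inl (k i)) (fun i => Sum.inr i))) E

end BCirc

/-- The family `f` of functions on bit strings is computed by Boolean circuits of polynomial size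
(deterministic polynomial time; a probabilistic algorithm takes its coins as a part of the input). -/
def PolyFun {a b : ℕ → ℕ} (f : ∀ lam, Bits (a lam) → Bits (b lam)) : Prop :=
  PolyBdd a ∧ PolyBdd b ∧
    ∃ (s : ℕ → ℕ) (C : ∀ lam, BCirc (a lam) (b lam) (s lam)),
      PolyBdd s ∧ ∀ lam x, (C lam).eval x = f lam x

/-! ## Quantum circuits -/

/-- (Unnormalized) density matrices on `a` qubits. -/
abbrev QState (a : ℕ) : Type := Matrix (Bits a) (Bits a) ℂ

/-- Linear maps from `QState a` to `QState b`, given by their matrices. -/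
abbrev Superop (a b : ℕ) : Type := Matrix (Bits b × Bits b) (Bits a × Bits a) ℂ

/-- The pure state `|x⟩⟨x|` of the computational basis. -/
def ket {a : ℕ} (x : Bits a) : QState a :=
  Matrix.of fun z z' => if z = x ∧ z' = x then 1 else 0

/-- The tensor product of states. -/
def QState.tensor {a b : ℕ} (ρ : QState a) (σ : QState b) : QState (a + b) :=
  Matrix.of fun z z' => ρ z.left z'.left * σ z.right z'.right

/-- The probability of the outcome `x` when all qubits are measured in the computational basis. -/
def QState.prob {a : ℕ} (ρ : QState a) (x : Bits a) : ℝ := (ρ x x).re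

/-- The unnormalized state of the second register after the first one was measured in the
computational basis, with outcome `y`; its trace is the probability of this outcome. -/
def QState.postMeasure {a b : ℕ} (ρ : QState (a + b)) (y : Bits a) : QState b :=
  Matrix.of fun z z' => ρ (Fin.append y z) (Fin.append y z')

namespace Superop

def apply {a b : ℕ} (S : Superop a b) (ρ : QState a) : QState b :=
  Matrix.of fun z z' => ∑ p : Bits a × Bits a, S (z, z') p * ρ p.1 p.2

def tensor {a b c d : ℕ} (S : Superop a b) (T : Superop c d) : Superop (a + c) (b + d) :=
  Matrix.of fun z x => S (z.1.left, z.2.left) (x.1.left, x.2.left) *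
    T (z.1.right, z.2.right) (x.1.right, x.2.right)

/-- The map `ρ ↦ S (|x⟩⟨x| ⊗ ρ)`. -/
def feed {a b c : ℕ} (S : Superop (a + b) c) (x : Bits a) : Superop b c :=
  Matrix.of fun z y => S z (Fin.append x y.1, Fin.append x y.2)

/-- The map `ρ ↦ U ρ U†`. -/
def conj {a : ℕ} (U : Matrix (Bits a) (Bits a) ℂ) : Superop a a :=
  Matrix.of fun z x => U z.1 x.1 * star (U z.2 x.2)

end Superop

/-- Generalized quantum circuits with `a` input qubits and `b` output qubits over the gate set
{H, T, CNOT, Toffoli}; qubits may be initialized in the zero state and may be traced out.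
In `perm e`, the output wire `j` is the input wire `e j`. -/
inductive QCirc : ℕ → ℕ → Type
  | perm {a b : ℕ} (e : Fin b ≃ Fin a) : QCirc a b
  | hadamard : QCirc 1 1
  | tGate : QCirc 1 1
  | cnot : QCirc 2 2
  | toffoli : QCirc 3 3
  | newZero : QCirc 0 1
  | discard : QCirc 1 0
  | seq {a b c : ℕ} (F : QCirc a b) (G : QCirc b c) : QCirc a c
  | par {a b c d : ℕ} (F : QCirc a b) (G : QCirc c d) : QCirc (a + c) (b + d)

namespace QCirc

/-- The number of gates, initializations and discarded qubits, and of wires in the permutations. -/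
def size : {a b : ℕ} → QCirc a b → ℕ
  | a, _, perm _ => a
  | _, _, hadamard => 1
  | _, _, tGate => 1
  | _, _, cnot => 1
  | _, _, toffoli => 1
  | _, _, newZero => 1
  | _, _, discard => 1
  | _, _, seq F G => F.size + G.size
  | _, _, par F G => F.size + G.size

def hadamardMatrix : Matrix (Bits 1) (Bits 1) ℂ :=
  Matrix.of fun z x => (if z 0 && x 0 then -1 else 1) / (Real.sqrt 2 : ℂ)

def tMatrix : Matrix (Bits 1) (Bits 1) ℂ :=
  Matrix.of fun z x => if z = x then (if x 0 then Complex.exp (Complex.I * Real.pi / 4) else 1) else 0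

def cnotMatrix : Matrix (Bits 2) (Bits 2) ℂ :=
  Matrix.of fun z x => if z = ![x 0, Bool.xor (x 1) (x 0)] then 1 else 0

def toffoliMatrix : Matrix (Bits 3) (Bits 3) ℂ :=
  Matrix.of fun z x => if z = ![x 0, x 1, Bool.xor (x 2) (x 0 && x 1)] then 1 else 0

/-- The quantum channel of a circuit. -/
def op : {a b : ℕ} → QCirc a b → Superop a b
  | _, _, perm e => Matrix.of fun z x => if z.1 = x.1 ∘ e ∧ z.2 = x.2 ∘ e then 1 else 0
  | _, _, hadamard => Superop.conj hadamardMatrix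
  | _, _, tGate => Superop.conj tMatrix
  | _, _, cnot => Superop.conj cnotMatrix
  | _, _, toffoli => Superop.conj toffoliMatrix
  | _, _, newZero => Matrix.of fun z _ => if z.1 0 = false ∧ z.2 0 = false then 1 else 0
  | _, _, discard => Matrix.of fun _ x => if x.1 = x.2 then 1 else 0
  | _, _, seq F G => G.op * F.op
  | _, _, par F G => Superop.tensor F.op G.op

def run {a b : ℕ} (F : QCirc a b) (ρ : QState a) : QState b := F.op.apply ρ

/-- The probability that the circuit, on the classical input `x`, outputs `1`. -/
def acceptProb {a : ℕ} (F : QCirc a 1) (x : Bits a) : ℝ := (F.run (ket x)).prob (Bits.single true)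

end QCirc

/-- Quantum polynomial time: a family of generalized quantum circuits of polynomial size. -/
def QPT {a b : ℕ → ℕ} (F : ∀ lam, QCirc (a lam) (b lam)) : Prop :=
  PolyBdd fun lam => (F lam).size

/-- The state that a circuit without input prepares. -/
def QCirc.prepare {b : ℕ} (F : QCirc 0 b) : QState b := F.run (ket Fin.elim0)

/-- The probability that two parties, who share the state `σ` and get the classical inputs `x` and
`y`, output `u` and `v`; they apply `B (x, ·) ⊗ C (y, ·)` to `σ` and measure. -/
def jointProb {n n' β γ c d : ℕ} (B : QCirc (n + β) c) (C : QCirc (n' + γ) d) (x : Bits n)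
    (y : Bits n') (σ : QState (β + γ)) (u : Bits c) (v : Bits d) : ℝ :=
  (((B.op.feed x).tensor (C.op.feed y)).apply σ).prob (Fin.append u v)

/-! ## Challenge distributions -/

/-- The uniform distribution on pairs of `n`-bit strings. -/
def unifPair (n : ℕ) : PMF (Bits n × Bits n) := PMF.uniformOfFintype _

/-- The distribution of `(x, x)` for a uniform `n`-bit string `x`. -/
def idenPair (n : ℕ) : PMF (Bits n × Bits n) := (PMF.uniformOfFintype (Bits n)).map fun x => (x, x)

/-! ## Pseudorandom generators -/

/-- Length-doubling generators with seed length `ℓ`. -/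
structure Prg (ℓ : ℕ → ℕ) where
  size : ℕ → ℕ
  circ : ∀ lam, BCirc (ℓ lam) (2 * ℓ lam) (size lam)
  poly : PolyBdd size

def Prg.Secure {ℓ : ℕ → ℕ} (G : Prg ℓ) : Prop :=
  ∀ D : ∀ lam, QCirc (2 * ℓ lam) 1, QPT D → ∃ μ, Negl μ ∧ ∀ lam,
    |(𝔼 r : Bits (ℓ lam), (D lam).acceptProb ((G.circ lam).eval r)) -
      𝔼 y : Bits (2 * ℓ lam), (D lam).acceptProb y| ≤ μ lam

/-! ## Puncturable pseudorandom functions -/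

/-- The algorithms of a function family from `n` bits to `n` bits that can be punctured at two
points; `peval` evaluates with a punctured key. -/
structure PuncPrf (n : ℕ → ℕ) where
  keyLen : ℕ → ℕ
  puncLen : ℕ → ℕ
  coins : ℕ → ℕ
  gen : ∀ lam, Bits (coins lam) → Bits (keyLen lam)
  puncture : ∀ lam, Bits (keyLen lam) → Bits (n lam) → Bits (n lam) → Bits (puncLen lam)
  evalSize : ℕ → ℕ
  eval : ∀ lam, BCirc (keyLen lam + n lam) (n lam) (evalSize lam)
  pevalSize : ℕ → ℕ
  peval : ∀ lam, BCirc (puncLen lam + n lam) (n lam) (pevalSize lam)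
  gen_poly : PolyFun gen
  puncture_poly : PolyFun (a := fun lam => keyLen lam + (n lam + n lam)) fun lam z =>
    puncture lam z.left z.right.left z.right.right
  eval_poly : PolyBdd evalSize
  peval_poly : PolyBdd pevalSize

namespace PuncPrf

variable {n : ℕ → ℕ}

/-- `F_k(x)`. -/
def app (F : PuncPrf n) {lam : ℕ} (k : Bits (F.keyLen lam)) (x : Bits (n lam)) : Bits (n lam) :=
  (F.eval lam).eval (Fin.append k x)

/-- A punctured key agrees with the key away from the punctured points. -/
def PunctureCorrect (F : PuncPrf n) : Prop :=
  ∀ lam (g : Bits (F.coins lam)) (x₁ x₂ x : Bits (n lam)), x ≠ x₁ → x ≠ x₂ →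
    (F.peval lam).eval (Fin.append (F.puncture lam (F.gen lam g) x₁ x₂) x) = F.app (F.gen lam g) x

/-- The values at the punctured points are pseudorandom given the punctured key. -/
def PunctureSecure (F : PuncPrf n) : Prop :=
  ∀ D : ∀ lam, QCirc (F.puncLen lam + ((n lam + n lam) + (n lam + n lam))) 1, QPT D →
    ∃ μ, Negl μ ∧ ∀ lam (x₁ x₂ : Bits (n lam)),
      |(𝔼 g : Bits (F.coins lam), (D lam).acceptProb
          (Fin.append (F.puncture lam (F.gen lam g) x₁ x₂)
            (Fin.append (Fin.append x₁ x₂)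
              (Fin.append (F.app (F.gen lam g) x₁) (F.app (F.gen lam g) x₂))))) -
        𝔼 g : Bits (F.coins lam), 𝔼 u₁ : Bits (n lam), 𝔼 u₂ : Bits (n lam), (D lam).acceptProb
          (Fin.append (F.puncture lam (F.gen lam g) x₁ x₂)
            (Fin.append (Fin.append x₁ x₂)
              (Fin.append u₁ (if x₂ = x₁ then u₁ else u₂))))| ≤ μ lam

end PuncPrf

/-! ## Indistinguishability obfuscation -/

/-- The obfuscator of an obfuscation scheme for circuits of all sizes. The obfuscated circuit is a
circuit again, and its size depends only on the security parameter and on the numbers of inputs,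
outputs and gates of the given circuit. -/
structure Obfuscator where
  coins : (lam n m s : ℕ) → ℕ
  outSize : (lam n m s : ℕ) → ℕ
  obf : (lam : ℕ) → {n m s : ℕ} → BCirc n m s → Bits (coins lam n m s) →
    BCirc n m (outSize lam n m s)
  poly : ∃ p : ℕ[X], ∀ lam n m s,
    coins lam n m s ≤ p.eval (lam + n + m + s) ∧
    outSize lam n m s ≤ p.eval (lam + n + m + s) ∧
    ∃ t, t ≤ p.eval (lam + n + m + s) ∧
      ∃ D : BCirc (BCirc.descLen n m s + coins lam n m s)
          (BCirc.descLen n m (outSize lam n m s)) t,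
        ∀ (C : BCirc n m s) (r : Bits (coins lam n m s)),
          D.eval (Fin.append C.encode r) = (obf lam C r).encode

/-- Post-quantum indistinguishability obfuscation for P/poly: perfect correctness, and security
for all circuits of polynomial size. -/
def Obfuscator.IsIndist (O : Obfuscator) : Prop :=
  (∀ (lam n m s : ℕ) (C : BCirc n m s) (r : Bits (O.coins lam n m s)) (x : Bits n),
    (O.obf lam C r).eval x = C.eval x) ∧
  ∀ n m s : ℕ → ℕ, PolyBdd n → PolyBdd m → PolyBdd s →
    ∀ D : ∀ lam, QCirc (BCirc.descLen (n lam) (m lam) (O.outSize lam (n lam) (m lam) (s lam)) +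
        (BCirc.descLen (n lam) (m lam) (s lam) + BCirc.descLen (n lam) (m lam) (s lam))) 1,
      QPT D → ∃ μ, Negl μ ∧
        ∀ lam (C₀ C₁ : BCirc (n lam) (m lam) (s lam)), (∀ x, C₀.eval x = C₁.eval x) →
          |(𝔼 r, (D lam).acceptProb
              (Fin.append (O.obf lam C₀ r).encode (Fin.append C₀.encode C₁.encode))) -
            𝔼 r, (D lam).acceptProb
              (Fin.append (O.obf lam C₁ r).encode (Fin.append C₀.encode C₁.encode))| ≤ μ lam

/-! ## Unclonable puncturable obfuscation -/

/-- Generalized puncturable keyed circuit classes in P/poly. The circuits `C k`, for `k` in the key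
space `K`, have `n` inputs, `m` outputs and `s` gates. `genPuncture k μB μC xB xC` is the circuit of
the same size whose outputs at the points `xB` and `xC` are replaced by the values of the circuits
`μB` and `μC`, which have `t` gates. Since every function with logarithmically many input bits can
be learned completely, `2 ^ (-n)` has to be negligible. -/
structure GenPuncClass where
  n : ℕ → ℕ
  m : ℕ → ℕ
  s : ℕ → ℕ
  t : ℕ → ℕ
  keyLen : ℕ → ℕ
  K : ∀ lam, Set (Bits (keyLen lam))
  C : ∀ lam, Bits (keyLen lam) → BCirc (n lam) (m lam) (s lam)
  genPuncture : ∀ lam, Bits (keyLen lam) → BCirc (n lam) (m lam) (t lam) →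
    BCirc (n lam) (m lam) (t lam) → Bits (n lam) → Bits (n lam) → BCirc (n lam) (m lam) (s lam)
  n_poly : PolyBdd n
  m_poly : PolyBdd m
  s_poly : PolyBdd s
  t_poly : PolyBdd t
  n_large : Negl fun lam => (1 / 2 : ℝ) ^ n lam
  C_poly : PolyFun fun lam k => (C lam k).encode
  genPuncture_poly : ∃ (z : ℕ → ℕ)
    (D : ∀ lam, BCirc
      (keyLen lam + ((BCirc.descLen (n lam) (m lam) (t lam) +
        BCirc.descLen (n lam) (m lam) (t lam)) + (n lam + n lam)))
      (BCirc.descLen (n lam) (m lam) (s lam)) (z lam)),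
    PolyBdd z ∧ ∀ lam k μB μC xB xC,
      (D lam).eval (Fin.append k (Fin.append (Fin.append μB.encode μC.encode) (Fin.append xB xC))) =
        (genPuncture lam k μB μC xB xC).encode
  genPuncture_spec : ∀ lam, ∀ k ∈ K lam, ∀ μB μC xB xC x,
    (genPuncture lam k μB μC xB xC).eval x =
      if x = xB then μB.eval xB else if x = xC then μC.eval xC else (C lam k).eval x

/-- The algorithms of an unclonable puncturable obfuscation scheme for circuits of all sizes. The
post-evaluation state that the evaluation algorithm may also return is traced out. -/
structure Upo where
  qubits : (lam n m s : ℕ) → ℕ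
  obf : (lam n m s : ℕ) → QCirc (BCirc.descLen n m s) (qubits lam n m s)
  eval : (lam n m s : ℕ) → QCirc (n + qubits lam n m s) m
  poly : ∃ p : ℕ[X], ∀ lam n m s,
    qubits lam n m s ≤ p.eval (lam + n + m + s) ∧
    (obf lam n m s).size ≤ p.eval (lam + n + m + s) ∧
    (eval lam n m s).size ≤ p.eval (lam + n + m + s)

namespace Upo

/-- The state `Obf(1^lam, C)`. -/
def obfState (U : Upo) (lam : ℕ) {n m s : ℕ} (C : BCirc n m s) : QState (U.qubits lam n m s) :=
  (U.obf lam n m s).run (ket C.encode)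

/-- The probability that the evaluation of `Obf(1^lam, C)` at `x` yields `C(x)`. -/
def evalProb (U : Upo) (lam : ℕ) {n m s : ℕ} (C : BCirc n m s) (x : Bits n) : ℝ :=
  (((U.eval lam n m s).op.feed x).apply (U.obfState lam C)).prob (C.eval x)

/-- Correctness on a class, up to a negligible error. -/
def CorrectFor (U : Upo) (𝔠 : GenPuncClass) : Prop :=
  ∃ δ, Negl δ ∧ ∀ lam, ∀ k ∈ 𝔠.K lam, ∀ x, 1 - δ lam ≤ U.evalProb lam (𝔠.C lam k) x

/-- The non-local quantum polynomial time adversaries `(A, B, C)` of the generalized security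
experiment. `A₁` outputs `(k, μB, μC)`, with `k` in the key space, and an internal state; `A₂` maps
this state and the obfuscated circuit to a bipartite state. -/
structure Adversary (U : Upo) (𝔠 : GenPuncClass) where
  st : ℕ → ℕ
  β : ℕ → ℕ
  γ : ℕ → ℕ
  A₁ : ∀ lam, QCirc 0 ((𝔠.keyLen lam + (BCirc.descLen (𝔠.n lam) (𝔠.m lam) (𝔠.t lam) +
    BCirc.descLen (𝔠.n lam) (𝔠.m lam) (𝔠.t lam))) + st lam)
  A₂ : ∀ lam, QCirc (st lam + U.qubits lam (𝔠.n lam) (𝔠.m lam) (𝔠.s lam)) (β lam + γ lam)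
  B : ∀ lam, QCirc (𝔠.n lam + β lam) 1
  C : ∀ lam, QCirc (𝔠.n lam + γ lam) 1
  A₁_qpt : QPT A₁
  A₂_qpt : QPT A₂
  B_qpt : QPT B
  C_qpt : QPT C
  valid : ∀ lam y z, (A₁ lam).prepare.prob (Fin.append y z) ≠ 0 →
    ∃ k ∈ 𝔠.K lam, ∃ μB μC : BCirc (𝔠.n lam) (𝔠.m lam) (𝔠.t lam),
      y = Fin.append k (Fin.append μB.encode μC.encode)

/-- The probability that the generalized security experiment with challenge bit `b` outputs `1`. -/
def exptProb {U : Upo} {𝔠 : GenPuncClass} (𝒜 : U.Adversary 𝔠)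
    (𝒟 : ∀ n, PMF (Bits n × Bits n)) (lam : ℕ) (b : Bool) : ℝ :=
  ∑ k : Bits (𝔠.keyLen lam), ∑ μB : BCirc (𝔠.n lam) (𝔠.m lam) (𝔠.t lam),
    ∑ μC : BCirc (𝔠.n lam) (𝔠.m lam) (𝔠.t lam), ∑ x : Bits (𝔠.n lam) × Bits (𝔠.n lam),
      (𝒟 (𝔠.n lam) x).toReal *
        (let stA := (𝒜.A₁ lam).prepare.postMeasure
            (Fin.append k (Fin.append μB.encode μC.encode))
          let ρ := U.obfState lam
            (if b then 𝔠.genPuncture lam k μB μC x.1 x.2 else 𝔠.C lam k)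
          let σ := (𝒜.A₂ lam).run (stA.tensor ρ)
          jointProb (𝒜.B lam) (𝒜.C lam) x.1 x.2 σ (Bits.single b) (Bits.single b))

/-- Generalized security on a class with respect to the challenge distribution `𝒟`. -/
def SecureFor (U : Upo) (𝔠 : GenPuncClass) (𝒟 : ∀ n, PMF (Bits n × Bits n)) : Prop :=
  ∀ 𝒜 : U.Adversary 𝔠, ∃ μ, Negl μ ∧ ∀ lam,
    (exptProb 𝒜 𝒟 lam false + exptProb 𝒜 𝒟 lam true) / 2 ≤ 1 / 2 + μ lam

/-- `U` is a generalized unclonable puncturable obfuscation scheme, with respect to `𝒟`, for every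
generalized puncturable keyed circuit class in P/poly. -/
def IsGenUpo (U : Upo) (𝒟 : ∀ n, PMF (Bits n × Bits n)) : Prop :=
  ∀ 𝔠 : GenPuncClass, U.CorrectFor 𝔠 ∧ U.SecureFor 𝔠 𝒟

end Upo

/-! ## Public-key single-decryptor encryption -/

/-- The algorithms of a public-key single-decryptor encryption scheme. -/
structure Sde where
  msgLen : ℕ → ℕ
  skLen : ℕ → ℕ
  pkLen : ℕ → ℕ
  ctLen : ℕ → ℕ
  qubits : ℕ → ℕ
  genCoins : ℕ → ℕ
  encCoins : ℕ → ℕ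
  gen : ∀ lam, Bits (genCoins lam) → Bits (skLen lam) × Bits (pkLen lam)
  qKeyGen : ∀ lam, Bits (skLen lam) → QState (qubits lam)
  enc : ∀ lam, Bits (pkLen lam) → Bits (msgLen lam) → Bits (encCoins lam) → Bits (ctLen lam)
  dec : ∀ lam, Bits (ctLen lam) → Superop (qubits lam) (msgLen lam)

namespace Sde

/-- All algorithms run in (classical or quantum) polynomial time. -/
def Efficient (S : Sde) : Prop :=
  PolyBdd S.msgLen ∧ PolyBdd S.ctLen ∧ PolyBdd S.qubits ∧ PolyBdd S.encCoins ∧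
  PolyFun (b := fun lam => S.skLen lam + S.pkLen lam)
    (fun lam g => Fin.append (S.gen lam g).1 (S.gen lam g).2) ∧
  (∃ Q : ∀ lam, QCirc (S.skLen lam) (S.qubits lam), QPT Q ∧
    ∀ lam sk, (Q lam).run (ket sk) = S.qKeyGen lam sk) ∧
  (∃ (s : ℕ → ℕ) (E : ∀ lam, BCirc (S.pkLen lam + (S.msgLen lam + S.encCoins lam))
      (S.ctLen lam) (s lam)), PolyBdd s ∧
    ∀ lam g msg r, (E lam).eval (Fin.append (S.gen lam g).2 (Fin.append msg r)) =
      S.enc lam (S.gen lam g).2 msg r) ∧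
  (∃ D : ∀ lam, QCirc (S.ctLen lam + S.qubits lam) (S.msgLen lam), QPT D ∧
    ∀ lam ct, (D lam).op.feed ct = S.dec lam ct)

/-- Correctness with error `δ`. -/
def CorrectWith (S : Sde) (δ : ℕ → ℝ) : Prop :=
  ∀ lam (msg : Bits (S.msgLen lam)), 1 - δ lam ≤
    𝔼 g : Bits (S.genCoins lam), 𝔼 r : Bits (S.encCoins lam),
      ((S.dec lam (S.enc lam (S.gen lam g).2 msg r)).apply
        (S.qKeyGen lam (S.gen lam g).1)).prob msg

def Correct (S : Sde) : Prop := ∃ δ, Negl δ ∧ S.CorrectWith δ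

/-- What the adversary gets: the decryption key and the public key. -/
def view (S : Sde) (lam : ℕ) (g : Bits (S.genCoins lam)) : QState (S.qubits lam + S.pkLen lam) :=
  (S.qKeyGen lam (S.gen lam g).1).tensor (ket (S.gen lam g).2)

/-- The non-local adversaries of the search experiment. -/
structure SearchAdversary (S : Sde) where
  β : ℕ → ℕ
  γ : ℕ → ℕ
  A : ∀ lam, QCirc (S.qubits lam + S.pkLen lam) (β lam + γ lam)
  B : ∀ lam, QCirc (S.ctLen lam + β lam) (S.msgLen lam)
  C : ∀ lam, QCirc (S.ctLen lam + γ lam) (S.msgLen lam)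
  A_qpt : QPT A
  B_qpt : QPT B
  C_qpt : QPT C

/-- The probability that the search experiment outputs `1`: `B` and `C` get encryptions of the
messages drawn from `𝒟` and both return their messages. -/
def searchProb {S : Sde} (𝒜 : S.SearchAdversary) (𝒟 : ∀ n, PMF (Bits n × Bits n)) (lam : ℕ) : ℝ :=
  𝔼 g : Bits (S.genCoins lam), ∑ msg : Bits (S.msgLen lam) × Bits (S.msgLen lam),
    (𝒟 (S.msgLen lam) msg).toReal *
      𝔼 rB : Bits (S.encCoins lam), 𝔼 rC : Bits (S.encCoins lam),
        jointProb (𝒜.B lam) (𝒜.C lam) (S.enc lam (S.gen lam g).2 msg.1 rB)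
          (S.enc lam (S.gen lam g).2 msg.2 rC) ((𝒜.A lam).run (S.view lam g)) msg.1 msg.2

def SearchAntiPiracy (S : Sde) (𝒟 : ∀ n, PMF (Bits n × Bits n)) : Prop :=
  ∀ 𝒜 : S.SearchAdversary, ∃ μ, Negl μ ∧ ∀ lam, searchProb 𝒜 𝒟 lam ≤ μ lam

/-- Four messages `m₀ᴮ, m₁ᴮ, m₀ᶜ, m₁ᶜ`. -/
structure Messages (n : ℕ) where
  B₀ : Bits n
  B₁ : Bits n
  C₀ : Bits n
  C₁ : Bits n

/-- The distribution of the pair of challenge ciphertexts, given the public key, the four messages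
and the challenge bit. -/
abbrev CtDist (S : Sde) : Type :=
  ∀ lam, Bits (S.pkLen lam) → Messages (S.msgLen lam) → Bool →
    PMF (Bits (S.ctLen lam) × Bits (S.ctLen lam))

/-- Identical bit, independent messages: independent encryptions of `m_bᴮ` and of `m_bᶜ`. -/
def idenBitIndMsg (S : Sde) : S.CtDist := fun lam pk M b =>
  (PMF.uniformOfFintype (Bits (S.encCoins lam) × Bits (S.encCoins lam))).map fun r =>
    (S.enc lam pk (if b then M.B₁ else M.B₀) r.1, S.enc lam pk (if b then M.C₁ else M.C₀) r.2)

/-- Identical challenges: the same encryption of `m_bᴮ` twice. -/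
def identical (S : Sde) : S.CtDist := fun lam pk M b =>
  (PMF.uniformOfFintype (Bits (S.encCoins lam))).map fun r =>
    (S.enc lam pk (if b then M.B₁ else M.B₀) r, S.enc lam pk (if b then M.B₁ else M.B₀) r)

/-- The non-local adversaries of the selective experiment: `A₁` outputs the four messages and an
internal state before any key is generated; `A₂` gets this state, the decryption key and the public
key, and prepares a bipartite state. -/
structure SelAdversary (S : Sde) where
  st : ℕ → ℕ
  β : ℕ → ℕ
  γ : ℕ → ℕ
  A₁ : ∀ lam, QCirc 0
    (((S.msgLen lam + S.msgLen lam) + (S.msgLen lam + S.msgLen lam)) + st lam)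
  A₂ : ∀ lam, QCirc (st lam + (S.qubits lam + S.pkLen lam)) (β lam + γ lam)
  B : ∀ lam, QCirc (S.ctLen lam + β lam) 1
  C : ∀ lam, QCirc (S.ctLen lam + γ lam) 1
  A₁_qpt : QPT A₁
  A₂_qpt : QPT A₂
  B_qpt : QPT B
  C_qpt : QPT C

/-- The probability that the selective experiment outputs `1`, that is, `B` and `C` both guess the
uniformly random challenge bit. -/
def selProb {S : Sde} (𝒜 : S.SelAdversary) (𝒟 : S.CtDist) (lam : ℕ) : ℝ :=
  ∑ mB₀ : Bits (S.msgLen lam), ∑ mB₁ : Bits (S.msgLen lam),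
    ∑ mC₀ : Bits (S.msgLen lam), ∑ mC₁ : Bits (S.msgLen lam),
      𝔼 g : Bits (S.genCoins lam), 𝔼 b : Bool,
        ∑ ct : Bits (S.ctLen lam) × Bits (S.ctLen lam),
          (𝒟 lam (S.gen lam g).2 ⟨mB₀, mB₁, mC₀, mC₁⟩ b ct).toReal *
            (let stA := (𝒜.A₁ lam).prepare.postMeasure
                (Fin.append (Fin.append mB₀ mB₁) (Fin.append mC₀ mC₁))
              let σ := (𝒜.A₂ lam).run (stA.tensor (S.view lam g))
              jointProb (𝒜.B lam) (𝒜.C lam) ct.1 ct.2 σ (Bits.single b) (Bits.single b))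

def SelectiveCpaAntiPiracy (S : Sde) (𝒟 : S.CtDist) : Prop :=
  ∀ 𝒜 : S.SelAdversary, ∃ μ, Negl μ ∧ ∀ lam, selProb 𝒜 𝒟 lam ≤ 1 / 2 + μ lam

end Sde

/-! ## The construction -/

section Construction

variable {ℓ : ℕ → ℕ} (F : PuncPrf fun lam => 2 * ℓ lam) (G : Prg ℓ) (O : Obfuscator) (U : Upo)
  (padC padF : ℕ → ℕ)

/-- The circuit that on input `(r, msg)` outputs `(PRG(r), PRF(k, PRG(r)) ⊕ msg)`: it computes in
turn `(PRG(r), msg)`, `(PRG(r), PRG(r), msg)`, `(PRG(r), PRF(k, PRG(r)), msg)` and the output. -/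
def encCircuit (lam : ℕ) (k : Bits (F.keyLen lam)) :=
  let n := 2 * ℓ lam
  let copy : Fin (n + (n + n)) → Bool ⊕ Fin (n + n) :=
    Fin.append (fun i => Sum.inr (Fin.castAdd n i)) (fun i => Sum.inr i)
  ((((G.circ lam).par (BCirc.id n)).comp (BCirc.wires copy)).comp
    ((BCirc.id n).par (((F.eval lam).hardwire k).par (BCirc.id n)))).comp
      ((BCirc.id n).par (BCirc.xorCirc n))

/-- The circuit `PRF(k, ·)`, padded with `padF` gates. -/
def decCircuit (lam : ℕ) (k : Bits (F.keyLen lam)) :=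
  ((F.eval lam).hardwire k).pad (padF lam)

/-- The single-decryptor encryption scheme in which the public key is an obfuscation of the padded
encryption circuit and the decryption key is `UPO.Obf(iO(PRF(k, ·)))`. -/
def sde : Sde :=
  let n : ℕ → ℕ := fun lam => 2 * ℓ lam
  let sizeC : ℕ → ℕ := fun lam =>
    G.size lam + 0 + 0 + (0 + (0 + F.evalSize lam + 0)) + (0 + 4 * n lam) + padC lam
  let sizeF : ℕ → ℕ := fun lam => 0 + F.evalSize lam + padF lam
  let outC : ℕ → ℕ := fun lam => O.outSize lam (ℓ lam + n lam) (n lam + n lam) (sizeC lam)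
  let outF : ℕ → ℕ := fun lam => O.outSize lam (n lam) (n lam) (sizeF lam)
  { msgLen := n
    skLen := F.keyLen
    pkLen := fun lam => BCirc.descLen (ℓ lam + n lam) (n lam + n lam) (outC lam)
    ctLen := fun lam => n lam + n lam
    qubits := fun lam => U.qubits lam (n lam) (n lam) (outF lam)
    genCoins := fun lam =>
      F.coins lam + O.coins lam (ℓ lam + n lam) (n lam + n lam) (sizeC lam)
    encCoins := ℓ
    gen := fun lam g =>
      let k := F.gen lam g.left
      (k, (O.obf lam ((encCircuit F G lam k).pad (padC lam)) g.right).encode)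
    qKeyGen := fun lam sk =>
      𝔼 r : Bits (O.coins lam (n lam) (n lam) (sizeF lam)),
        U.obfState lam (O.obf lam (decCircuit F padF lam sk) r)
    enc := fun lam pk msg r => (BCirc.decode (s := outC lam) pk).eval (Fin.append r msg)
    dec := fun lam ct => Matrix.of fun z x =>
      (U.eval lam (n lam) (n lam) (outF lam)).op.feed ct.left
        (z.1.xor ct.right, z.2.xor ct.right) x }

end Construction

end

/-!
# Unclonable puncturable obfuscation gives public-key single-decryptor encryption

All security notions are nonuniform, so keys, coins and messages that a reduction would have to
guess are replaced by best possible ones, which are hardwired.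

*Selective security.* An encryption of `m` is `(y, PRF(k, y) ⊕ m)` with `y = PRG(r)`. For both
values of the challenge bit, `y` is first replaced by a uniform string (`Attack.realGame_points`).
For the challenge bit `0` nothing else is changed. For the challenge bit `1`, and for points `y`
outside the range of the generator, the public key may contain a key punctured at the challenge
points, because the encryption circuit never evaluates the function there; the circuit
`PRF(k, ·)` in the decryption key may be evaluated with the punctured key as well, patched with the
right values. These values are then uniform, so they can be shifted by the differences of the
messages for the bits `0` and `1`. After undoing the first steps, the ciphertexts are those for the
challenge bit `0`, with the true values of the function as masks, whereas the decryption key is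
patched with shifted values (`Attack.game_real_sub_hybrid`). What remains for the two bits are the
two worlds of the security experiment of the unclonable obfuscation, for the class of all
obfuscations of `PRF(k, ·)`: in one world the circuit is intact, and in the other one it is patched
at the challenge points with the circuits `x ↦ PRF(k, x) ⊕ d`
(`Attack.realGame_add_patchedGame_le`). Independent and identical challenges are treated at the
same time, by a flag `same`. The padding has to exceed the size of the circuits with punctured keys
(`exists_puncturedCircuits`).

*Search security.* A search adversary yields a selective one that announces random messages and
zeros, and whose parties guess the bit `0` if they find their messages. For the bit `1` they hold
encryptions of zeros, and find the messages only with negligible probability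
(`Sde.SelectiveCpaAntiPiracy.searchAntiPiracy`).

*Efficiency.* Adversaries are quantum circuits over a fixed gate set, so every reduction has to be
carried out by such circuits of polynomial size. Families of classical functions that are computed
by small Boolean circuits (`PEff`) are closed under the usual operations, including the evaluation
of a circuit that is given by its description (`BCirc.computesOn_eval`). Boolean circuits are
simulated by quantum circuits that measure their inputs (`BCirc.exists_classical`). Families of
superoperators that depend on classical data and are implemented by small quantum circuits (`CEff`)
are closed under composition, tensor products, and the measurement of control registers.
-/

noncomputable section

/-! ### Polynomially bounded functions -/

namespace PolyBdd

theorem mono {f g : ℕ → ℕ} (hg : PolyBdd g) (h : ∀ i, f i ≤ g i) : PolyBdd f := by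
  obtain ⟨p, hp⟩ := hg
  exact ⟨p, fun i => (h i).trans (hp i)⟩

theorem const (c : ℕ) : PolyBdd fun _ => c := ⟨C c, fun i => by simp⟩

theorem self : PolyBdd fun i => i := ⟨X, fun i => by simp⟩

theorem add {f g : ℕ → ℕ} (hf : PolyBdd f) (hg : PolyBdd g) : PolyBdd fun i => f i + g i := by
  obtain ⟨p, hp⟩ := hf
  obtain ⟨q, hq⟩ := hg
  exact ⟨p + q, fun i => by simpa using add_le_add (hp i) (hq i)⟩

theorem mul {f g : ℕ → ℕ} (hf : PolyBdd f) (hg : PolyBdd g) : PolyBdd fun i => f i * g i := by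
  obtain ⟨p, hp⟩ := hf
  obtain ⟨q, hq⟩ := hg
  exact ⟨p * q, fun i => by simpa using Nat.mul_le_mul (hp i) (hq i)⟩

theorem eval_mono (p : ℕ[X]) {a b : ℕ} (h : a ≤ b) : p.eval a ≤ p.eval b := by
  rw [Polynomial.eval_eq_sum, Polynomial.eval_eq_sum]
  exact Finset.sum_le_sum fun i _ => Nat.mul_le_mul le_rfl (Nat.pow_le_pow_left h i)

theorem eval {f : ℕ → ℕ} (p : ℕ[X]) (hf : PolyBdd f) : PolyBdd fun i => p.eval (f i) := by
  obtain ⟨q, hq⟩ := hf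
  exact ⟨p.comp q, fun i => by simpa using eval_mono p (hq i)⟩

theorem descLen {n m s : ℕ → ℕ} (hn : PolyBdd n) (hm : PolyBdd m) (hs : PolyBdd s) :
    PolyBdd fun i => BCirc.descLen (n i) (m i) (s i) :=
  (((hs.add hs).add hm).mul (((const 2).add hn).add hs))

end PolyBdd

/-! ### Bit strings -/

@[simp] theorem Bits.left_append {a b : ℕ} (x : Bits a) (y : Bits b) :
    Bits.left (Fin.append x y) = x := by funext i; simp [Bits.left]

@[simp] theorem Bits.right_append {a b : ℕ} (x : Bits a) (y : Bits b) :
    Bits.right (Fin.append x y) = y := by funext i; simp [Bits.right]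

@[simp] theorem Bits.append_left_right {a b : ℕ} (x : Bits (a + b)) :
    Fin.append x.left x.right = x := Fin.append_castAdd_natAdd

theorem Bits.append_inj {a b : ℕ} {x x' : Bits a} {y y' : Bits b} :
    Fin.append x y = Fin.append x' y' ↔ x = x' ∧ y = y' := by
  constructor
  · intro h
    exact ⟨by simpa using congrArg Bits.left h, by simpa using congrArg Bits.right h⟩
  · rintro ⟨rfl, rfl⟩; rfl

theorem Bits.xor_xor_cancel {n : ℕ} (x y : Bits n) : (x.xor y).xor y = x := by
  funext i; simp [Bits.xor]

theorem Bits.xor_assoc {n : ℕ} (x y z : Bits n) : (x.xor y).xor z = x.xor (y.xor z) := by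
  funext i; simp [Bits.xor]

theorem Bits.single_injective : Function.Injective Bits.single := fun _ _ h => congrFun h 0

theorem Bits.eq_single (x : Bits 1) : x = Bits.single (x 0) := by
  funext i; rw [Subsingleton.elim i 0]; rfl

/-! ### Evaluation of Boolean circuits -/

namespace BCirc

variable {n m s : ℕ}

theorem val_congr (C : BCirc n m s) (x : Bits n) {w w' : ℕ} (h : w = w') (hw : w < 2 + n + s) :
    C.val x w hw = C.val x w' (h ▸ hw) := by subst h; rfl

theorem val_of_lt_two (C : BCirc n m s) (x : Bits n) {w : ℕ} (hw : w < 2 + n + s) (h : w < 2) :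
    C.val x w hw = decide (w = 1) := by
  rw [val, dif_pos h]

theorem val_input (C : BCirc n m s) (x : Bits n) {w : ℕ} (hw : w < 2 + n + s) (h2 : ¬ w < 2)
    (h : w < 2 + n) : C.val x w hw = x ⟨w - 2, by omega⟩ := by
  rw [val, dif_neg h2, dif_pos h]

theorem val_gate (C : BCirc n m s) (x : Bits n) (j : Fin s) :
    C.val x (2 + n + j) (by omega) =
      !(C.val x (C.gate j).1 (by have := (C.gate j).1.2; omega) &&
        C.val x (C.gate j).2 (by have := (C.gate j).2.2; omega)) := by
  rw [val, dif_neg (by omega), dif_neg (by omega)]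
  have : (⟨2 + n + (j : ℕ) - (2 + n), by omega⟩ : Fin s) = j := Fin.ext (by simp)
  dsimp only
  congr 2
  · exact val_congr _ _ (congrArg (fun j => ((C.gate j).1 : ℕ)) this) _
  · exact val_congr _ _ (congrArg (fun j => ((C.gate j).2 : ℕ)) this) _

theorem val_gate' (C : BCirc n m s) (x : Bits n) {w : ℕ} (hw : w < 2 + n + s)
    (h : ¬ w < 2 + n) :
    C.val x w hw =
      !(C.val x (C.gate ⟨w - (2 + n), by omega⟩).1
          (by have := (C.gate ⟨w - (2 + n), by omega⟩).1.2; simp only at this; omega) &&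
        C.val x (C.gate ⟨w - (2 + n), by omega⟩).2
          (by have := (C.gate ⟨w - (2 + n), by omega⟩).2.2; simp only at this; omega)) := by
  rw [val, dif_neg (by omega), dif_neg (by omega)]

theorem eval_apply (C : BCirc n m s) (x : Bits n) (i : Fin m) :
    C.eval x i = C.val x (C.out i) (C.out i).2 := rfl

theorem eval_wires {a b : ℕ} (f : Fin b → Bool ⊕ Fin a) (x : Bits a) (i : Fin b) :
    (wires f).eval x i = Sum.elim (fun c => c) x (f i) := by
  rw [eval_apply]
  rcases h : f i with c | j
  · have : ((wires f).out i : ℕ) = if c then 1 else 0 := by simp [wires, h]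
    rw [val_congr _ _ this, val_of_lt_two _ _ _ (by split <;> omega)]
    cases c <;> simp
  · have : ((wires f).out i : ℕ) = 2 + j := by simp [wires, h]
    rw [val_congr _ _ this, val_input _ _ _ (by omega) (by omega)]
    simp

theorem eval_id {a : ℕ} (x : Bits a) : (BCirc.id a).eval x = x := by
  funext i; simp [BCirc.id, eval_wires]

/-- The position in `comp C D` of the wire `w` of `D`. -/
def compReloc {a b c s t : ℕ} (C : BCirc a b s) (_ : BCirc b c t) (w : ℕ)
    (_ : w < 2 + b + t) : ℕ :=
  if h2 : w < 2 then w
  else if hb : w < 2 + b then C.out ⟨w - 2, by omega⟩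
  else 2 + a + s + (w - (2 + b))

theorem compReloc_lt {a b c s t : ℕ} (C : BCirc a b s) (D : BCirc b c t) {w : ℕ}
    (hw : w < 2 + b + t) : compReloc C D w hw < 2 + a + (s + t) := by
  unfold compReloc
  split_ifs with h2 hb
  · omega
  · have := (C.out ⟨w - 2, by omega⟩).2; omega
  · omega

theorem comp_gate_lt {a b c s t : ℕ} (C : BCirc a b s) (D : BCirc b c t) (j : Fin (s + t))
    (h : (j : ℕ) < s) : (comp C D).gate j = C.gate ⟨j, h⟩ := by
  simp [comp, h]

theorem comp_gate_fst {a b c s t : ℕ} (C : BCirc a b s) (D : BCirc b c t) (j : Fin t)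
    (j' : Fin (s + t)) (h : (j' : ℕ) = s + j) :
    (((comp C D).gate j').1 : ℕ) = compReloc C D (D.gate j).1 (by have := (D.gate j).1.2; omega) := by
  have : ¬ (j' : ℕ) < s := by omega
  obtain ⟨j, hj⟩ := j
  obtain rfl : j = j' - s := by simp only at h; omega
  simp only [comp, this, dite_false, Fin.val_castLE]
  unfold compReloc
  split_ifs <;> simp

theorem comp_gate_snd {a b c s t : ℕ} (C : BCirc a b s) (D : BCirc b c t) (j : Fin t)
    (j' : Fin (s + t)) (h : (j' : ℕ) = s + j) :
    (((comp C D).gate j').2 : ℕ) = compReloc C D (D.gate j).2 (by have := (D.gate j).2.2; omega) := by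
  have : ¬ (j' : ℕ) < s := by omega
  obtain ⟨j, hj⟩ := j
  obtain rfl : j = j' - s := by simp only at h; omega
  simp only [comp, this, dite_false, Fin.val_castLE]
  unfold compReloc
  split_ifs <;> simp

theorem comp_out {a b c s t : ℕ} (C : BCirc a b s) (D : BCirc b c t) (i : Fin c) :
    ((comp C D).out i : ℕ) = compReloc C D (D.out i) (D.out i).2 := by
  simp only [comp]
  unfold compReloc
  split_ifs <;> simp

theorem val_comp_left {a b c s t : ℕ} (C : BCirc a b s) (D : BCirc b c t) (x : Bits a) (w : ℕ)
    (hw : w < 2 + a + s) : (comp C D).val x w (by omega) = C.val x w hw := by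
  induction w using Nat.strong_induction_on with
  | _ w ih =>
    by_cases h2 : w < 2
    · rw [val_of_lt_two _ _ _ h2, val_of_lt_two _ _ _ h2]
    by_cases ha : w < 2 + a
    · rw [val_input _ _ _ h2 ha, val_input _ _ _ h2 ha]
    rw [val_gate' _ _ _ ha, val_gate' _ _ _ ha]
    have e := comp_gate_lt C D ⟨w - (2 + a), by omega⟩ (by simp only; omega)
    have h1 := (C.gate ⟨w - (2 + a), by omega⟩).1.2
    have h3 := (C.gate ⟨w - (2 + a), by omega⟩).2.2
    simp only at h1 h3
    congr 2
    · rw [← ih _ (by omega)]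
      exact val_congr _ _ (by rw [e]) _
    · rw [← ih _ (by omega)]
      exact val_congr _ _ (by rw [e]) _

theorem val_comp_right {a b c s t : ℕ} (C : BCirc a b s) (D : BCirc b c t) (x : Bits a) (w : ℕ)
    (hw : w < 2 + b + t) :
    (comp C D).val x (compReloc C D w hw) (compReloc_lt C D hw) = D.val (C.eval x) w hw := by
  induction w using Nat.strong_induction_on with
  | _ w ih =>
    by_cases h2 : w < 2
    · rw [val_of_lt_two _ _ _ h2, val_congr _ _ (show compReloc C D w hw = w by simp [compReloc, h2]),
        val_of_lt_two _ _ _ h2]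
    by_cases hb : w < 2 + b
    · rw [val_input _ _ _ h2 hb, val_congr _ _
        (show compReloc C D w hw = C.out ⟨w - 2, by omega⟩ by simp [compReloc, h2, hb]),
        val_comp_left _ _ _ _ (C.out _).2]
      rfl
    have e : compReloc C D w hw = 2 + a + (s + (w - (2 + b))) := by
      simp [compReloc, h2, hb]; omega
    rw [val_congr _ _ e, val_gate' _ _ _ (show ¬ w < 2 + b by omega),
      val_gate (comp C D) x ⟨s + (w - (2 + b)), by omega⟩]
    have h1 := (D.gate ⟨w - (2 + b), by omega⟩).1.2
    have h3 := (D.gate ⟨w - (2 + b), by omega⟩).2.2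
    simp only at h1 h3
    congr 2
    · rw [← ih _ (by omega)]
      exact val_congr _ _ (comp_gate_fst C D ⟨w - (2 + b), by omega⟩ _ rfl) _
    · rw [← ih _ (by omega)]
      exact val_congr _ _ (comp_gate_snd C D ⟨w - (2 + b), by omega⟩ _ rfl) _

theorem eval_comp {a b c s t : ℕ} (C : BCirc a b s) (D : BCirc b c t) (x : Bits a) :
    (comp C D).eval x = D.eval (C.eval x) := by
  funext i
  rw [eval_apply, eval_apply, ← val_comp_right, val_congr _ _ (comp_out C D i)]

/-- The position in `par C D` of the wire `w` of `C`. -/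
def parRelocL (a c w : ℕ) : ℕ := if w < 2 + a then w else w + c

/-- The position in `par C D` of the wire `w` of `D`. -/
def parRelocR (a s c w : ℕ) : ℕ :=
  if w < 2 then w else if w < 2 + c then a + w else a + s + w

theorem par_gate_lt {a b c d s t : ℕ} (C : BCirc a b s) (D : BCirc c d t) (j : Fin s)
    (j' : Fin (s + t)) (h : (j' : ℕ) = j) :
    (((par C D).gate j').1 : ℕ) = parRelocL a c (C.gate j).1 ∧
      (((par C D).gate j').2 : ℕ) = parRelocL a c (C.gate j).2 := by
  obtain ⟨j', hj'⟩ := j'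
  simp only at h
  subst h
  simp only [par, j.2, dite_true, parRelocL]
  constructor <;> split_ifs <;> simp

theorem par_gate_ge {a b c d s t : ℕ} (C : BCirc a b s) (D : BCirc c d t) (j : Fin t)
    (j' : Fin (s + t)) (h : (j' : ℕ) = s + j) :
    (((par C D).gate j').1 : ℕ) = parRelocR a s c (D.gate j).1 ∧
      (((par C D).gate j').2 : ℕ) = parRelocR a s c (D.gate j).2 := by
  have : ¬ (j' : ℕ) < s := by omega
  obtain ⟨j, hj⟩ := j
  obtain rfl : j = j' - s := by simp only at h; omega
  simp only [par, this, dite_false, Fin.val_castLE, parRelocR]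
  constructor <;> split_ifs <;> simp

theorem val_par_left {a b c d s t : ℕ} (C : BCirc a b s) (D : BCirc c d t) (x : Bits (a + c))
    (w : ℕ) (hw : w < 2 + a + s) :
    (par C D).val x (parRelocL a c w) (by unfold parRelocL; split_ifs <;> omega) =
      C.val x.left w hw := by
  induction w using Nat.strong_induction_on with
  | _ w ih =>
    by_cases h2 : w < 2
    · have e : parRelocL a c w = w := if_pos (by omega)
      rw [val_of_lt_two _ _ _ h2, val_congr _ _ e, val_of_lt_two _ _ _ h2]
    by_cases ha : w < 2 + a
    · have e : parRelocL a c w = w := if_pos (by omega)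
      rw [val_input _ _ _ h2 ha, val_congr _ _ e, val_input _ _ _ h2 (by omega)]
      rfl
    have e : parRelocL a c w = 2 + (a + c) + (w - (2 + a)) := by
      rw [parRelocL, if_neg (by omega)]; omega
    have h1 := (C.gate ⟨w - (2 + a), by omega⟩).1.2
    have h3 := (C.gate ⟨w - (2 + a), by omega⟩).2.2
    simp only at h1 h3
    have g := par_gate_lt C D ⟨w - (2 + a), by omega⟩ ⟨w - (2 + a), by omega⟩ rfl
    rw [val_congr _ _ e, val_gate' _ _ _ ha, val_gate (par C D) x ⟨w - (2 + a), by omega⟩]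
    congr 2
    · rw [← ih _ (by omega)]
      exact val_congr _ _ g.1 _
    · rw [← ih _ (by omega)]
      exact val_congr _ _ g.2 _

theorem val_par_right {a b c d s t : ℕ} (C : BCirc a b s) (D : BCirc c d t) (x : Bits (a + c))
    (w : ℕ) (hw : w < 2 + c + t) :
    (par C D).val x (parRelocR a s c w) (by unfold parRelocR; split_ifs <;> omega) =
      D.val x.right w hw := by
  induction w using Nat.strong_induction_on with
  | _ w ih =>
    by_cases h2 : w < 2
    · have e : parRelocR a s c w = w := if_pos (by omega)
      rw [val_of_lt_two _ _ _ h2, val_congr _ _ e, val_of_lt_two _ _ _ h2]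
    by_cases ha : w < 2 + c
    · have e : parRelocR a s c w = a + w := by rw [parRelocR, if_neg h2, if_pos ha]
      rw [val_input _ _ _ h2 ha, val_congr _ _ e, val_input _ _ _ (by omega) (by omega)]
      exact congrArg x (Fin.ext (by simp; omega))
    have e : parRelocR a s c w = 2 + (a + c) + (s + (w - (2 + c))) := by
      rw [parRelocR, if_neg h2, if_neg ha]; omega
    have h1 := (D.gate ⟨w - (2 + c), by omega⟩).1.2
    have h3 := (D.gate ⟨w - (2 + c), by omega⟩).2.2
    simp only at h1 h3
    have g := par_gate_ge C D ⟨w - (2 + c), by omega⟩ ⟨s + (w - (2 + c)), by omega⟩ rfl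
    rw [val_congr _ _ e, val_gate' _ _ _ ha, val_gate (par C D) x ⟨s + (w - (2 + c)), by omega⟩]
    congr 2
    · rw [← ih _ (by omega)]
      exact val_congr _ _ g.1 _
    · rw [← ih _ (by omega)]
      exact val_congr _ _ g.2 _

theorem eval_par {a b c d s t : ℕ} (C : BCirc a b s) (D : BCirc c d t) (x : Bits (a + c)) :
    (par C D).eval x = Fin.append (C.eval x.left) (D.eval x.right) := by
  funext i
  rw [eval_apply]
  refine Fin.addCases (fun i => ?_) (fun i => ?_) i
  · rw [Fin.append_left, eval_apply, ← val_par_left C D]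
    apply val_congr
    simp only [par, Fin.append_left, parRelocL]
    split_ifs <;> simp
  · rw [Fin.append_right, eval_apply, ← val_par_right C D]
    apply val_congr
    simp only [par, Fin.append_right, parRelocR]
    split_ifs <;> simp

theorem eval_hardwire {a b c s : ℕ} (E : BCirc (a + b) c s) (k : Bits a) (x : Bits b) :
    (E.hardwire k).eval x = E.eval (Fin.append k x) := by
  rw [hardwire, eval_comp]
  congr 1
  funext i
  rw [eval_wires]
  refine Fin.addCases (fun i => ?_) (fun i => ?_) i <;> simp

theorem eval_xorCirc (n : ℕ) (z : Bits (n + n)) : (xorCirc n).eval z = z.left.xor z.right := by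
  funext i
  -- the values of the four gates that belong to bit `i`
  have v : ∀ r : Fin 4, (xorCirc n).val z (2 + (n + n) + (4 * i + r)) (by omega) =
      ![!(z.left i && z.right i), !(z.left i && !(z.left i && z.right i)),
        !(z.right i && !(z.left i && z.right i)), Bool.xor (z.left i) (z.right i)] r := by
    have vL : ∀ w, (hw : w = 2 + (i : ℕ)) → (xorCirc n).val z w (by omega) = z.left i := by
      rintro w rfl
      rw [val_input _ _ _ (by omega) (by omega)]
      exact congrArg z (Fin.ext (by simp))
    have vR : ∀ w, (hw : w = 2 + n + (i : ℕ)) → (xorCirc n).val z w (by omega) = z.right i := by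
      rintro w rfl
      rw [val_input _ _ _ (by omega) (by omega)]
      exact congrArg z (Fin.ext (by simp; omega))
    have d : ∀ r : Fin 4, (4 * (i : ℕ) + r) / 4 = i ∧ (4 * (i : ℕ) + r) % 4 = r := by
      intro r; omega
    have v0 : (xorCirc n).val z (2 + (n + n) + (4 * i)) (by omega) =
        !(z.left i && z.right i) := by
      rw [val_gate (xorCirc n) z ⟨4 * i, by omega⟩, vL _ (by simp [xorCirc]),
        vR _ (by simp [xorCirc])]
    have v1 : (xorCirc n).val z (2 + (n + n) + (4 * i + 1)) (by omega) =
        !(z.left i && !(z.left i && z.right i)) := by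
      have := d 1
      simp only [Fin.val_one] at this
      rw [val_gate (xorCirc n) z ⟨4 * i + 1, by omega⟩, vL _ (by simp [xorCirc, this]), ← v0]
      congr 2
      exact val_congr _ _ (by simp [xorCirc, this]) _
    have v2 : (xorCirc n).val z (2 + (n + n) + (4 * i + 2)) (by omega) =
        !(z.right i && !(z.left i && z.right i)) := by
      have := d 2
      simp only [Fin.val_two] at this
      rw [val_gate (xorCirc n) z ⟨4 * i + 2, by omega⟩, vR _ (by simp [xorCirc, this]), ← v0]
      congr 2
      exact val_congr _ _ (by simp [xorCirc, this]) _
    intro r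
    match r with
    | 0 => exact v0
    | 1 => exact v1
    | 2 => exact v2
    | 3 =>
      have := d 3
      have h3 : ((3 : Fin 4) : ℕ) = 3 := rfl
      rw [h3] at this
      have e : (xorCirc n).val z (2 + (n + n) + (4 * i + 3)) (by omega) =
          !((xorCirc n).val z (2 + (n + n) + (4 * i + 1)) (by omega) &&
            (xorCirc n).val z (2 + (n + n) + (4 * i + 2)) (by omega)) := by
        rw [val_gate (xorCirc n) z ⟨4 * i + 3, by omega⟩]
        congr 2
        · exact val_congr _ _ (by simp [xorCirc, this]; omega) _
        · exact val_congr _ _ (by simp [xorCirc, this]; omega) _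
      refine e.trans ?_
      rw [v1, v2]
      cases z.left i <;> cases z.right i <;> rfl
  exact v 3

/-- The circuit `C` with unused gates added up to size `t`. -/
def padTo {a b s : ℕ} (C : BCirc a b s) (t : ℕ) (h : s ≤ t) : BCirc a b t where
  gate j := if h : (j : ℕ) < s then C.gate ⟨j, h⟩ else (⟨0, by omega⟩, ⟨0, by omega⟩)
  out i := Fin.castLE (by omega) (C.out i)

theorem pad_eq_padTo {a b s : ℕ} (C : BCirc a b s) (p : ℕ) :
    C.pad p = C.padTo (s + p) (Nat.le_add_right s p) := rfl

theorem eval_padTo {a b s : ℕ} (C : BCirc a b s) (t : ℕ) (h : s ≤ t) (x : Bits a) :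
    (C.padTo t h).eval x = C.eval x := by
  have key : ∀ w (hw : w < 2 + a + s), (C.padTo t h).val x w (by omega) = C.val x w hw := by
    intro w
    induction w using Nat.strong_induction_on with
    | _ w ih =>
      intro hw
      by_cases h2 : w < 2
      · rw [val_of_lt_two _ _ _ h2, val_of_lt_two _ _ _ h2]
      by_cases ha : w < 2 + a
      · rw [val_input _ _ _ h2 ha, val_input _ _ _ h2 ha]
      rw [val_gate' _ _ _ ha, val_gate' _ _ _ ha]
      have e : (C.padTo t h).gate ⟨w - (2 + a), by omega⟩ = C.gate ⟨w - (2 + a), by omega⟩ :=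
        dif_pos (show w - (2 + a) < s by omega)
      have h1 := (C.gate ⟨w - (2 + a), by omega⟩).1.2
      have h3 := (C.gate ⟨w - (2 + a), by omega⟩).2.2
      simp only at h1 h3
      congr 2
      · rw [← ih _ (by omega)]
        exact val_congr _ _ (by rw [e]) _
      · rw [← ih _ (by omega)]
        exact val_congr _ _ (by rw [e]) _
  funext i
  exact key _ _

theorem decode_encode (C : BCirc n m s) : decode C.encode = C :=
  Function.leftInverse_invFun encode_injective C

end BCirc

/-! ### Functions computed by small Boolean circuits -/

/-- `f x` is computed from the encoding `e x` of `x` by a Boolean circuit with at most `s` gates. -/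
def ComputesOn {X : Type*} {a b : ℕ} (e : X → Bits a) (s : ℕ) (f : X → Bits b) : Prop :=
  ∃ t ≤ s, ∃ C : BCirc a b t, ∀ x, C.eval (e x) = f x

/-- The Boolean `f x` is computed from `e x` by a circuit with at most `s` gates. -/
def ComputesBit {X : Type*} {a : ℕ} (e : X → Bits a) (s : ℕ) (f : X → Bool) : Prop :=
  ComputesOn e s fun x => Bits.single (f x)

namespace ComputesOn

variable {X : Type*} {a b c s t : ℕ} {e : X → Bits a}

theorem mono {f : X → Bits b} (h : ComputesOn e s f) (hst : s ≤ t) : ComputesOn e t f := by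
  obtain ⟨u, hu, C, hC⟩ := h
  exact ⟨u, hu.trans hst, C, hC⟩

theorem congr {f g : X → Bits b} (h : ComputesOn e s f) (hfg : ∀ x, f x = g x) :
    ComputesOn e s g := by
  rwa [← show f = g from funext hfg]

theorem trans {f : X → Bits b} {g : X → Bits c} (hf : ComputesOn e s f) (hg : ComputesOn f t g) :
    ComputesOn e (s + t) g := by
  obtain ⟨u, hu, C, hC⟩ := hf
  obtain ⟨v, hv, D, hD⟩ := hg
  exact ⟨u + v, add_le_add hu hv, C.comp D, fun x => by rw [BCirc.eval_comp, hC, hD]⟩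

theorem wires (φ : Fin b → Bool ⊕ Fin a) :
    ComputesOn e 0 fun x i => Sum.elim (fun c => c) (e x) (φ i) :=
  ⟨0, le_rfl, BCirc.wires φ, fun x => by funext i; rw [BCirc.eval_wires]⟩

theorem refl : ComputesOn e 0 e := wires fun i => Sum.inr i

theorem const (y : Bits b) : ComputesOn e 0 fun _ => y := wires fun i => Sum.inl (y i)

theorem append {f : X → Bits b} {g : X → Bits c} (hf : ComputesOn e s f)
    (hg : ComputesOn e t g) : ComputesOn e (s + t) fun x => Fin.append (f x) (g x) := by
  obtain ⟨u, hu, C, hC⟩ := hf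
  obtain ⟨v, hv, D, hD⟩ := hg
  have hd : ComputesOn e 0 fun x => Fin.append (e x) (e x) := by
    obtain ⟨w, hw, E, hE⟩ := wires (e := e) (Fin.append (fun i => Sum.inr i) (fun i => Sum.inr i))
    refine ⟨w, hw, E, fun x => (hE x).trans ?_⟩
    funext i
    refine Fin.addCases (fun i => ?_) (fun i => ?_) i
    · simp only [Fin.append_left, Sum.elim_inr]
    · simp only [Fin.append_right, Sum.elim_inr]
  refine (hd.trans (t := s + t) ⟨u + v, add_le_add hu hv, C.par D, fun x => ?_⟩).mono (by omega)
  rw [BCirc.eval_par, Bits.left_append, Bits.right_append, hC, hD]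

theorem left {f : X → Bits (b + c)} (hf : ComputesOn e s f) : ComputesOn e s fun x => (f x).left :=
  hf.trans (t := 0) (wires fun i => Sum.inr (Fin.castAdd c i))

theorem right {f : X → Bits (b + c)} (hf : ComputesOn e s f) :
    ComputesOn e s fun x => (f x).right :=
  hf.trans (t := 0) (wires fun i => Sum.inr (Fin.natAdd b i))

theorem bit {f : X → Bits b} (hf : ComputesOn e s f) (i : Fin b) :
    ComputesBit e s fun x => f x i :=
  hf.trans (t := 0) (wires fun _ => Sum.inr i)

end ComputesOn

namespace ComputesBit

variable {X : Type*} {a m s t : ℕ} {e : X → Bits a}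

theorem mono {f : X → Bool} (h : ComputesBit e s f) (hst : s ≤ t) : ComputesBit e t f :=
  ComputesOn.mono h hst

theorem proj (i : Fin a) : ComputesBit e 0 fun x => e x i := ComputesOn.refl.bit i

theorem const (b : Bool) : ComputesBit e 0 fun _ => b := ComputesOn.const _

theorem congr {f g : X → Bool} (h : ComputesBit e s f) (hfg : ∀ x, f x = g x) :
    ComputesBit e s g := by
  rwa [← show f = g from funext hfg]

/-- The circuit that consists of one gate. -/
def nandCirc : BCirc (1 + 1) 1 1 where
  gate _ := (⟨2, by omega⟩, ⟨3, by omega⟩)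
  out _ := ⟨4, by omega⟩

theorem nand {f g : X → Bool} (hf : ComputesBit e s f) (hg : ComputesBit e t g) :
    ComputesBit e (s + t + 1) fun x => !(f x && g x) := by
  refine (ComputesOn.append hf hg).trans ⟨1, le_rfl, nandCirc, fun x => ?_⟩
  funext i
  rw [BCirc.eval_apply]
  have := BCirc.val_gate nandCirc (Fin.append (Bits.single (f x)) (Bits.single (g x))) 0
  refine Eq.trans this ?_
  rw [BCirc.val_input _ _ _ (by simp [nandCirc]) (by simp [nandCirc]),
    BCirc.val_input _ _ _ (by simp [nandCirc]) (by simp [nandCirc])]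
  rfl

theorem not {f : X → Bool} (hf : ComputesBit e s f) : ComputesBit e (s + 1) fun x => !f x := by
  have := hf.nand (const true)
  simpa using this

theorem and {f g : X → Bool} (hf : ComputesBit e s f) (hg : ComputesBit e t g) :
    ComputesBit e (s + t + 2) fun x => f x && g x := by
  simpa using (hf.nand hg).not

theorem or {f g : X → Bool} (hf : ComputesBit e s f) (hg : ComputesBit e t g) :
    ComputesBit e (s + t + 3) fun x => f x || g x := by
  have := (hf.not.nand hg.not).mono (show s + 1 + (t + 1) + 1 ≤ s + t + 3 by omega)
  simpa using this

theorem forall_fin {f : Fin m → X → Bool} (hf : ∀ i, ComputesBit e s (f i)) :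
    ComputesBit e (m * (s + 2)) fun x => decide (∀ i, f i x = true) := by
  induction m with
  | zero => simpa using (const true : ComputesBit e 0 _)
  | succ m ih =>
    have h := ((ih fun i => hf i.castSucc).and (hf (Fin.last m))).mono
      (show m * (s + 2) + s + 2 ≤ (m + 1) * (s + 2) by ring_nf; omega)
    convert h using 2 with x
    simp [Fin.forall_fin_succ']

theorem exists_fin {f : Fin m → X → Bool} (hf : ∀ i, ComputesBit e s (f i)) :
    ComputesBit e (m * (s + 3)) fun x => decide (∃ i, f i x = true) := by
  induction m with
  | zero => simpa using (const false : ComputesBit e 0 _)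
  | succ m ih =>
    have h := ((ih fun i => hf i.castSucc).or (hf (Fin.last m))).mono
      (show m * (s + 3) + s + 3 ≤ (m + 1) * (s + 3) by ring_nf; omega)
    convert h using 2 with x
    simp [Fin.exists_fin_succ']

end ComputesBit

theorem Fin.append_single {m : ℕ} (x : Bits m) (b : Bool) :
    (Fin.append x (Bits.single b) : Bits (m + 1)) = Fin.snoc x b := by
  rw [Fin.append_right_eq_snoc]; rfl

namespace ComputesOn

variable {X : Type*} {a b c s t n m : ℕ} {e : X → Bits a}

theorem of_bits {f : X → Bits m} (hf : ∀ i, ComputesBit e s fun x => f x i) :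
    ComputesOn e (m * s) f := by
  induction m with
  | zero =>
    have := const (e := e) (fun i : Fin 0 => i.elim0)
    convert this.mono (Nat.zero_le (0 * s)) using 2
  | succ m ih =>
    have h := ComputesOn.append (ih (f := fun x i => f x i.castSucc) fun i => hf i.castSucc)
      (hf (Fin.last m))
    refine (h.mono (show _ ≤ (m + 1) * s by rw [Nat.succ_mul])).congr fun x => ?_
    rw [Fin.append_single]
    funext i
    refine Fin.lastCases ?_ (fun i => ?_) i <;> simp

theorem xor {f g : X → Bits b} (hf : ComputesOn e s f) (hg : ComputesOn e t g) :
    ComputesOn e (s + t + 4 * b) fun x => (f x).xor (g x) :=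
  (hf.append hg).trans ⟨_, le_rfl, BCirc.xorCirc b, fun x => by
    rw [BCirc.eval_xorCirc, Bits.left_append, Bits.right_append]⟩

theorem decide_eq {f g : X → Bits b} (hf : ComputesOn e s f) (hg : ComputesOn e t g) :
    ComputesBit e (s + t + b * 9) fun x => decide (f x = g x) := by
  refine trans (hf.append hg) ?_
  have : ∀ i : Fin b, ComputesBit (fun x => Fin.append (f x) (g x)) 7 fun x => f x i == g x i := by
    intro i
    have h1 := ComputesBit.proj (e := fun x => Fin.append (f x) (g x)) (Fin.castAdd b i)
    have h2 := ComputesBit.proj (e := fun x => Fin.append (f x) (g x)) (Fin.natAdd b i)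
    simp only [Fin.append_left, Fin.append_right] at h1 h2
    refine (((h1.nand h2).nand (h1.not.nand h2.not)).mono (t := 7) (by omega)).congr fun x => ?_
    cases f x i <;> cases g x i <;> rfl
  exact (ComputesBit.forall_fin this).congr fun x => by simp [funext_iff]

theorem ite {u : X → Bool} {f g : X → Bits b} {r : ℕ} (hu : ComputesBit e r u)
    (hf : ComputesOn e s f) (hg : ComputesOn e t g) :
    ComputesOn e (r + s + t + b * 8) fun x => if u x = true then f x else g x := by
  refine trans ((ComputesOn.append hu hf).append hg) (of_bits fun i => ?_)
  set e' := fun x => Fin.append (Fin.append (Bits.single (u x)) (f x)) (g x) with he'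
  have h0 : ComputesBit e' 0 u :=
    (ComputesBit.proj (e := e') (Fin.castAdd b (Fin.castAdd b 0))).congr fun x => by
      simp only [he', Fin.append_left]; rfl
  have h1 : ComputesBit e' 0 fun x => f x i := by
    have := ComputesBit.proj (e := e') (Fin.castAdd b (Fin.natAdd 1 i))
    simpa [he'] using this
  have h2 : ComputesBit e' 0 fun x => g x i := by
    have := ComputesBit.proj (e := e') (Fin.natAdd (1 + b) i)
    simpa [he'] using this
  refine (((h0.nand h1).nand (h0.not.nand h2)).mono (t := 8) (by omega)).congr fun x => ?_
  cases h : u x <;> simp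

end ComputesOn

/-! ### Universal evaluation -/

namespace BCirc

variable {n m s : ℕ}

/-- The value on a wire that is given by its one-hot description. -/
theorem exists_encode_and_val (C : BCirc n m s) (x : Bits n) (q : Fin (s + s + m)) (j : ℕ)
    (hj : j ≤ s) (h : (C.refs q : ℕ) < 2 + n + j) :
    C.val x (C.refs q) (C.refs q).2 = decide (∃ w : Fin (2 + n + j),
      (C.encode (finProdFinEquiv (q, Fin.castLE (by omega) w)) &&
        C.val x w (by omega)) = true) := by
  rw [Bool.eq_iff_iff]
  simp only [encode, Equiv.symm_apply_apply, Bool.and_eq_true, decide_eq_true_eq]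
  constructor
  · exact fun hv => ⟨⟨C.refs q, h⟩, rfl, hv⟩
  · rintro ⟨w, hw, hv⟩
    rw [val_congr C x (congrArg Fin.val hw)]
    exact hv

theorem computesBit_ref {X : Type*} {a : ℕ} {e : X → Bits a} {C : X → BCirc n m s} {x : X → Bits n}
    (q : Fin (s + s + m)) (j : ℕ) (hj : j ≤ s) (h : ∀ z, ((C z).refs q : ℕ) < 2 + n + j)
    (hC : ComputesOn e 0 fun z => (C z).encode)
    (hv : ComputesOn e 0 fun z (w : Fin (2 + n + j)) => (C z).val (x z) w (by omega)) :
    ComputesBit e ((2 + n + s) * 5) fun z => (C z).val (x z) ((C z).refs q) ((C z).refs q).2 := by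
  have := ComputesBit.exists_fin fun w : Fin (2 + n + j) =>
    (hC.bit (finProdFinEquiv (q, Fin.castLE (by omega) w))).and (hv.bit w)
  exact (this.mono (Nat.mul_le_mul (show _ ≤ 2 + n + s by omega) le_rfl)).congr fun z =>
    (exists_encode_and_val _ _ q j hj (h z)).symm

theorem computesOn_val {X : Type*} {a : ℕ} {e : X → Bits a} {C : X → BCirc n m s} {x : X → Bits n}
    (hC : ComputesOn e 0 fun z => (C z).encode) (hx : ComputesOn e 0 x) (j : ℕ) (hj : j ≤ s) :
    ComputesOn e (j * ((2 + n + s) * 10 + 1))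
      fun z (w : Fin (2 + n + j)) => (C z).val (x z) w (by omega) := by
  induction j with
  | zero =>
    have h := (ComputesOn.append (ComputesOn.const (e := e) (![false, true] : Bits 2)) hx)
    rw [Nat.zero_mul]
    refine h.congr fun z => ?_
    funext w
    refine Fin.addCases (fun w => ?_) (fun w => ?_) (w : Fin (2 + n))
    · have hw := w.2
      rw [Fin.append_left, val_of_lt_two _ _ _ (by simp only [Fin.val_castAdd]; omega)]
      fin_cases w <;> simp
    · rw [Fin.append_right, val_input _ _ _ (by simp only [Fin.val_natAdd]; omega)
        (by simp only [Fin.val_natAdd]; omega)]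
      simp
  | succ j ih =>
    specialize ih (by omega)
    have hall := (ComputesOn.refl (e := e)).append ih
    rw [Nat.zero_add] at hall
    set v := fun z (w : Fin (2 + n + j)) => (C z).val (x z) w (by omega) with hv
    set e' := fun z => Fin.append (e z) (v z) with he'
    have hE : ComputesOn e' 0 e := by
      have := (ComputesOn.refl (e := e')).left
      simpa [he'] using this
    have hV : ComputesOn e' 0 v := by
      have := (ComputesOn.refl (e := e')).right
      simpa [he'] using this
    have hC' : ComputesOn e' 0 fun z => (C z).encode := hE.trans hC
    have g1 := computesBit_ref (Fin.castAdd m (Fin.castAdd s ⟨j, by omega⟩)) j (by omega)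
      (fun z => by
        have := ((C z).gate ⟨j, by omega⟩).1.2
        simpa only [refs, Fin.append_left, Fin.append_right, Fin.val_castLE] using this) hC' hV
    have g2 := computesBit_ref (Fin.castAdd m (Fin.natAdd s ⟨j, by omega⟩)) j (by omega)
      (fun z => by
        have := ((C z).gate ⟨j, by omega⟩).2.2
        simpa only [refs, Fin.append_left, Fin.append_right, Fin.val_castLE] using this) hC' hV
    have := hall.trans (hV.append (g1.nand g2))
    refine (this.mono (t := (j + 1) * ((2 + n + s) * 10 + 1)) (by ring_nf; omega)).congr fun z => ?_
    rw [Fin.append_single]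
    funext w
    refine Fin.lastCases ?_ (fun w => ?_) (w : Fin (2 + n + j + 1))
    · rw [Fin.snoc_last]
      have := val_gate (C z) (x z) ⟨j, by omega⟩
      refine (congrArg₂ (fun p q => !(p && q)) (val_congr _ _ ?_ _) (val_congr _ _ ?_ _)).trans
        this.symm
      · simp only [refs, Fin.append_left, Fin.val_castLE]
      · simp only [refs, Fin.append_left, Fin.append_right, Fin.val_castLE]
    · rw [Fin.snoc_castSucc]; rfl

/-- A circuit that is given by its description can be evaluated by a circuit of polynomial size. -/
theorem computesOn_eval {X : Type*} {a : ℕ} {e : X → Bits a} {C : X → BCirc n m s}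
    {x : X → Bits n} (hC : ComputesOn e 0 fun z => (C z).encode) (hx : ComputesOn e 0 x) :
    ComputesOn e (s * ((2 + n + s) * 10 + 1) + m * ((2 + n + s) * 5))
      fun z => (C z).eval (x z) := by
  have hall := (ComputesOn.refl (e := e)).append (computesOn_val hC hx s le_rfl)
  rw [Nat.zero_add] at hall
  set v := fun z (w : Fin (2 + n + s)) => (C z).val (x z) w (by omega) with hv
  set e' := fun z => Fin.append (e z) (v z) with he'
  have hE : ComputesOn e' 0 e := by
    have := (ComputesOn.refl (e := e')).left
    simpa [he'] using this
  have hV : ComputesOn e' 0 v := by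
    have := (ComputesOn.refl (e := e')).right
    simpa [he'] using this
  refine hall.trans (ComputesOn.of_bits fun i => ?_)
  have := computesBit_ref (Fin.natAdd (s + s) i) s le_rfl (fun z => ((C z).refs _).2)
    (hE.trans hC) hV
  refine this.congr fun z => ?_
  rw [eval_apply]
  exact val_congr _ _ (by simp only [refs, Fin.append_right]) _

end BCirc

/-! ### Classical polynomial time on encoded data -/

/-- Types whose elements are described by bit strings of a fixed length. -/
class Enc (X : Type) where
  len : ℕ
  enc : X → Bits len

open Enc

instance (n : ℕ) : Enc (Bits n) := ⟨n, fun x => x⟩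

instance {n m s : ℕ} : Enc (BCirc n m s) := ⟨BCirc.descLen n m s, BCirc.encode⟩

instance {X Y : Type} [Enc X] [Enc Y] : Enc (X × Y) :=
  ⟨len X + len Y, fun p => Fin.append (enc p.1) (enc p.2)⟩

/-- The family `f` of functions is computed by Boolean circuits of polynomial size. -/
structure PEff {X Y : ℕ → Type} [∀ i, Enc (X i)] [∀ i, Enc (Y i)] (f : ∀ i, X i → Y i) :
    Prop where
  dom : PolyBdd fun i => len (X i)
  cod : PolyBdd fun i => len (Y i)
  circ : ∃ s : ℕ → ℕ, PolyBdd s ∧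
    ∀ i, ComputesOn (enc : X i → Bits (len (X i))) (s i) fun x => enc (f i x)

theorem ComputesOn.precomp {X Y : Type*} {a b s : ℕ} {e : X → Bits a} {f : X → Bits b}
    (h : ComputesOn e s f) (g : Y → X) : ComputesOn (fun y => e (g y)) s fun y => f (g y) := by
  obtain ⟨t, ht, C, hC⟩ := h
  exact ⟨t, ht, C, fun y => hC _⟩

namespace PEff

variable {X Y Z W : ℕ → Type} [∀ i, Enc (X i)] [∀ i, Enc (Y i)] [∀ i, Enc (Z i)]
  [∀ i, Enc (W i)] {a b n m s : ℕ → ℕ}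

theorem id (h : PolyBdd fun i => len (X i)) : PEff fun i (x : X i) => x :=
  ⟨h, h, fun _ => 0, .const 0, fun _ => ComputesOn.refl⟩

theorem const (h : PolyBdd fun i => len (X i)) (h' : PolyBdd fun i => len (Y i))
    (y : ∀ i, Y i) : PEff fun i (_ : X i) => y i :=
  ⟨h, h', fun _ => 0, .const 0, fun _ => ComputesOn.const _⟩

theorem comp {g : ∀ i, Y i → Z i} {f : ∀ i, X i → Y i} (hg : PEff g) (hf : PEff f) :
    PEff fun i x => g i (f i x) := by
  obtain ⟨s, hs, hf'⟩ := hf.circ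
  obtain ⟨t, ht, hg'⟩ := hg.circ
  exact ⟨hf.dom, hg.cod, _, hs.add ht, fun i => (hf' i).trans ((hg' i).precomp (f i))⟩

theorem pair {f : ∀ i, X i → Y i} {g : ∀ i, X i → Z i} (hf : PEff f) (hg : PEff g) :
    PEff fun i x => (f i x, g i x) := by
  obtain ⟨s, hs, hf'⟩ := hf.circ
  obtain ⟨t, ht, hg'⟩ := hg.circ
  exact ⟨hf.dom, hf.cod.add hg.cod, _, hs.add ht, fun i => (hf' i).append (hg' i)⟩

theorem fst {f : ∀ i, X i → Y i × Z i} (hf : PEff f) : PEff fun i x => (f i x).1 := by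
  obtain ⟨s, hs, hf'⟩ := hf.circ
  exact ⟨hf.dom, hf.cod.mono fun i => Nat.le_add_right _ _, s, hs, fun i =>
    (hf' i).left.congr fun x => Bits.left_append _ _⟩

theorem snd {f : ∀ i, X i → Y i × Z i} (hf : PEff f) : PEff fun i x => (f i x).2 := by
  obtain ⟨s, hs, hf'⟩ := hf.circ
  exact ⟨hf.dom, hf.cod.mono fun i => Nat.le_add_left _ _, s, hs, fun i =>
    (hf' i).right.congr fun x => Bits.right_append _ _⟩

theorem left {f : ∀ i, X i → Bits (a i + b i)} (hf : PEff f) : PEff fun i x => (f i x).left := by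
  obtain ⟨s, hs, hf'⟩ := hf.circ
  exact ⟨hf.dom, hf.cod.mono fun i => Nat.le_add_right _ _, s, hs, fun i => (hf' i).left⟩

theorem right {f : ∀ i, X i → Bits (a i + b i)} (hf : PEff f) :
    PEff fun i x => (f i x).right := by
  obtain ⟨s, hs, hf'⟩ := hf.circ
  exact ⟨hf.dom, hf.cod.mono fun i => Nat.le_add_left _ _, s, hs, fun i => (hf' i).right⟩

theorem append {f : ∀ i, X i → Bits (a i)} {g : ∀ i, X i → Bits (b i)} (hf : PEff f)
    (hg : PEff g) : PEff fun i x => (Fin.append (f i x) (g i x) : Bits (a i + b i)) := by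
  obtain ⟨s, hs, h⟩ := (hf.pair hg).circ
  exact ⟨hf.dom, hf.cod.add hg.cod, s, hs, h⟩

theorem to_enc {f : ∀ i, X i → Y i} (hf : PEff f) :
    PEff fun i x => (enc (f i x) : Bits (len (Y i))) := ⟨hf.dom, hf.cod, hf.circ⟩

theorem of_circ {f : ∀ i, X i → Y i} (h : PolyBdd fun i => len (X i))
    (h' : PolyBdd fun i => len (Y i)) (hs : PolyBdd s)
    (C : ∀ i, BCirc (len (X i)) (len (Y i)) (s i))
    (hC : ∀ i x, (C i).eval (enc x) = enc (f i x)) : PEff f :=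
  ⟨h, h', s, hs, fun i => ⟨s i, le_rfl, C i, hC i⟩⟩

theorem exists_circ {f : ∀ i, X i → Y i} (hf : PEff f) :
    ∃ (s : ℕ → ℕ) (C : ∀ i, BCirc (len (X i)) (len (Y i)) (s i)), PolyBdd s ∧
      ∀ i x, (C i).eval (enc x) = enc (f i x) := by
  obtain ⟨s, hs, h⟩ := hf.circ
  choose t ht C hC using h
  exact ⟨t, C, hs.mono ht, hC⟩

theorem of_polyFun {f : ∀ i, Bits (a i) → Bits (b i)} (h : PolyFun f) : PEff f := by
  obtain ⟨ha, hb, s, C, hs, hC⟩ := h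
  exact of_circ ha hb hs C hC

theorem polyFun {f : ∀ i, Bits (a i) → Bits (b i)} (h : PEff f) : PolyFun f := by
  obtain ⟨s, C, hs, hC⟩ := h.exists_circ
  exact ⟨h.dom, h.cod, s, C, hs, hC⟩

theorem xor {f g : ∀ i, X i → Bits (b i)} (hf : PEff f) (hg : PEff g) :
    PEff fun i x => (f i x).xor (g i x) := by
  obtain ⟨s, hs, hf'⟩ := hf.circ
  obtain ⟨t, ht, hg'⟩ := hg.circ
  exact ⟨hf.dom, hf.cod, _, (hs.add ht).add ((PolyBdd.const 4).mul hf.cod), fun i =>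
    (hf' i).xor (hg' i)⟩

theorem ite_eq {u v : ∀ i, X i → Bits (b i)} {f g : ∀ i, X i → Y i} (hu : PEff u) (hv : PEff v)
    (hf : PEff f) (hg : PEff g) : PEff fun i x => if u i x = v i x then f i x else g i x := by
  obtain ⟨s, hs, hf'⟩ := hf.circ
  obtain ⟨t, ht, hg'⟩ := hg.circ
  obtain ⟨p, hp, hu'⟩ := hu.circ
  obtain ⟨q, hq, hv'⟩ := hv.circ
  refine ⟨hf.dom, hf.cod, _, ((((hp.add hq).add (hu.cod.mul (.const 9))).add hs).add ht).add
    (hf.cod.mul (.const 8)), fun i => ?_⟩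
  refine (ComputesOn.ite ((hu' i).decide_eq (hv' i)) (hf' i) (hg' i)).congr fun x => ?_
  have : ∀ (p : Prop) [Decidable p] (y z : Y i),
      (if decide p = true then enc y else enc z) = enc (if p then y else z) := by
    intro p _ y z
    by_cases hp : p <;> simp [hp]
  exact this _ _ _

/-- Circuits that are given by their descriptions can be evaluated in polynomial time. -/
theorem evalCirc {C : ∀ i, X i → BCirc (n i) (m i) (s i)} {x : ∀ i, X i → Bits (n i)}
    (hn : PolyBdd n) (hm : PolyBdd m) (hs : PolyBdd s) (hC : PEff C) (hx : PEff x) :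
    PEff fun i z => (C i z).eval (x i z) := by
  have hsize : PolyBdd fun i => (2 + n i + s i) := ((PolyBdd.const 2).add hn).add hs
  have key : PEff (X := fun i => BCirc (n i) (m i) (s i) × Bits (n i)) (Y := fun i => Bits (m i))
      fun i p => p.1.eval p.2 :=
    ⟨(PolyBdd.descLen hn hm hs).add hn, hm, _,
      (hs.mul ((hsize.mul (.const 10)).add (.const 1))).add (hm.mul (hsize.mul (.const 5))),
      fun i => BCirc.computesOn_eval (C := fun z : BCirc (n i) (m i) (s i) × Bits (n i) => z.1)
        (x := fun z => z.2)
        (ComputesOn.refl.left.congr fun z => Bits.left_append _ _)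
        (ComputesOn.refl.right.congr fun z => Bits.right_append _ _)⟩
  exact key.comp (hC.pair hx)

/-- Evaluation of a fixed family of circuits. -/
theorem evalFixed {x : ∀ i, X i → Y i} (hs : PolyBdd s) (hm : PolyBdd m)
    (C : ∀ i, BCirc (len (Y i)) (m i) (s i)) (hx : PEff x) :
    PEff fun i z => (C i).eval (enc (x i z)) :=
  (of_circ (X := Y) (Y := fun i => Bits (m i)) hx.cod hm hs C fun _ _ => rfl).comp hx

end PEff

/-! ### Circuits whose descriptions are computed bit by bit -/

/-- `f` depends on at most one bit of its argument. -/
def OneBit {a : ℕ} {α : Sort*} (f : Bits a → α) : Prop :=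
  (∀ k k', f k = f k') ∨ ∃ i, ∀ k k', k i = k' i → f k = f k'

namespace OneBit

variable {a : ℕ} {α β : Sort*}

theorem const (c : α) : OneBit fun _ : Bits a => c := Or.inl fun _ _ => rfl

theorem map {f : Bits a → α} (hf : OneBit f) (g : α → β) : OneBit fun k => g (f k) := by
  rcases hf with h | ⟨i, h⟩
  · exact Or.inl fun k k' => congrArg g (h k k')
  · exact Or.inr ⟨i, fun k k' hk => congrArg g (h k k' hk)⟩

theorem of_map {f : Bits a → α} {g : α → β} (hg : Function.Injective g)
    (h : OneBit fun k => g (f k)) : OneBit f := by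
  rcases h with h | ⟨i, h⟩
  · exact Or.inl fun k k' => hg (h k k')
  · exact Or.inr ⟨i, fun k k' hk => hg (h k k' hk)⟩

theorem of_val {n : ℕ} {f : Bits a → Fin n} (h : OneBit fun k => (f k : ℕ)) : OneBit f :=
  of_map (g := Fin.val) Fin.val_injective h

theorem congr {f g : Bits a → α} (h : OneBit f) (hfg : ∀ k, f k = g k) : OneBit g := by
  rwa [← show f = g from funext hfg]

theorem computesBit {f : Bits a → Bool} (h : OneBit f) :
    ComputesBit (fun k : Bits a => k) 1 f := by
  rcases h with h | ⟨i, h⟩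
  · exact ((ComputesBit.const (f fun _ => false)).congr fun k => h _ _).mono (Nat.zero_le _)
  · have e : ∀ k, f k = bif k i then f (fun _ => true) else f fun _ => false := by
      intro k
      cases hk : k i
      · exact h _ _ hk
      · exact h _ _ hk
    have hp := ComputesBit.proj (e := fun k : Bits a => k) i
    cases h0 : f fun _ => false <;> cases h1 : f fun _ => true
    · exact ((ComputesBit.const false).congr fun k => by rw [e, h0, h1]; simp).mono (Nat.zero_le _)
    · exact (hp.congr fun k => by rw [e, h0, h1]; simp).mono (Nat.zero_le _)
    · exact hp.not.congr fun k => by rw [e, h0, h1]; simp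
    · exact ((ComputesBit.const true).congr fun k => by rw [e, h0, h1]; simp).mono (Nat.zero_le _)

end OneBit

/-- Every wire reference of the circuit `C k` depends on at most one bit of `k`. -/
structure RefLocal {a n m s : ℕ} (C : Bits a → BCirc n m s) : Prop where
  fst : ∀ j, OneBit fun k => ((C k).gate j).1
  snd : ∀ j, OneBit fun k => ((C k).gate j).2
  out : ∀ i, OneBit fun k => (C k).out i

namespace RefLocal

variable {a n m s t p q r u : ℕ}

theorem const (C : BCirc n m s) : RefLocal fun _ : Bits a => C :=
  ⟨fun _ => .const _, fun _ => .const _, fun _ => .const _⟩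

theorem comp_left {C : Bits a → BCirc n m s} (hC : RefLocal C) (D : BCirc m p t) :
    RefLocal fun k => (C k).comp D := by
  have key : ∀ w hw, OneBit fun k => BCirc.compReloc (C k) D w hw := by
    intro w hw
    unfold BCirc.compReloc
    split_ifs with h2 hb
    · exact .const _
    · exact (hC.out _).map Fin.val
    · exact .const _
  refine ⟨fun j => ?_, fun j => ?_, fun i => ?_⟩
  · refine .of_val ?_
    by_cases h : (j : ℕ) < s
    · exact ((hC.fst ⟨j, h⟩).map Fin.val).congr fun k => by rw [BCirc.comp_gate_lt _ _ _ h]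
    · exact (key _ _).congr fun k =>
        (BCirc.comp_gate_fst _ _ ⟨j - s, by omega⟩ j (by simp only; omega)).symm
  · refine .of_val ?_
    by_cases h : (j : ℕ) < s
    · exact ((hC.snd ⟨j, h⟩).map Fin.val).congr fun k => by rw [BCirc.comp_gate_lt _ _ _ h]
    · exact (key _ _).congr fun k =>
        (BCirc.comp_gate_snd _ _ ⟨j - s, by omega⟩ j (by simp only; omega)).symm
  · exact .of_val ((key _ _).congr fun k => (BCirc.comp_out _ _ _).symm)

theorem comp_right (C : BCirc n m s) {D : Bits a → BCirc m p t} (hD : RefLocal D) :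
    RefLocal fun k => C.comp (D k) := by
  have key : ∀ {j : ℕ} {w : Bits a → Fin (2 + m + j)} (hj : j ≤ t), OneBit w →
      OneBit fun k => BCirc.compReloc C (D k) (w k) (by omega) := by
    intro j w hj hw
    exact hw.map fun w => if h2 : (w : ℕ) < 2 then (w : ℕ)
      else if hb : (w : ℕ) < 2 + m then (C.out ⟨w - 2, by omega⟩ : ℕ)
      else 2 + n + s + (w - (2 + m))
  refine ⟨fun j => ?_, fun j => ?_, fun i => ?_⟩
  · refine .of_val ?_
    by_cases h : (j : ℕ) < s
    · exact (OneBit.const ((C.gate ⟨j, h⟩).1 : ℕ)).congr fun k => by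
        rw [BCirc.comp_gate_lt _ _ _ h]
    · exact (key (by simp only; omega) (hD.fst ⟨j - s, by omega⟩)).congr fun k =>
        (BCirc.comp_gate_fst _ _ ⟨j - s, by omega⟩ j (by simp only; omega)).symm
  · refine .of_val ?_
    by_cases h : (j : ℕ) < s
    · exact (OneBit.const ((C.gate ⟨j, h⟩).2 : ℕ)).congr fun k => by
        rw [BCirc.comp_gate_lt _ _ _ h]
    · exact (key (by simp only; omega) (hD.snd ⟨j - s, by omega⟩)).congr fun k =>
        (BCirc.comp_gate_snd _ _ ⟨j - s, by omega⟩ j (by simp only; omega)).symm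
  · exact .of_val ((key le_rfl (hD.out i)).congr fun k => (BCirc.comp_out _ _ _).symm)

theorem par {C : Bits a → BCirc n m s} {D : Bits a → BCirc p q t} (hC : RefLocal C)
    (hD : RefLocal D) : RefLocal fun k => (C k).par (D k) := by
  refine ⟨fun j => .of_val ?_, fun j => .of_val ?_, fun i => ?_⟩
  · by_cases h : (j : ℕ) < s
    · exact ((hC.fst ⟨j, h⟩).map fun w => BCirc.parRelocL n p w).congr fun k =>
        (BCirc.par_gate_lt (C k) (D k) ⟨j, h⟩ j rfl).1.symm
    · exact ((hD.fst ⟨j - s, by omega⟩).map fun w => BCirc.parRelocR n s p w).congr fun k =>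
        (BCirc.par_gate_ge (C k) (D k) ⟨j - s, by omega⟩ j (by simp only; omega)).1.symm
  · by_cases h : (j : ℕ) < s
    · exact ((hC.snd ⟨j, h⟩).map fun w => BCirc.parRelocL n p w).congr fun k =>
        (BCirc.par_gate_lt (C k) (D k) ⟨j, h⟩ j rfl).2.symm
    · exact ((hD.snd ⟨j - s, by omega⟩).map fun w => BCirc.parRelocR n s p w).congr fun k =>
        (BCirc.par_gate_ge (C k) (D k) ⟨j - s, by omega⟩ j (by simp only; omega)).2.symm
  · refine Fin.addCases (fun i => ?_) (fun i => ?_) i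
    · refine .of_val (((hC.out i).map fun w => BCirc.parRelocL n p w).congr fun k => ?_)
      simp only [BCirc.par, Fin.append_left, BCirc.parRelocL]
      split_ifs <;> simp
    · refine .of_val (((hD.out i).map fun w => BCirc.parRelocR n s p w).congr fun k => ?_)
      simp only [BCirc.par, Fin.append_right, BCirc.parRelocR]
      split_ifs <;> simp

theorem padTo {C : Bits a → BCirc n m s} (hC : RefLocal C) (h : s ≤ t) :
    RefLocal fun k => (C k).padTo t h := by
  refine ⟨fun j => ?_, fun j => ?_, fun i => ?_⟩
  · by_cases hj : (j : ℕ) < s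
    · exact (hC.fst ⟨j, hj⟩).congr fun k => by simp [BCirc.padTo, hj]
    · exact (OneBit.const (⟨0, by omega⟩ : Fin (2 + n + j))).congr fun k => by
        simp [BCirc.padTo, hj]
  · by_cases hj : (j : ℕ) < s
    · exact (hC.snd ⟨j, hj⟩).congr fun k => by simp [BCirc.padTo, hj]
    · exact (OneBit.const (⟨0, by omega⟩ : Fin (2 + n + j))).congr fun k => by
        simp [BCirc.padTo, hj]
  · exact (hC.out i).map (Fin.castLE (by omega))

theorem hardwire (E : BCirc (a + n) m s) : RefLocal fun k => E.hardwire k := by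
  refine comp_left (C := fun k => BCirc.wires _) ⟨fun j => j.elim0, fun j => j.elim0, fun i => ?_⟩ E
  refine Fin.addCases (fun i => ?_) (fun i => ?_) i
  · refine Or.inr ⟨i, fun k k' h => ?_⟩
    simp only [BCirc.wires, Fin.append_left, h]
  · refine Or.inl fun k k' => ?_
    simp only [BCirc.wires, Fin.append_right]

theorem computesOn {C : Bits a → BCirc n m s} (hC : RefLocal C) :
    ComputesOn (fun k : Bits a => k) (BCirc.descLen n m s * 1) fun k => (C k).encode := by
  refine ComputesOn.of_bits fun i => OneBit.computesBit ?_
  have hr : ∀ q, OneBit fun k => (C k).refs q := by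
    intro q
    refine Fin.addCases (fun q => ?_) (fun q => ?_) q
    · refine Fin.addCases (fun q => ?_) (fun q => ?_) q
      · simp only [BCirc.refs, Fin.append_left]
        exact (hC.fst q).map _
      · simp only [BCirc.refs, Fin.append_left, Fin.append_right]
        exact (hC.snd q).map _
    · simp only [BCirc.refs, Fin.append_right]
      exact hC.out q
  exact (hr _).map fun w => decide (w = (finProdFinEquiv.symm i).2)

end RefLocal

theorem PEff.of_refLocal {a n m s : ℕ → ℕ} {C : ∀ i, Bits (a i) → BCirc (n i) (m i) (s i)}
    (ha : PolyBdd a) (hn : PolyBdd n) (hm : PolyBdd m) (hs : PolyBdd s)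
    (hC : ∀ i, RefLocal (C i)) : PEff C :=
  ⟨ha, .descLen hn hm hs, _, (PolyBdd.descLen hn hm hs).mul (.const 1), fun i =>
    (hC i).computesOn⟩

/-! ### States and superoperators -/

theorem Bits.sum_append {a b : ℕ} {M : Type*} [AddCommMonoid M] (f : Bits (a + b) → M) :
    ∑ x, f x = ∑ y : Bits a, ∑ z : Bits b, f (Fin.append y z) := by
  rw [← Fintype.sum_prod_type', ← (Fin.appendEquiv a b).sum_comp]
  rfl

/-- The matrix unit `|x⟩⟨x'|`. -/
def unitState {a : ℕ} (x x' : Bits a) : QState a :=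
  Matrix.of fun z z' => if z = x ∧ z' = x' then 1 else 0

theorem ket_eq_unitState {a : ℕ} (x : Bits a) : ket x = unitState x x := rfl

namespace QState

variable {a b c d : ℕ}

theorem tensor_apply (ρ : QState a) (σ : QState b) (z z' : Bits (a + b)) :
    ρ.tensor σ z z' = ρ z.left z'.left * σ z.right z'.right := rfl

theorem ext_append {ρ σ : QState (a + b)}
    (h : ∀ y z y' z', ρ (Fin.append y z) (Fin.append y' z') =
      σ (Fin.append y z) (Fin.append y' z')) : ρ = σ := by
  ext z z'
  rw [← Bits.append_left_right z, ← Bits.append_left_right z']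
  exact h _ _ _ _

theorem ket_tensor_ket (x : Bits a) (y : Bits b) :
    (ket x).tensor (ket y) = ket (Fin.append x y) := by
  refine ext_append fun u v u' v' => ?_
  simp only [tensor_apply, Bits.left_append, Bits.right_append, ket, Matrix.of_apply,
    Bits.append_inj]
  by_cases h1 : u = x <;> by_cases h2 : u' = x <;> by_cases h3 : v = y <;> by_cases h4 : v' = y <;>
    simp [*]

theorem unitState_tensor (x x' : Bits a) (y y' : Bits b) :
    (unitState x x').tensor (unitState y y') =
      unitState (Fin.append x y) (Fin.append x' y') := by
  refine ext_append fun u v u' v' => ?_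
  simp only [tensor_apply, Bits.left_append, Bits.right_append, unitState, Matrix.of_apply,
    Bits.append_inj]
  by_cases h1 : u = x <;> by_cases h2 : u' = x' <;> by_cases h3 : v = y <;>
    by_cases h4 : v' = y' <;> simp [*]

theorem tensor_sum {ι : Type*} (s : Finset ι) (ρ : QState a) (σ : ι → QState b) :
    ρ.tensor (∑ i ∈ s, σ i) = ∑ i ∈ s, ρ.tensor (σ i) := by
  ext z z'
  simp [tensor_apply, Matrix.sum_apply, Finset.mul_sum]

theorem sum_tensor {ι : Type*} (s : Finset ι) (ρ : ι → QState a) (σ : QState b) :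
    QState.tensor (∑ i ∈ s, ρ i) σ = ∑ i ∈ s, (ρ i).tensor σ := by
  ext z z'
  simp [tensor_apply, Matrix.sum_apply, Finset.sum_mul]

theorem smul_tensor (r : ℂ) (ρ : QState a) (σ : QState b) :
    QState.tensor (r • ρ) σ = r • ρ.tensor σ := by
  ext z z'
  simp [tensor_apply, mul_assoc]

theorem tensor_smul (r : ℂ) (ρ : QState a) (σ : QState b) :
    ρ.tensor (r • σ) = r • ρ.tensor σ := by
  ext z z'
  simp [tensor_apply, mul_left_comm]

@[simp] theorem tensor_zero (ρ : QState a) : ρ.tensor (0 : QState b) = 0 := by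
  ext z z'; simp [tensor_apply]

@[simp] theorem zero_tensor (σ : QState b) : QState.tensor (0 : QState a) σ = 0 := by
  ext z z'; simp [tensor_apply]

theorem postMeasure_tensor (ρ : QState a) (σ : QState b) (y : Bits a) :
    (ρ.tensor σ).postMeasure y = ρ y y • σ := by
  ext z z'
  simp [postMeasure, tensor_apply]

theorem postMeasure_ket_tensor (x y : Bits a) (σ : QState b) :
    ((ket x).tensor σ).postMeasure y = if y = x then σ else 0 := by
  rw [postMeasure_tensor]
  by_cases h : y = x <;> simp [ket, h]

theorem postMeasure_sum {ι : Type*} (s : Finset ι) (ρ : ι → QState (a + b)) (y : Bits a) :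
    postMeasure (∑ i ∈ s, ρ i) y = ∑ i ∈ s, (ρ i).postMeasure y := by
  ext z z'
  simp [postMeasure, Matrix.sum_apply]

theorem prob_sum {ι : Type*} (s : Finset ι) (ρ : ι → QState a) (y : Bits a) :
    prob (∑ i ∈ s, ρ i) y = ∑ i ∈ s, (ρ i).prob y := by
  simp [prob, Matrix.sum_apply]

theorem prob_smul (r : ℝ) (ρ : QState a) (y : Bits a) :
    prob ((r : ℂ) • ρ) y = r * ρ.prob y := by
  simp [prob]

@[simp] theorem prob_zero (y : Bits a) : prob (0 : QState a) y = 0 := by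
  simp [prob]

end QState

namespace Superop

variable {a b c d e f : ℕ}

theorem apply_eq_mulVec (S : Superop a b) (ρ : QState a) (z z' : Bits b) :
    S.apply ρ z z' = S.mulVec (fun p => ρ p.1 p.2) (z, z') := rfl

/-- First `S`, then `T`. -/
def comp (T : Superop b c) (S : Superop a b) : Superop a c := Matrix.of (T * S)

theorem apply_comp (T : Superop b c) (S : Superop a b) (ρ : QState a) :
    (T.comp S).apply ρ = T.apply (S.apply ρ) := by
  ext z z'
  refine Eq.trans ?_ (congrFun (Matrix.mulVec_mulVec (fun p : Bits a × Bits a => ρ p.1 p.2) T S)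
    (z, z')).symm
  rfl

@[simp] theorem one_apply (ρ : QState a) : Superop.apply (1 : Superop a a) ρ = ρ := by
  ext z z'
  rw [apply_eq_mulVec, Matrix.one_mulVec]

theorem apply_sum {ι : Type*} (s : Finset ι) (S : Superop a b) (ρ : ι → QState a) :
    S.apply (∑ i ∈ s, ρ i) = ∑ i ∈ s, S.apply (ρ i) := by
  ext z z'
  simp only [apply, Matrix.of_apply, Matrix.sum_apply, Finset.mul_sum]
  rw [Finset.sum_comm]

theorem apply_smul (S : Superop a b) (r : ℂ) (ρ : QState a) :
    S.apply (r • ρ) = r • S.apply ρ := by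
  ext z z'
  simp only [apply, Matrix.of_apply, Matrix.smul_apply, smul_eq_mul, Finset.mul_sum]
  exact Finset.sum_congr rfl fun p _ => by ring

@[simp] theorem apply_zero (S : Superop a b) : S.apply 0 = 0 := by
  ext z z'
  simp [apply]

theorem sum_apply {ι : Type*} (s : Finset ι) (S : ι → Superop a b) (ρ : QState a) :
    Superop.apply (∑ i ∈ s, S i) ρ = ∑ i ∈ s, (S i).apply ρ := by
  ext z z'
  simp only [apply, Matrix.of_apply, Matrix.sum_apply, Finset.sum_mul]
  rw [Finset.sum_comm]

theorem apply_unitState (S : Superop a b) (x x' : Bits a) (z z' : Bits b) :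
    S.apply (unitState x x') z z' = S (z, z') (x, x') := by
  simp only [apply, Matrix.of_apply, unitState]
  rw [Finset.sum_eq_single (x, x')]
  · simp
  · rintro ⟨y, y'⟩ _ h
    rw [if_neg, mul_zero]
    rintro ⟨rfl, rfl⟩
    exact h rfl
  · simp

theorem ext_unitState {S T : Superop a b}
    (h : ∀ x x', S.apply (unitState x x') = T.apply (unitState x x')) : S = T := by
  ext ⟨z, z'⟩ ⟨x, x'⟩
  exact (apply_unitState S x x' z z').symm.trans ((congrFun (congrFun (h x x') z) z').trans
    (apply_unitState T x x' z z'))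

theorem ext_apply {S T : Superop a b} (h : ∀ ρ, S.apply ρ = T.apply ρ) : S = T :=
  ext_unitState fun _ _ => h _

theorem ext_tensor {S T : Superop (a + b) c}
    (h : ∀ ρ σ, S.apply (QState.tensor ρ σ) = T.apply (QState.tensor ρ σ)) : S = T := by
  refine ext_unitState fun x x' => ?_
  rw [← Bits.append_left_right x, ← Bits.append_left_right x', ← QState.unitState_tensor]
  exact h _ _

theorem tensor_apply_tensor (S : Superop a b) (T : Superop c d) (ρ : QState a) (σ : QState c) :
    (S.tensor T).apply (ρ.tensor σ) = (S.apply ρ).tensor (T.apply σ) := by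
  ext z z'
  simp only [apply, Matrix.of_apply, tensor, QState.tensor, Fintype.sum_prod_type,
    Bits.sum_append (M := ℂ), Bits.left_append, Bits.right_append, Finset.sum_mul, Finset.mul_sum]
  rw [Finset.sum_comm]
  refine Finset.sum_congr rfl fun y _ => ?_
  conv_rhs => rw [Finset.sum_comm]
  refine Finset.sum_congr rfl fun x _ => ?_
  conv_rhs => rw [Finset.sum_comm]
  refine Finset.sum_congr rfl fun x' _ => Finset.sum_congr rfl fun y' _ => ?_
  ring

theorem tensor_comp_tensor (S : Superop a b) (T : Superop c d) (S' : Superop b e)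
    (T' : Superop d f) : (S'.comp S).tensor (T'.comp T) = (S'.tensor T').comp (S.tensor T) := by
  refine ext_tensor fun ρ σ => ?_
  rw [apply_comp, tensor_apply_tensor, tensor_apply_tensor, tensor_apply_tensor, apply_comp,
    apply_comp]

theorem feed_apply (S : Superop (a + b) c) (x : Bits a) (ρ : QState b) :
    (S.feed x).apply ρ = S.apply ((ket x).tensor ρ) := by
  ext z z'
  simp only [apply, Matrix.of_apply, feed, QState.tensor, Fintype.sum_prod_type,
    Bits.sum_append, Bits.left_append, Bits.right_append, ket]
  rw [Finset.sum_eq_single x]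
  · refine Finset.sum_congr rfl fun y _ => ?_
    rw [Finset.sum_eq_single x]
    · simp
    · intro u _ hu; simp [hu]
    · simp
  · intro u _ hu; simp [hu]
  · simp

/-- The map that adjoins the register `|x⟩⟨x|`. -/
def adjoin (x : Bits a) : Superop b (a + b) := Superop.feed (1 : Superop (a + b) (a + b)) x

theorem adjoin_apply (x : Bits a) (ρ : QState b) : (adjoin x).apply ρ = (ket x).tensor ρ := by
  rw [adjoin, feed_apply, one_apply]

/-- The map `ρ ↦ ∑ y, T y (ρ_y)`, where `ρ_y` is the state of the second register after the first
one was measured with outcome `y`. -/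
def measure (T : Bits a → Superop b c) : Superop (a + b) c :=
  Matrix.of fun z x => if x.1.left = x.2.left then T x.1.left z (x.1.right, x.2.right) else 0

theorem measure_apply (T : Bits a → Superop b c) (ρ : QState (a + b)) :
    (measure T).apply ρ = ∑ y, (T y).apply (ρ.postMeasure y) := by
  ext z z'
  simp only [apply, Matrix.of_apply, measure, Fintype.sum_prod_type, Matrix.sum_apply,
    Bits.sum_append, Bits.left_append, Bits.right_append, QState.postMeasure]
  refine Finset.sum_congr rfl fun x _ => Finset.sum_congr rfl fun y _ => ?_
  rw [Finset.sum_eq_single x]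
  · simp
  · intro u _ hu
    simp [Ne.symm hu]
  · simp

theorem measure_apply_ket_tensor (T : Bits a → Superop b c) (x : Bits a) (σ : QState b) :
    (measure T).apply ((ket x).tensor σ) = (T x).apply σ := by
  rw [measure_apply, Finset.sum_eq_single x]
  · rw [QState.postMeasure_ket_tensor, if_pos rfl]
  · intro y _ hy
    rw [QState.postMeasure_ket_tensor, if_neg hy, apply_zero]
  · simp

/-- The map that applies the function `f` to the computational basis, coherently. -/
def ofFun (f : Bits a → Bits b) : Superop a b :=
  Matrix.of fun z x => if z.1 = f x.1 ∧ z.2 = f x.2 then 1 else 0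

theorem ofFun_apply_unitState (f : Bits a → Bits b) (x x' : Bits a) :
    (ofFun f).apply (unitState x x') = unitState (f x) (f x') := by
  ext z z'
  rw [apply_unitState]
  rfl

theorem ofFun_apply_ket (f : Bits a → Bits b) (x : Bits a) :
    (ofFun f).apply (ket x) = ket (f x) := ofFun_apply_unitState f x x

theorem ofFun_comp_ofFun (g : Bits b → Bits c) (f : Bits a → Bits b) :
    (ofFun g).comp (ofFun f) = ofFun (fun x => g (f x)) :=
  ext_unitState fun x x' => by
    rw [apply_comp, ofFun_apply_unitState, ofFun_apply_unitState, ofFun_apply_unitState]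

theorem ofFun_tensor_ofFun (f : Bits a → Bits b) (g : Bits c → Bits d) :
    (ofFun f).tensor (ofFun g) = ofFun fun x => Fin.append (f x.left) (g x.right) := by
  refine ext_unitState fun x x' => ?_
  rw [ofFun_apply_unitState, ← Bits.append_left_right x, ← Bits.append_left_right x',
    ← QState.unitState_tensor, tensor_apply_tensor, ofFun_apply_unitState, ofFun_apply_unitState,
    QState.unitState_tensor]
  simp

theorem ofFun_id : (ofFun fun x : Bits a => x) = 1 :=
  ext_unitState fun x x' => by rw [ofFun_apply_unitState, one_apply]

/-- The map that measures in the computational basis and applies the function `f` to the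
outcome. -/
def classical (f : Bits a → Bits b) : Superop a b :=
  Matrix.of fun z x => if x.1 = x.2 ∧ z.1 = f x.1 ∧ z.2 = f x.1 then 1 else 0

theorem classical_apply_unitState (f : Bits a → Bits b) (x x' : Bits a) :
    (classical f).apply (unitState x x') = if x = x' then ket (f x) else 0 := by
  ext z z'
  rw [apply_unitState]
  by_cases h : x = x' <;> simp [classical, ket, h]

theorem classical_apply_ket (f : Bits a → Bits b) (x : Bits a) :
    (classical f).apply (ket x) = ket (f x) := by
  rw [ket_eq_unitState x, classical_apply_unitState, if_pos rfl]

theorem classical_apply (f : Bits a → Bits b) (ρ : QState a) :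
    (classical f).apply ρ = ∑ x, ρ x x • ket (f x) := by
  ext z z'
  simp only [apply, classical, Matrix.of_apply, Fintype.sum_prod_type, Matrix.sum_apply,
    Matrix.smul_apply, ket, smul_eq_mul]
  refine Finset.sum_congr rfl fun x _ => ?_
  rw [Finset.sum_eq_single x]
  · simp [mul_comm]
  · intro u _ hu; simp [Ne.symm hu]
  · simp

/-- Measuring the first register. -/
theorem measure_adjoin :
    (measure fun y : Bits a => (adjoin y : Superop b (a + b))) =
      (classical fun y => y).tensor 1 := by
  refine ext_unitState fun x x' => ?_
  rw [← Bits.append_left_right x, ← Bits.append_left_right x', ← QState.unitState_tensor,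
    tensor_apply_tensor, classical_apply_unitState, one_apply, measure_apply]
  simp only [QState.postMeasure_tensor, apply_smul, adjoin_apply]
  by_cases h : x.left = x'.left
  · rw [Finset.sum_eq_single x.left]
    · rw [if_pos h]
      simp [unitState, h]
    · intro u _ hu; simp [unitState, hu]
    · simp
  · rw [if_neg h, QState.zero_tensor]
    refine Finset.sum_eq_zero fun y _ => ?_
    have : (unitState x.left x'.left) y y = 0 := by
      simp only [unitState, Matrix.of_apply]
      exact if_neg fun h' => h (h'.1.symm.trans h'.2)
    rw [this, zero_smul]

theorem measure_tensor_one (ρ : QState (a + b)) :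
    ((classical fun y => y).tensor (1 : Superop b b)).apply ρ =
      ∑ y, (ket y).tensor (ρ.postMeasure y) := by
  rw [← measure_adjoin, measure_apply]
  simp only [adjoin_apply]

/-! ### Rearranging registers -/

theorem ofFun_perm_apply (e : Fin b ≃ Fin a) (ρ : QState a) (z z' : Bits b) :
    (ofFun fun x : Bits a => (x ∘ e : Bits b)).apply ρ z z' = ρ (z ∘ e.symm) (z' ∘ e.symm) := by
  simp only [apply, ofFun, Matrix.of_apply, Fintype.sum_prod_type]
  have h : ∀ (z : Bits b) (x : Bits a), z = x ∘ e ↔ x = z ∘ e.symm := by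
    intro z x
    constructor
    · rintro rfl; funext i; simp
    · rintro rfl; funext i; simp
  simp only [h]
  rw [Finset.sum_eq_single (z ∘ e.symm), Finset.sum_eq_single (z' ∘ e.symm)]
  · simp
  · intro u _ hu; simp [hu]
  · simp
  · intro u _ hu; simp [hu]
  · simp

/-- Regrouping of three registers. -/
def assocR (a b c : ℕ) : Fin (a + (b + c)) ≃ Fin (a + b + c) := finCongr (Nat.add_assoc a b c).symm

theorem assocR_apply (ρ : QState a) (σ : QState b) (τ : QState c) :
    (ofFun fun x : Bits (a + b + c) => (x ∘ assocR a b c : Bits (a + (b + c)))).apply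
      ((ρ.tensor σ).tensor τ) = ρ.tensor (σ.tensor τ) := by
  ext z z'
  rw [ofFun_perm_apply]
  simp only [QState.tensor, Matrix.of_apply]
  rw [mul_assoc]
  congr 2
  have h : ∀ z : Bits (a + (b + c)),
      Bits.right (z ∘ (assocR a b c).symm) = z.right.right := by
    intro z; funext i; exact congrArg z (Fin.ext (by simp [assocR, Nat.add_assoc]))
  rw [h, h]

theorem assocL_apply (ρ : QState a) (σ : QState b) (τ : QState c) :
    (ofFun fun x : Bits (a + (b + c)) => (x ∘ (assocR a b c).symm : Bits (a + b + c))).apply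
      (ρ.tensor (σ.tensor τ)) = (ρ.tensor σ).tensor τ := by
  have h : ∀ υ : QState (a + b + c), (ofFun fun x : Bits (a + (b + c)) =>
      (x ∘ (assocR a b c).symm : Bits (a + b + c))).apply
        ((ofFun fun x : Bits (a + b + c) => (x ∘ assocR a b c : Bits (a + (b + c)))).apply υ)
        = υ := by
    intro υ
    ext z z'
    rw [ofFun_perm_apply, ofFun_perm_apply]
    rfl
  rw [← assocR_apply, h]

/-- Exchange of the two middle registers of four. -/
def swapMid (a b c d : ℕ) : Fin ((a + c) + (b + d)) ≃ Fin ((a + b) + (c + d)) :=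
  (((finSumFinEquiv.symm.trans (finSumFinEquiv.symm.sumCongr finSumFinEquiv.symm)).trans
    (Equiv.sumSumSumComm (Fin a) (Fin c) (Fin b) (Fin d))).trans
      (finSumFinEquiv.sumCongr finSumFinEquiv)).trans finSumFinEquiv

theorem swapMid_apply (ρ : QState a) (σ : QState b) (τ : QState c) (υ : QState d) :
    (ofFun fun x : Bits ((a + b) + (c + d)) => (x ∘ swapMid a b c d : Bits _)).apply
      ((ρ.tensor σ).tensor (τ.tensor υ)) = (ρ.tensor τ).tensor (σ.tensor υ) := by
  ext z z'
  rw [ofFun_perm_apply]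
  have h1 : ∀ z : Bits ((a + c) + (b + d)),
      Bits.left (Bits.left (z ∘ (swapMid a b c d).symm)) = z.left.left := by
    intro z; funext i; simp [Bits.left, swapMid]
  have h2 : ∀ z : Bits ((a + c) + (b + d)),
      Bits.right (Bits.left (z ∘ (swapMid a b c d).symm)) = z.right.left := by
    intro z; funext i; simp [Bits.left, Bits.right, swapMid, -Fin.natAdd_eq_addNat]
  have h3 : ∀ z : Bits ((a + c) + (b + d)),
      Bits.left (Bits.right (z ∘ (swapMid a b c d).symm)) = z.left.right := by
    intro z; funext i; simp [Bits.left, Bits.right, swapMid, -Fin.natAdd_eq_addNat]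
  have h4 : ∀ z : Bits ((a + c) + (b + d)),
      Bits.right (Bits.right (z ∘ (swapMid a b c d).symm)) = z.right.right := by
    intro z; funext i; simp [Bits.right, swapMid, -Fin.natAdd_eq_addNat]
  simp only [QState.tensor_apply, h1, h2, h3, h4]
  ring

end Superop

/-! ### Simulation of Boolean circuits by quantum circuits -/

namespace QCirc

variable {a b c d : ℕ}

theorem op_seq (F : QCirc a b) (G : QCirc b c) : (seq F G).op = G.op.comp F.op := rfl

theorem op_par (F : QCirc a b) (G : QCirc c d) : (par F G).op = F.op.tensor G.op := rfl

theorem op_perm (e : Fin b ≃ Fin a) : (perm e).op = Superop.ofFun fun x => x ∘ e := rfl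

/-- The identity circuit. -/
def idle (a : ℕ) : QCirc a a := perm (Equiv.refl _)

theorem op_idle (a : ℕ) : (idle a).op = 1 := Superop.ofFun_id

/-- The size bounds the numbers of input and output qubits. -/
theorem dim_le (F : QCirc a b) : a ≤ 3 * F.size ∧ b ≤ 3 * F.size := by
  induction F with
  | @perm a b e =>
    have : b = a := by simpa using Fintype.card_congr e
    simp only [size]; omega
  | seq F G hF hG => simp only [size]; omega
  | par F G hF hG => simp only [size]; omega
  | _ => simp only [size]; omega

theorem op_cnot : cnot.op = Superop.ofFun fun x : Bits 2 => ![x 0, Bool.xor (x 1) (x 0)] := by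
  ext z x
  simp only [op, Superop.conj, cnotMatrix, Superop.ofFun, Matrix.of_apply]
  by_cases h1 : z.1 = ![x.1 0, Bool.xor (x.1 1) (x.1 0)] <;>
    by_cases h2 : z.2 = ![x.2 0, Bool.xor (x.2 1) (x.2 0)] <;> simp [h1, h2]

theorem op_toffoli :
    toffoli.op = Superop.ofFun fun x : Bits 3 => ![x 0, x 1, Bool.xor (x 2) (x 0 && x 1)] := by
  ext z x
  simp only [op, Superop.conj, toffoliMatrix, Superop.ofFun, Matrix.of_apply]
  by_cases h1 : z.1 = ![x.1 0, x.1 1, Bool.xor (x.1 2) (x.1 0 && x.1 1)] <;>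
    by_cases h2 : z.2 = ![x.2 0, x.2 1, Bool.xor (x.2 2) (x.2 0 && x.2 1)] <;> simp [h1, h2]

theorem op_newZero : newZero.op = Superop.ofFun fun _ : Bits 0 => Bits.single false := by
  ext z x
  simp only [op, Superop.ofFun, Matrix.of_apply]
  have h : ∀ y : Bits 1, y = Bits.single false ↔ y 0 = false := fun y =>
    ⟨fun h => by rw [h]; rfl, fun h => (Bits.eq_single y).trans (by rw [h])⟩
  simp only [h]

theorem _root_.Superop.conj_comp_conj (U V : Matrix (Bits a) (Bits a) ℂ) :
    (Superop.conj U).comp (Superop.conj V) = Superop.conj (U * V) := by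
  ext z x
  change ∑ p : Bits a × Bits a, (U z.1 p.1 * star (U z.2 p.2)) * (V p.1 x.1 * star (V p.2 x.2)) =
    (U * V) z.1 x.1 * star ((U * V) z.2 x.2)
  rw [Fintype.sum_prod_type, Matrix.mul_apply, Matrix.mul_apply, star_sum, Finset.sum_mul_sum]
  refine Finset.sum_congr rfl fun i _ => Finset.sum_congr rfl fun j _ => ?_
  rw [star_mul']
  ring

theorem _root_.Bits.sum_one {M : Type*} [AddCommMonoid M] (f : Bits 1 → M) :
    ∑ x, f x = f (Bits.single true) + f (Bits.single false) := by
  rw [← Fintype.sum_bool fun b => f (Bits.single b)]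
  exact Fintype.sum_equiv (Equiv.funUnique (Fin 1) Bool) _ _ fun x => by
    rw [Bits.eq_single x]; rfl

/-- Negation, as `H T⁴ H`. -/
def notGate : QCirc 1 1 :=
  seq hadamard (seq tGate (seq tGate (seq tGate (seq tGate hadamard))))

theorem op_notGate : notGate.op = Superop.ofFun fun x : Bits 1 => Bits.single (!x 0) := by
  have hT : tMatrix = Matrix.diagonal fun x : Bits 1 =>
      if x 0 then Complex.exp (Complex.I * Real.pi / 4) else 1 := by
    ext z x
    by_cases h : z = x <;> simp [tMatrix, h]
  have hexp : Complex.exp (Complex.I * Real.pi / 4) * Complex.exp (Complex.I * Real.pi / 4) *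
      Complex.exp (Complex.I * Real.pi / 4) * Complex.exp (Complex.I * Real.pi / 4) = -1 := by
    rw [← Complex.exp_add, ← Complex.exp_add, ← Complex.exp_add, ← Complex.exp_pi_mul_I]
    congr 1; ring
  have hT4 : tMatrix * tMatrix * tMatrix * tMatrix =
      Matrix.diagonal fun x : Bits 1 => if x 0 then -1 else 1 := by
    rw [hT, Matrix.diagonal_mul_diagonal, Matrix.diagonal_mul_diagonal,
      Matrix.diagonal_mul_diagonal]
    congr 1
    funext x
    by_cases h : x 0 = true <;> simp [h, hexp]
  have hs : (Real.sqrt 2 : ℂ) * (Real.sqrt 2 : ℂ) = 2 := by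
    rw [← Complex.ofReal_mul, Real.mul_self_sqrt (by norm_num)]; simp
  have hs0 : (Real.sqrt 2 : ℂ) ≠ 0 := by
    intro h; rw [h] at hs; norm_num at hs
  have hU : hadamardMatrix * (tMatrix * tMatrix * tMatrix * tMatrix) * hadamardMatrix =
      Matrix.of fun z x : Bits 1 => if z = Bits.single (!x 0) then 1 else 0 := by
    rw [hT4]
    ext z x
    rw [Matrix.mul_apply, Bits.sum_one]
    simp only [Matrix.mul_diagonal, hadamardMatrix, Matrix.of_apply]
    rw [Bits.eq_single z]
    simp only [Bits.single_injective.eq_iff]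
    simp only [Bits.single]
    cases z 0 <;> cases x 0 <;> simp <;> field_simp <;> rw [sq, hs] <;> norm_num
  have hop : notGate.op =
      Superop.conj (hadamardMatrix * (tMatrix * tMatrix * tMatrix * tMatrix) * hadamardMatrix) := by
    simp only [notGate, op_seq]
    simp only [op, Superop.conj_comp_conj, Matrix.mul_assoc]
  rw [hop, hU]
  ext z x
  simp only [Superop.conj, Superop.ofFun, Matrix.of_apply]
  by_cases h1 : z.1 = Bits.single (!x.1 0) <;> by_cases h2 : z.2 = Bits.single (!x.2 0) <;>
    simp [h1, h2]

end QCirc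

/-- The function `f` is applied to the computational basis, coherently, by a quantum circuit of size
at most `s`. -/
def Coherent {a b : ℕ} (s : ℕ) (f : Bits a → Bits b) : Prop :=
  ∃ Q : QCirc a b, Q.size ≤ s ∧ Q.op = Superop.ofFun f

namespace Coherent

variable {a b c d s t N : ℕ}

theorem mono {f : Bits a → Bits b} (h : Coherent s f) (hst : s ≤ t) : Coherent t f := by
  obtain ⟨Q, hQ, hf⟩ := h
  exact ⟨Q, hQ.trans hst, hf⟩

theorem congr {f g : Bits a → Bits b} (h : Coherent s f) (hfg : ∀ x, f x = g x) :
    Coherent s g := by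
  rwa [← show f = g from funext hfg]

theorem comp {g : Bits b → Bits c} {f : Bits a → Bits b} (hg : Coherent t g)
    (hf : Coherent s f) : Coherent (s + t) fun x => g (f x) := by
  obtain ⟨Q, hQ, hQf⟩ := hf
  obtain ⟨R, hR, hRg⟩ := hg
  exact ⟨Q.seq R, add_le_add hQ hR, by rw [QCirc.op_seq, hQf, hRg, Superop.ofFun_comp_ofFun]⟩

theorem par {f : Bits a → Bits b} {g : Bits c → Bits d} (hf : Coherent s f)
    (hg : Coherent t g) : Coherent (s + t) fun x => Fin.append (f x.left) (g x.right) := by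
  obtain ⟨Q, hQ, hQf⟩ := hf
  obtain ⟨R, hR, hRg⟩ := hg
  exact ⟨Q.par R, add_le_add hQ hR, by rw [QCirc.op_par, hQf, hRg, Superop.ofFun_tensor_ofFun]⟩

theorem perm (e : Fin b ≃ Fin a) : Coherent a fun x => x ∘ e := ⟨.perm e, le_rfl, rfl⟩

theorem id (a : ℕ) : Coherent a fun x : Bits a => x := perm (Equiv.refl _)

/-- A gate that acts on the wires `ι k` and leaves the others alone. -/
theorem onWires {g : Bits c → Bits c} (hg : Coherent s g) {ι : Fin c → Fin N}
    (hι : Function.Injective ι) {f : Bits N → Bits N} (h1 : ∀ x k, f x (ι k) = g (x ∘ ι) k)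
    (h2 : ∀ x w, w ∉ Set.range ι → f x w = x w) : Coherent (s + 3 * N) f := by
  classical
  have hcN : c ≤ N := by simpa using Fintype.card_le_of_injective ι hι
  have hcard : Fintype.card ((Set.range ι)ᶜ : Set (Fin N)) = N - c := by
    rw [Fintype.card_compl_set, Set.card_range_of_injective hι]; simp
  -- the wires in the order in which the gate acts on the last ones
  let e : Fin ((N - c) + c) ≃ Fin N :=
    finSumFinEquiv.symm.trans <| (Equiv.sumComm _ _).trans <|
      ((Equiv.ofInjective ι hι).sumCongr (Fintype.equivFinOfCardEq hcard).symm).trans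
        (Equiv.Set.sumCompl (Set.range ι))
  have e1 : ∀ k, e (Fin.natAdd _ k) = ι k := by
    intro k; simp [e, -Fin.natAdd_eq_addNat]
  have e2 : ∀ k, e (Fin.castAdd _ k) ∉ Set.range ι := by
    intro k
    simp only [e, Equiv.trans_apply, finSumFinEquiv_symm_apply_castAdd, Equiv.sumComm_apply,
      Sum.swap_inl, Equiv.sumCongr_apply, Sum.map_inr, Equiv.Set.sumCompl_apply_inr]
    exact ((Fintype.equivFinOfCardEq hcard).symm k).2
  have h := (perm e.symm).comp (((id (N - c)).par hg).comp (perm e))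
  refine (h.mono (by omega)).congr fun x => ?_
  funext w
  obtain ⟨v, rfl⟩ := e.surjective w
  simp only [Function.comp_apply, Equiv.symm_apply_apply]
  refine Fin.addCases (fun v => ?_) (fun v => ?_) v
  · rw [Fin.append_left, h2 _ _ (e2 v)]; rfl
  · rw [Fin.append_right, e1, h1]
    congr 1
    funext k
    exact congrArg x (e1 k)

theorem newZero : Coherent (N + 1) fun x : Bits N => (Fin.snoc x false : Bits (N + 1)) :=
  ((id N).par ⟨.newZero, le_rfl, QCirc.op_newZero⟩).congr fun x => by
    rw [Fin.append_single]; rfl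

theorem notLast :
    Coherent (6 + 3 * (N + 1)) fun x : Bits (N + 1) =>
      (Fin.snoc (fun i => x i.castSucc) (!x (Fin.last N)) : Bits (N + 1)) := by
  refine onWires (ι := fun _ : Fin 1 => Fin.last N) ⟨QCirc.notGate, le_rfl, QCirc.op_notGate⟩
    (fun _ _ _ => Subsingleton.elim _ _) (fun x k => ?_) fun x w hw => ?_
  · simp [Bits.single]
  · induction w using Fin.lastCases with
    | last => exact absurd ⟨0, rfl⟩ hw
    | cast w => simp

theorem copy (i : Fin N) :
    Coherent (5 * (N + 1)) fun x : Bits N => (Fin.snoc x (x i) : Bits (N + 1)) := by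
  have h : Coherent (1 + 3 * (N + 1)) fun x : Bits (N + 1) =>
      (Fin.snoc (fun i => x i.castSucc) (Bool.xor (x (Fin.last N)) (x i.castSucc)) :
        Bits (N + 1)) := by
    refine onWires (ι := ![i.castSucc, Fin.last N]) ⟨QCirc.cnot, le_rfl, QCirc.op_cnot⟩ ?_
      (fun x k => ?_) fun x w hw => ?_
    · intro p q hpq
      fin_cases p <;> fin_cases q <;> simp_all [Fin.ext_iff] <;> omega
    · fin_cases k <;> simp
    · induction w using Fin.lastCases with
      | last => exact absurd ⟨1, rfl⟩ hw
      | cast w => simp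
  refine ((h.comp newZero).mono (by omega)).congr fun x => ?_
  simp

theorem nand (i j : Fin N) :
    Coherent (15 * (N + 1)) fun x : Bits N => (Fin.snoc x (!(x i && x j)) : Bits (N + 1)) := by
  by_cases hij : i = j
  · subst hij
    refine ((notLast.comp (copy i)).mono (by omega)).congr fun x => ?_
    simp
  · have h : Coherent (1 + 3 * (N + 1)) fun x : Bits (N + 1) =>
        (Fin.snoc (fun i => x i.castSucc)
          (Bool.xor (x (Fin.last N)) (x i.castSucc && x j.castSucc)) : Bits (N + 1)) := by
      refine onWires (ι := ![i.castSucc, j.castSucc, Fin.last N])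
        ⟨QCirc.toffoli, le_rfl, QCirc.op_toffoli⟩ ?_ (fun x k => ?_) fun x w hw => ?_
      · intro p q hpq
        have hij' : (i : ℕ) ≠ j := fun h => hij (Fin.ext h)
        fin_cases p <;> fin_cases q <;> simp_all [Fin.ext_iff] <;> omega
      · fin_cases k <;> simp
      · induction w using Fin.lastCases with
        | last => exact absurd ⟨2, rfl⟩ hw
        | cast w => simp
    refine ((notLast.comp (h.comp newZero)).mono (by omega)).congr fun x => ?_
    simp

theorem copies (φ : Fin c → Fin N) :
    Coherent (N + c * (5 * (N + c + 1)))
      fun x : Bits N => (Fin.append x fun k => x (φ k) : Bits (N + c)) := by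
  induction c with
  | zero =>
    refine ((id N).mono (by omega)).congr fun x => ?_
    funext w
    exact (Fin.append_left x _ w).symm
  | succ c ih =>
    have h := (copy (Fin.castAdd c (φ (Fin.last c)))).comp (ih fun k => φ k.castSucc)
    refine (h.mono (by
      have := Nat.mul_le_mul (le_refl c) (show 5 * (N + c + 1) ≤ 5 * (N + (c + 1) + 1) by omega)
      rw [Nat.succ_mul c]; omega)).congr fun x => ?_
    rw [Fin.append_left]
    funext w
    refine Fin.lastCases ?_ (fun w => ?_) (w : Fin (N + c + 1))
    · rw [Fin.snoc_last]
      exact (Fin.append_right x (fun k => x (φ k)) (Fin.last c)).symm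
    · rw [Fin.snoc_castSucc]
      refine Fin.addCases (fun w => ?_) (fun w => ?_) w
      · rw [Fin.append_left]
        exact (Fin.append_left x (fun k => x (φ k)) w).symm
      · rw [Fin.append_right]
        exact (Fin.append_right x (fun k => x (φ k)) w.castSucc).symm

end Coherent

namespace BCirc

variable {n m s : ℕ}

/-- All wires of a Boolean circuit can be computed coherently. -/
theorem coherent_val (C : BCirc n m s) (j : ℕ) (hj : j ≤ s) :
    Coherent (20 * (n + 3) + j * (15 * (2 + n + s + 1)))
      fun x (w : Fin (2 + n + j)) => C.val x w (by omega) := by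
  induction j with
  | zero =>
    have h0 : Coherent 1 fun x : Bits 0 => (Bits.single false) :=
      ⟨.newZero, le_rfl, QCirc.op_newZero⟩
    have h1 := (Coherent.notLast (N := 0)).comp h0
    have h := ((h0.par h1).par (Coherent.id n)).comp
      (Coherent.perm (finCongr (show 0 + 0 + n = n by omega)))
    refine (h.mono (by omega)).congr fun x => ?_
    funext w
    refine Fin.addCases (fun w => ?_) (fun w => ?_) (w : Fin (1 + 1 + n))
    · rw [Fin.append_left, val_of_lt_two _ _ _ (by have := w.2; simp only [Fin.val_castAdd]; omega)]
      fin_cases w <;> rfl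
    · rw [Fin.append_right, val_input _ _ _ (by simp only [Fin.val_natAdd]; omega)
        (by simp only [Fin.val_natAdd]; omega)]
      exact congrArg x (Fin.ext (by simp))
  | succ j ih =>
    specialize ih (by omega)
    have h := (Coherent.nand (C.gate ⟨j, by omega⟩).1 (C.gate ⟨j, by omega⟩).2).comp ih
    refine (h.mono (by
      have : 2 + n + j + 1 ≤ 2 + n + s + 1 := by omega
      simp only
      rw [Nat.succ_mul j]; omega)).congr fun x => ?_
    funext w
    refine Fin.lastCases ?_ (fun w => ?_) (w : Fin (2 + n + j + 1))
    · rw [Fin.snoc_last]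
      exact (val_gate C x ⟨j, by omega⟩).symm
    · rw [Fin.snoc_castSucc]; rfl

end BCirc

namespace QCirc

/-- The circuit that discards all qubits. -/
def discardAll : (a : ℕ) → QCirc a 0
  | 0 => idle 0
  | a + 1 => (discardAll a).par discard

theorem size_discardAll (a : ℕ) : (discardAll a).size = a := by
  induction a with
  | zero => rfl
  | succ a ih => simp [discardAll, size, ih]

theorem discardAll_apply_unitState (a : ℕ) (x x' : Bits a) :
    (discardAll a).op.apply (unitState x x') = if x = x' then ket Fin.elim0 else 0 := by
  induction a with
  | zero =>
    rw [discardAll, op_idle, Superop.one_apply, if_pos (Subsingleton.elim _ _)]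
    rw [ket_eq_unitState]
    congr 1 <;> exact Subsingleton.elim _ _
  | succ a ih =>
    have hd : ∀ y y' : Bits 1, discard.op.apply (unitState y y') =
        if y = y' then ket Fin.elim0 else 0 := by
      intro y y'
      ext z z'
      rw [Superop.apply_unitState]
      by_cases h : y = y' <;> simp [op, h, ket, eq_iff_true_of_subsingleton]
    have hx : x = Fin.append (Bits.left (a := a) (b := 1) x) (Bits.right (a := a) (b := 1) x) :=
      (Bits.append_left_right (a := a) (b := 1) x).symm
    have hx' : x' = Fin.append (Bits.left (a := a) (b := 1) x') (Bits.right (a := a) (b := 1) x') :=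
      (Bits.append_left_right (a := a) (b := 1) x').symm
    rw [hx, hx', ← QState.unitState_tensor, discardAll, op_par]
    refine (Superop.tensor_apply_tensor _ _ _ _).trans ?_
    rw [ih, hd]
    simp only [Bits.append_inj]
    by_cases h1 : Bits.left (a := a) (b := 1) x = Bits.left (a := a) (b := 1) x' <;>
      by_cases h2 : Bits.right (a := a) (b := 1) x = Bits.right (a := a) (b := 1) x'
    · simp only [h1, h2, and_self, if_true]
      exact (QState.ket_tensor_ket (a := 0) (b := 0) _ _).trans
        (congrArg ket (Subsingleton.elim (α := Bits 0) _ _))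
    all_goals simp [h1, h2]

end QCirc

/-- Boolean circuits can be simulated by quantum circuits of polynomial size. -/
theorem BCirc.exists_classical {n m s : ℕ} (C : BCirc n m s) :
    ∃ Q : QCirc n m, Q.size ≤ 100 * ((n + s + m + 1) * (n + s + m + 1)) ∧
      Q.op = Superop.classical C.eval := by
  obtain ⟨Q, hQ, hop⟩ := (Coherent.copies C.out).comp (C.coherent_val s le_rfl)
  let R : QCirc (2 + n + s + m) m :=
    ((QCirc.discardAll (2 + n + s)).par (QCirc.idle m)).seq
      (.perm (finCongr (Nat.zero_add m).symm))
  have hR : R.size ≤ 2 + n + s + m + m := by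
    simp [R, QCirc.size, QCirc.size_discardAll, QCirc.idle]
  refine ⟨Q.seq R, ?_, ?_⟩
  · simp only [QCirc.size]
    refine (add_le_add hQ hR).trans ?_
    have hs : s * (15 * (2 + n + s + 1)) ≤ 45 * ((n + s + m + 1) * (n + s + m + 1)) := by nlinarith
    have hm : m * (5 * (2 + n + s + m + 1)) ≤ 15 * ((n + s + m + 1) * (n + s + m + 1)) := by
      nlinarith
    nlinarith
  · refine Superop.ext_unitState fun x x' => ?_
    rw [QCirc.op_seq, Superop.apply_comp, hop, Superop.ofFun_apply_unitState,
      ← QState.unitState_tensor, QCirc.op_seq, Superop.apply_comp, QCirc.op_par,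
      Superop.tensor_apply_tensor, QCirc.op_idle, Superop.one_apply,
      QCirc.discardAll_apply_unitState, Superop.classical_apply_unitState]
    have hinj : ((fun w : Fin (2 + n + s) => C.val x w w.2) =
        fun w : Fin (2 + n + s) => C.val x' w w.2) ↔ x = x' := by
      refine ⟨fun h => ?_, fun h => by rw [h]⟩
      funext i
      have := congrFun h ⟨2 + i, by omega⟩
      simp only at this
      rw [val_input _ _ _ (by omega) (by omega), val_input _ _ _ (by omega) (by omega)] at this
      simpa using this
    simp only [hinj]
    by_cases h : x = x'
    · subst h
      rw [if_pos rfl, if_pos rfl, ← ket_eq_unitState, QState.ket_tensor_ket, QCirc.op_perm,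
        Superop.ofFun_apply_ket]
      congr 1
      funext i
      have : (finCongr (Nat.zero_add m).symm i : Fin (0 + m)) = Fin.natAdd 0 i :=
        Fin.ext (by simp)
      rw [Function.comp_apply, this, Fin.append_right]
      rfl
    · rw [if_neg h, if_neg h, QState.zero_tensor, Superop.apply_zero]

/-! ### Quantum polynomial time with classical control -/

theorem QPT.dom {a b : ℕ → ℕ} {Q : ∀ i, QCirc (a i) (b i)} (h : QPT Q) : PolyBdd a :=
  ((PolyBdd.const 3).mul h).mono fun i => (Q i).dim_le.1

theorem QPT.cod {a b : ℕ → ℕ} {Q : ∀ i, QCirc (a i) (b i)} (h : QPT Q) : PolyBdd b :=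
  ((PolyBdd.const 3).mul h).mono fun i => (Q i).dim_le.2

theorem QPT.seq {a b c : ℕ → ℕ} {Q : ∀ i, QCirc (a i) (b i)} {R : ∀ i, QCirc (b i) (c i)}
    (hQ : QPT Q) (hR : QPT R) : QPT fun i => (Q i).seq (R i) := hQ.add hR

theorem QPT.par {a b c d : ℕ → ℕ} {Q : ∀ i, QCirc (a i) (b i)} {R : ∀ i, QCirc (c i) (d i)}
    (hQ : QPT Q) (hR : QPT R) : QPT fun i => (Q i).par (R i) := hQ.add hR

theorem QPT.perm {a b : ℕ → ℕ} (ha : PolyBdd a) (e : ∀ i, Fin (b i) ≃ Fin (a i)) :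
    QPT fun i => QCirc.perm (e i) := ha

theorem QPT.idle {a : ℕ → ℕ} (ha : PolyBdd a) : QPT fun i => QCirc.idle (a i) := ha

/-- Classical polynomial time functions can be computed by quantum circuits, which measure their
input. -/
theorem PEff.exists_qpt {X Y : ℕ → Type} [∀ i, Enc (X i)] [∀ i, Enc (Y i)] {f : ∀ i, X i → Y i}
    (hf : PEff f) : ∃ Q : ∀ i, QCirc (len (X i)) (len (Y i)), QPT Q ∧
      ∀ i, ∃ g : Bits (len (X i)) → Bits (len (Y i)), (Q i).op = Superop.classical g ∧
        ∀ x, g (enc x) = enc (f i x) := by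
  obtain ⟨s, C, hs, hC⟩ := hf.exists_circ
  choose Q hQ hop using fun i => (C i).exists_classical
  have h1 : PolyBdd fun i => len (X i) + s i + len (Y i) + 1 :=
    ((hf.dom.add hs).add hf.cod).add (.const 1)
  exact ⟨Q, ((PolyBdd.const 100).mul (h1.mul h1)).mono hQ, fun i => ⟨(C i).eval, hop i, hC i⟩⟩

theorem PEff.exists_qpt_apply {X Y : ℕ → Type} [∀ i, Enc (X i)] [∀ i, Enc (Y i)]
    {f : ∀ i, X i → Y i} (hf : PEff f) : ∃ Q : ∀ i, QCirc (len (X i)) (len (Y i)), QPT Q ∧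
      ∀ i x, (Q i).op.apply (ket (enc x)) = ket (enc (f i x)) := by
  obtain ⟨Q, hQ, h⟩ := hf.exists_qpt
  refine ⟨Q, hQ, fun i x => ?_⟩
  obtain ⟨g, hg, hgf⟩ := h i
  rw [hg, Superop.classical_apply_ket, hgf]

/-- Classical data can be copied. -/
theorem QPT.exists_copy {X : ℕ → Type} [∀ i, Enc (X i)] (h : PolyBdd fun i => len (X i)) :
    ∃ D : ∀ i, QCirc (len (X i)) (len (X i) + len (X i)), QPT D ∧
      ∀ i (x : X i), (D i).op.apply (ket (enc x)) = (ket (enc x)).tensor (ket (enc x)) := by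
  obtain ⟨D, hD, hD'⟩ := ((PEff.id h).pair (PEff.id h)).exists_qpt_apply
  exact ⟨D, hD, fun i x => (hD' i x).trans (QState.ket_tensor_ket _ _).symm⟩

theorem PEff.exists_qpt_classical {a b : ℕ → ℕ} {f : ∀ i, Bits (a i) → Bits (b i)}
    (hf : PEff f) : ∃ Q : ∀ i, QCirc (a i) (b i), QPT Q ∧
      ∀ i, (Q i).op = Superop.classical (f i) := by
  obtain ⟨Q, hQ, h⟩ := hf.exists_qpt
  refine ⟨Q, hQ, fun i => ?_⟩
  obtain ⟨g, hg, hgf⟩ := h i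
  rw [hg]
  congr 1
  exact funext hgf

/-- The superoperators `T i x`, which depend on classical data `x`, are implemented by a quantum
polynomial time algorithm that gets `x` as a classical input. -/
def CEff {X : ℕ → Type} [∀ i, Enc (X i)] {a b : ℕ → ℕ} (T : ∀ i, X i → Superop (a i) (b i)) :
    Prop :=
  ∃ Q : ∀ i, QCirc (len (X i) + a i) (b i), QPT Q ∧ ∀ i x, (Q i).op.feed (enc x) = T i x

theorem Superop.unitL_apply {a : ℕ} (ρ : QState a) (y : Bits 0) :
    (ofFun fun x : Bits (0 + a) => (x ∘ finCongr (Nat.zero_add a).symm : Bits a)).apply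
      ((ket y).tensor ρ) = ρ := by
  ext z z'
  rw [ofFun_perm_apply]
  simp only [QState.tensor, Matrix.of_apply]
  have h : ∀ z : Bits a, Bits.right (z ∘ (finCongr (Nat.zero_add a).symm).symm) = z := by
    intro z; funext i; exact congrArg z (Fin.ext (by simp))
  rw [h, h]
  simp [ket, eq_iff_true_of_subsingleton]

theorem Superop.unitL_symm_apply {a : ℕ} (ρ : QState a) (y : Bits 0) :
    (ofFun fun x : Bits a => (x ∘ finCongr (Nat.zero_add a) : Bits (0 + a))).apply ρ =
      (ket y).tensor ρ := by
  ext z z'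
  rw [ofFun_perm_apply]
  simp only [QState.tensor, Matrix.of_apply]
  have h : ∀ z : Bits (0 + a), z ∘ (finCongr (Nat.zero_add a)).symm = Bits.right z := by
    intro z; funext i; exact congrArg z (Fin.ext (by simp))
  rw [h, h]
  simp [ket, eq_iff_true_of_subsingleton]

namespace CEff

variable {X Y : ℕ → Type} [∀ i, Enc (X i)] [∀ i, Enc (Y i)] {a b c d m : ℕ → ℕ}

theorem ctrl {T : ∀ i, X i → Superop (a i) (b i)} (h : CEff T) : PolyBdd fun i => len (X i) := by
  obtain ⟨Q, hQ, -⟩ := h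
  exact hQ.dom.mono fun i => Nat.le_add_right _ _

theorem dom {T : ∀ i, X i → Superop (a i) (b i)} (h : CEff T) : PolyBdd a := by
  obtain ⟨Q, hQ, -⟩ := h
  exact hQ.dom.mono fun i => Nat.le_add_left _ _

theorem cod {T : ∀ i, X i → Superop (a i) (b i)} (h : CEff T) : PolyBdd b := by
  obtain ⟨Q, hQ, -⟩ := h
  exact hQ.cod

theorem of_circ {Q : ∀ i, QCirc (m i + a i) (b i)} (hQ : QPT Q) :
    CEff (X := fun i => Bits (m i)) fun i x => (Q i).op.feed x := ⟨Q, hQ, fun _ _ => rfl⟩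

theorem map {T : ∀ i, Y i → Superop (a i) (b i)} (hT : CEff T) {f : ∀ i, X i → Y i}
    (hf : PEff f) : CEff fun i x => T i (f i x) := by
  obtain ⟨Q, hQ, hT'⟩ := id hT
  obtain ⟨R, hR, hf'⟩ := hf.exists_qpt_apply
  refine ⟨_, (hR.par (QPT.idle hT.dom)).seq hQ, fun i x => Superop.ext_apply fun ρ => ?_⟩
  simp only [Superop.feed_apply, QCirc.op_seq, Superop.apply_comp, QCirc.op_par, QCirc.op_idle,
    Superop.tensor_apply_tensor, hf', Superop.one_apply, ← hT']

theorem comp {T : ∀ i, X i → Superop (b i) (c i)} {S : ∀ i, X i → Superop (a i) (b i)}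
    (hT : CEff T) (hS : CEff S) : CEff fun i x => (T i x).comp (S i x) := by
  obtain ⟨Q, hQ, hT'⟩ := id hT
  obtain ⟨R, hR, hS'⟩ := id hS
  have hx := hT.ctrl
  obtain ⟨D, hD, hD'⟩ := QPT.exists_copy hx
  refine ⟨_, ((hD.par (QPT.idle hS.dom)).seq (QPT.perm ((hx.add hx).add hS.dom) fun i =>
    Superop.assocR (len (X i)) (len (X i)) (a i))).seq (((QPT.idle hx).par hR).seq hQ),
    fun i x => Superop.ext_apply fun ρ => ?_⟩
  simp only [Superop.feed_apply, QCirc.op_seq, Superop.apply_comp, QCirc.op_par, QCirc.op_idle,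
    Superop.tensor_apply_tensor, hD', Superop.one_apply, QCirc.op_perm, Superop.assocR_apply,
    ← hT', ← hS']

theorem tensor {T : ∀ i, X i → Superop (a i) (b i)} {S : ∀ i, X i → Superop (c i) (d i)}
    (hT : CEff T) (hS : CEff S) : CEff (a := fun i => a i + c i) (b := fun i => b i + d i)
      fun i x => (T i x).tensor (S i x) := by
  obtain ⟨Q, hQ, hT'⟩ := id hT
  obtain ⟨R, hR, hS'⟩ := id hS
  have hx := hT.ctrl
  obtain ⟨D, hD, hD'⟩ := QPT.exists_copy hx
  refine ⟨_, ((hD.par (QPT.idle (hT.dom.add hS.dom))).seq (QPT.perm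
    ((hx.add hx).add (hT.dom.add hS.dom)) fun i =>
      Superop.swapMid (len (X i)) (len (X i)) (a i) (c i))).seq (hQ.par hR),
    fun i x => Superop.ext_tensor fun ρ σ => ?_⟩
  simp only [Superop.feed_apply, QCirc.op_seq, Superop.apply_comp, QCirc.op_par, QCirc.op_idle,
    Superop.tensor_apply_tensor, hD', Superop.one_apply, QCirc.op_perm, Superop.swapMid_apply,
    ← hT', ← hS']

theorem const {Q : ∀ i, QCirc (a i) (b i)} (hQ : QPT Q) (hX : PolyBdd fun i => len (X i)) :
    CEff fun i (_ : X i) => (Q i).op := by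
  have hD : QPT fun i => QCirc.discardAll (len (X i)) :=
    hX.mono fun i => (QCirc.size_discardAll _).le
  refine ⟨_, (hD.par hQ).seq (QPT.perm ((PolyBdd.const 0).add hQ.cod) fun i =>
    finCongr (Nat.zero_add (b i)).symm), fun i x => Superop.ext_apply fun ρ => ?_⟩
  rw [Superop.feed_apply, QCirc.op_seq, Superop.apply_comp, QCirc.op_par,
    Superop.tensor_apply_tensor, ket_eq_unitState, QCirc.discardAll_apply_unitState, if_pos rfl,
    QCirc.op_perm, Superop.unitL_apply]

theorem one (ha : PolyBdd a) (hX : PolyBdd fun i => len (X i)) :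
    CEff fun i (_ : X i) => (1 : Superop (a i) (a i)) := by
  simpa only [QCirc.op_idle] using const (X := X) (QPT.idle ha) hX

theorem adjoin {f : ∀ i, X i → Bits (m i)} (ha : PolyBdd a) (hf : PEff f) :
    CEff (b := fun i => m i + a i) fun i x => (Superop.adjoin (f i x) : Superop (a i) _) := by
  have := (of_circ (m := m) (a := a) (QPT.idle (hf.cod.add ha))).map hf
  simp only [QCirc.op_idle] at this
  exact this

theorem measure {T : ∀ i, X i × Bits (m i) → Superop (a i) (b i)} (hT : CEff T) :
    CEff (a := fun i => m i + a i) fun i x => Superop.measure fun y => T i (x, y) := by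
  obtain ⟨Q, hQ, hT'⟩ := id hT
  have hm : PolyBdd m := hT.ctrl.mono fun i => Nat.le_add_left _ _
  have hx : PolyBdd fun i => len (X i) := hT.ctrl.mono fun i => Nat.le_add_right _ _
  obtain ⟨D, hD, hD'⟩ := (PEff.id (X := fun i => Bits (m i)) hm).exists_qpt_classical
  refine ⟨_, ((QPT.idle hx).par (hD.par (QPT.idle hT.dom))).seq ((QPT.perm
    (hx.add (hm.add hT.dom)) fun i => (Superop.assocR (len (X i)) (m i) (a i)).symm).seq hQ),
    fun i x => Superop.ext_apply fun ρ => ?_⟩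
  simp only [Superop.feed_apply, QCirc.op_seq, Superop.apply_comp, QCirc.op_par, QCirc.op_idle,
    Superop.tensor_apply_tensor, hD', Superop.one_apply, QCirc.op_perm]
  rw [Superop.measure_tensor_one, QState.tensor_sum, Superop.apply_sum, Superop.apply_sum,
    Superop.measure_apply]
  refine Finset.sum_congr rfl fun y _ => ?_
  refine (congrArg (Q i).op.apply (Superop.assocL_apply _ _ _)).trans ?_
  rw [QState.ket_tensor_ket, ← hT']
  exact (Superop.feed_apply _ _ _).symm

/-- A classical function, applied to the measured register. -/
theorem classical {f : ∀ i, Bits (a i) → Bits (b i)} (hX : PolyBdd fun i => len (X i))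
    (hf : PEff f) : CEff fun i (_ : X i) => Superop.classical (f i) := by
  obtain ⟨Q, hQ, h⟩ := hf.exists_qpt_classical
  simpa only [h] using const (X := X) hQ hX

/-- Controlled superoperators without classical data are quantum algorithms. -/
theorem exists_circ {T : ∀ i, Bits 0 → Superop (a i) (b i)} (h : CEff T) :
    ∃ Q : ∀ i, QCirc (a i) (b i), QPT Q ∧ ∀ i, (Q i).op = T i Fin.elim0 := by
  obtain ⟨Q, hQ, hT⟩ := id h
  refine ⟨_, (QPT.perm h.dom fun i => finCongr (Nat.zero_add (a i))).seq hQ, fun i =>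
    Superop.ext_apply fun ρ => ?_⟩
  rw [QCirc.op_seq, Superop.apply_comp, QCirc.op_perm, Superop.unitL_symm_apply ρ Fin.elim0]
  exact (Superop.feed_apply _ _ _).symm.trans
    (congrArg (fun S : Superop (a i) (b i) => S.apply ρ) (hT i Fin.elim0))

end CEff

/-! ### Random coins -/

namespace QCirc

/-- `m` qubits, each in the state `H|0⟩`. -/
def coins : (m : ℕ) → QCirc 0 m
  | 0 => idle 0
  | m + 1 => (coins m).par (newZero.seq hadamard)

theorem size_coins (m : ℕ) : (coins m).size = 2 * m := by
  induction m with
  | zero => rfl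
  | succ m ih => simp [coins, size, ih]; ring

theorem coins_prepare (m : ℕ) (y : Bits m) : (coins m).prepare y y = (1 / 2 : ℂ) ^ m := by
  induction m with
  | zero =>
    simp only [prepare, run, coins, op_idle, Superop.one_apply]
    simp [ket, eq_iff_true_of_subsingleton]
  | succ m ih =>
    have e : (ket (Fin.elim0 : Bits 0)) =
        QState.tensor (a := 0) (b := 0) (ket Fin.elim0) (ket Fin.elim0) :=
      ((QState.ket_tensor_ket (a := 0) (b := 0) _ _).trans
        (congrArg ket (Subsingleton.elim (α := Bits 0) _ _))).symm
    have h : (coins (m + 1)).prepare =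
        QState.tensor (coins m).prepare ((newZero.seq hadamard).op.apply (ket Fin.elim0)) := by
      refine (congrArg (coins (m + 1)).op.apply e).trans ?_
      exact Superop.tensor_apply_tensor _ _ _ _
    have h1 : ∀ z : Bits 1, (newZero.seq hadamard).op.apply (ket Fin.elim0) z z = 1 / 2 := by
      intro z
      rw [op_seq, Superop.apply_comp, op_newZero, Superop.ofFun_apply_ket, ket_eq_unitState,
        Superop.apply_unitState]
      have hs : (Real.sqrt 2 : ℂ) * (Real.sqrt 2 : ℂ) = 2 := by
        rw [← Complex.ofReal_mul, Real.mul_self_sqrt (by norm_num)]; simp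
      simp only [op, Superop.conj, hadamardMatrix, Matrix.of_apply, Bits.single]
      simp
      rw [← mul_inv, hs]
    rw [h]
    refine (QState.tensor_apply (a := m) (b := 1) _ _ y y).trans ?_
    rw [ih, h1, pow_succ]

end QCirc

theorem Superop.expect_apply {a b : ℕ} {ι : Type*} [Fintype ι] (S : ι → Superop a b)
    (ρ : QState a) : Superop.apply (𝔼 i, S i) ρ = 𝔼 i, (S i).apply ρ := by
  have h : ∀ q : ℚ≥0, ∀ T : Superop a b, Superop.apply (q • T) ρ = q • T.apply ρ := by
    intro q T
    ext z z'
    simp only [apply, Matrix.of_apply, Matrix.smul_apply, Finset.smul_sum, smul_mul_assoc]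
  rw [Finset.expect, Finset.expect, h, Superop.sum_apply]

theorem CEff.expect {X : ℕ → Type} [∀ i, Enc (X i)] {a b m : ℕ → ℕ}
    {T : ∀ i, X i × Bits (m i) → Superop (a i) (b i)} (hT : CEff T) :
    CEff fun i x => 𝔼 y : Bits (m i), T i (x, y) := by
  have hm : PolyBdd m := hT.ctrl.mono fun i => Nat.le_add_left _ _
  have hx : PolyBdd fun i => len (X i) := hT.ctrl.mono fun i => Nat.le_add_right _ _
  have hc : QPT fun i => QCirc.coins (m i) :=
    ((PolyBdd.const 2).mul hm).mono fun i => (QCirc.size_coins _).le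
  have h1 := hT.measure.comp (CEff.const (X := X) ((QPT.perm hT.dom fun i =>
    finCongr (Nat.zero_add (a i))).seq (hc.par (QPT.idle hT.dom))) hx)
  refine (Eq.mp (congrArg CEff ?_) h1 : CEff (X := X) _)
  funext i x
  refine Superop.ext_apply fun ρ => ?_
  rw [Superop.apply_comp, QCirc.op_seq, Superop.apply_comp, QCirc.op_perm,
    Superop.unitL_symm_apply ρ Fin.elim0, QCirc.op_par, Superop.tensor_apply_tensor,
    QCirc.op_idle, Superop.one_apply, Superop.measure_apply, Superop.expect_apply]
  have h : ∀ y, QState.postMeasure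
      (QState.tensor ((QCirc.coins (m i)).op.apply (ket Fin.elim0)) ρ) y =
        ((1 / 2 : ℂ) ^ m i) • ρ := by
    intro y
    rw [QState.postMeasure_tensor]
    congr 1
    exact QCirc.coins_prepare _ _
  simp only [h, Superop.apply_smul, ← Finset.smul_sum]
  ext z z'
  rw [Finset.expect]
  simp only [Matrix.smul_apply, Finset.card_univ, Fintype.card_pi, Fintype.card_bool,
    Finset.prod_const, Fintype.card_fin, smul_eq_mul]
  rw [NNRat.smul_def]
  simp

/-! ### Positivity and normalization -/

section Positivity

open scoped ComplexOrder

/-- Density matrices. -/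
def QState.IsState {a : ℕ} (ρ : QState a) : Prop := ρ.PosSemidef ∧ ρ.trace = 1

/-- Completely positive and trace preserving maps, in Kraus form. -/
def Superop.IsChannel {a b : ℕ} (S : Superop a b) : Prop :=
  ∃ (ι : Type) (_ : Fintype ι) (K : ι → Matrix (Bits b) (Bits a) ℂ),
    (∀ z z' x x', S (z, z') (x, x') = ∑ i, K i z x * star (K i z' x')) ∧
      ∑ i, (K i).conjTranspose * K i = 1

namespace Superop.IsChannel

variable {a b c d : ℕ}

theorem isState {S : Superop a b} (hS : S.IsChannel) {ρ : QState a} (hρ : ρ.IsState) :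
    (S.apply ρ).IsState := by
  obtain ⟨ι, _, K, hK, hK1⟩ := hS
  have h : S.apply ρ = ∑ i, K i * ρ * (K i).conjTranspose := by
    ext z z'
    simp only [Superop.apply, Matrix.of_apply, hK, Matrix.sum_apply, Matrix.mul_apply,
      Matrix.conjTranspose_apply, Fintype.sum_prod_type, Finset.sum_mul]
    have : ∀ x x', ∑ i, K i z x * star (K i z' x') * ρ x x' =
        ∑ i, K i z x * ρ x x' * star (K i z' x') := fun x x' =>
      Finset.sum_congr rfl fun i _ => by ring
    simp only [this]
    conv_rhs => rw [Finset.sum_comm]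
    rw [Finset.sum_comm]
    exact Finset.sum_congr rfl fun x _ => Finset.sum_comm
  refine ⟨?_, ?_⟩
  · rw [h]
    exact Matrix.posSemidef_sum _ fun i _ => hρ.1.mul_mul_conjTranspose_same (K i)
  · rw [h, Matrix.trace_sum]
    have : ∀ i, (K i * ρ * (K i).conjTranspose).trace = ((K i).conjTranspose * K i * ρ).trace := by
      intro i
      rw [Matrix.mul_assoc, Matrix.trace_mul_comm, Matrix.mul_assoc, Matrix.trace_mul_comm,
        Matrix.mul_assoc]
    simp only [this]
    rw [← Matrix.trace_sum, ← Matrix.sum_mul, hK1, Matrix.one_mul, hρ.2]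

theorem comp {T : Superop b c} {S : Superop a b} (hT : T.IsChannel) (hS : S.IsChannel) :
    (T.comp S).IsChannel := by
  obtain ⟨ι, _, K, hK, hK1⟩ := hS
  obtain ⟨κ, _, L, hL, hL1⟩ := hT
  refine ⟨κ × ι, inferInstance, fun p => L p.1 * K p.2, fun z z' x x' => ?_, ?_⟩
  · have : (T.comp S) (z, z') (x, x') = ∑ p : Bits b × Bits b, T (z, z') p * S p (x, x') := rfl
    rw [this]
    have h1 : ∀ q : Bits b × Bits b, T (z, z') q * S q (x, x') =
        ∑ p : κ × ι, L p.1 z q.1 * K p.2 q.1 x * star (L p.1 z' q.2 * K p.2 q.2 x') := by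
      intro q
      rw [hK, hL, Finset.sum_mul_sum, Fintype.sum_prod_type]
      refine Finset.sum_congr rfl fun i _ => Finset.sum_congr rfl fun j _ => ?_
      rw [star_mul']
      ring
    simp only [h1]
    rw [Finset.sum_comm]
    refine Finset.sum_congr rfl fun p _ => ?_
    rw [Fintype.sum_prod_type, Matrix.mul_apply, Matrix.mul_apply, star_sum, Finset.sum_mul_sum]
  · have : ∀ p : κ × ι, (L p.1 * K p.2).conjTranspose * (L p.1 * K p.2) =
        (K p.2).conjTranspose * ((L p.1).conjTranspose * L p.1) * K p.2 := by
      intro p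
      rw [Matrix.conjTranspose_mul]
      simp only [Matrix.mul_assoc]
    simp only [this, Fintype.sum_prod_type]
    rw [Finset.sum_comm]
    have h2 : ∀ i, ∑ j, (K i).conjTranspose * ((L j).conjTranspose * L j) * K i =
        (K i).conjTranspose * K i := by
      intro i
      rw [← Matrix.sum_mul, ← Matrix.mul_sum, hL1, Matrix.mul_one]
    simp only [h2, hK1]

theorem tensor {S : Superop a b} {T : Superop c d} (hS : S.IsChannel) (hT : T.IsChannel) :
    (S.tensor T).IsChannel := by
  obtain ⟨ι, _, K, hK, hK1⟩ := hS
  obtain ⟨κ, _, L, hL, hL1⟩ := hT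
  refine ⟨ι × κ, inferInstance,
    fun p => Matrix.of fun z x => K p.1 z.left x.left * L p.2 z.right x.right,
    fun z z' x x' => ?_, ?_⟩
  · simp only [Superop.tensor, Matrix.of_apply, hK, hL, Fintype.sum_prod_type, Finset.sum_mul_sum,
      star_mul']
    exact Finset.sum_congr rfl fun i _ => Finset.sum_congr rfl fun j _ => by ring
  · have e1 : ∀ x x', (∑ i, ∑ u, star (K i u x) * K i u x') = (1 : Matrix _ _ ℂ) x x' := by
      intro x x'
      rw [← hK1, Matrix.sum_apply]
      simp only [Matrix.mul_apply, Matrix.conjTranspose_apply]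
    have e2 : ∀ x x', (∑ i, ∑ u, star (L i u x) * L i u x') = (1 : Matrix _ _ ℂ) x x' := by
      intro x x'
      rw [← hL1, Matrix.sum_apply]
      simp only [Matrix.mul_apply, Matrix.conjTranspose_apply]
    ext x x'
    simp only [Matrix.sum_apply, Matrix.mul_apply, Matrix.conjTranspose_apply, Matrix.of_apply,
      Bits.sum_append (M := ℂ), Bits.left_append, Bits.right_append, Fintype.sum_prod_type,
      star_mul']
    have h1 : ∀ i j u v, star (K i u x.left) * star (L j v x.right) *
        (K i u x'.left * L j v x'.right) =
        (star (K i u x.left) * K i u x'.left) * (star (L j v x.right) * L j v x'.right) :=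
      fun i j u v => by ring
    simp only [h1, ← Finset.sum_mul_sum, e1, e2, Matrix.one_apply]
    have h2 : x = x' ↔ x.left = x'.left ∧ x.right = x'.right := by
      rw [← Bits.append_inj, Bits.append_left_right, Bits.append_left_right]
    by_cases h3 : x.left = x'.left <;> by_cases h4 : x.right = x'.right <;> simp [h2, h3, h4]

theorem feed {S : Superop (a + b) c} (hS : S.IsChannel) (x : Bits a) : (S.feed x).IsChannel := by
  obtain ⟨ι, _, K, hK, hK1⟩ := hS
  refine ⟨ι, inferInstance, fun i => Matrix.of fun z y => K i z (Fin.append x y),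
    fun z z' y y' => hK _ _ _ _, ?_⟩
  ext y y'
  have := congrFun (congrFun hK1 (Fin.append x y)) (Fin.append x y')
  simp only [Matrix.sum_apply, Matrix.mul_apply, Matrix.conjTranspose_apply, Matrix.of_apply,
    Matrix.one_apply, Bits.append_inj, true_and] at this ⊢
  exact this

theorem ofFun {f : Bits a → Bits b} (hf : Function.Injective f) :
    (Superop.ofFun f).IsChannel := by
  refine ⟨Unit, inferInstance, fun _ => Matrix.of fun z x => if z = f x then 1 else 0,
    fun z z' x x' => ?_, ?_⟩
  · by_cases h1 : z = f x <;> by_cases h2 : z' = f x' <;> simp [Superop.ofFun, h1, h2]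
  · ext x x'
    simp [Matrix.mul_apply, Matrix.one_apply, hf.eq_iff, eq_comm]

theorem conj {U : Matrix (Bits a) (Bits a) ℂ} (hU : U.conjTranspose * U = 1) :
    (Superop.conj U).IsChannel :=
  ⟨Unit, inferInstance, fun _ => U, fun z z' x x' => by simp [Superop.conj], by simpa using hU⟩

end Superop.IsChannel

theorem QCirc.isChannel {a b : ℕ} (F : QCirc a b) : F.op.IsChannel := by
  induction F with
  | perm e =>
    rw [op_perm]
    exact .ofFun fun x y h => by
      funext i
      have := congrFun h (e.symm i)
      simpa using this
  | hadamard =>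
    refine .conj ?_
    have hs : (Real.sqrt 2 : ℂ) * (Real.sqrt 2 : ℂ) = 2 := by
      rw [← Complex.ofReal_mul, Real.mul_self_sqrt (by norm_num)]; simp
    have hs0 : (Real.sqrt 2 : ℂ) ≠ 0 := by
      intro h; rw [h] at hs; norm_num at hs
    ext x x'
    rw [Matrix.mul_apply, Bits.sum_one, Bits.eq_single x, Bits.eq_single x']
    simp only [Matrix.conjTranspose_apply, hadamardMatrix, Matrix.of_apply, Matrix.one_apply,
      Bits.single_injective.eq_iff]
    simp only [Bits.single]
    cases x 0 <;> cases x' 0 <;> simp <;> field_simp <;> rw [sq, hs] <;> norm_num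
  | tGate =>
    refine .conj ?_
    have h1 : star (Complex.exp (Complex.I * Real.pi / 4)) * Complex.exp (Complex.I * Real.pi / 4)
        = 1 := by
      rw [Complex.star_def, ← Complex.exp_conj, ← Complex.exp_add]
      have h4 : (starRingEnd ℂ) 4 = 4 := map_ofNat _ 4
      simp only [map_div₀, map_mul, Complex.conj_I, Complex.conj_ofReal, h4]
      rw [← Complex.exp_zero]
      congr 1
      ring
    ext x x'
    rw [Matrix.mul_apply, Bits.sum_one, Bits.eq_single x, Bits.eq_single x']
    simp only [Matrix.conjTranspose_apply, tMatrix, Matrix.of_apply, Matrix.one_apply,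
      Bits.single_injective.eq_iff]
    simp only [Bits.single]
    cases x 0 <;> cases x' 0 <;> simp
    exact h1
  | cnot =>
    rw [op_cnot]
    refine .ofFun ?_
    decide
  | toffoli =>
    rw [op_toffoli]
    refine .ofFun ?_
    decide
  | newZero =>
    rw [op_newZero]
    exact .ofFun fun x y _ => Subsingleton.elim _ _
  | discard =>
    refine ⟨Bits 1, inferInstance, fun i => Matrix.of fun _ x => if x = i then 1 else 0,
      fun z z' x x' => ?_, ?_⟩
    · by_cases h : x = x' <;> simp [op, h]
    · ext x x'
      simp [Matrix.sum_apply, Matrix.mul_apply, Matrix.one_apply]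
  | seq F G hF hG => exact hG.comp hF
  | par F G hF hG => exact hF.tensor hG

namespace QState

variable {a b : ℕ}

theorem IsState.ket (x : Bits a) : (ket x).IsState := by
  have h : (_root_.ket x) = Matrix.vecMulVec (Pi.single x 1) (star (Pi.single x 1)) := by
    ext z z'
    by_cases h1 : z = x <;> by_cases h2 : z' = x <;>
      simp [_root_.ket, Matrix.vecMulVec, Pi.single_apply, h1, h2]
  refine ⟨?_, ?_⟩
  · rw [h]; exact Matrix.posSemidef_vecMulVec_self_star _
  · simp [Matrix.trace, _root_.ket]

theorem IsState.tensor_ket {ρ : QState a} (hρ : ρ.IsState) (y : Bits b) :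
    (ρ.tensor (_root_.ket y)).IsState := by
  let S : Superop a (a + b) := Matrix.of fun z x =>
    if z.1 = Fin.append x.1 y ∧ z.2 = Fin.append x.2 y then 1 else 0
  have hS : S.IsChannel := Superop.IsChannel.ofFun (f := fun x => Fin.append x y) fun x x' h =>
    (Bits.append_inj.1 h).1
  have h : S.apply ρ = ρ.tensor (_root_.ket y) := by
    refine ext_append fun u v u' v' => ?_
    simp only [Superop.apply, S, Matrix.of_apply, tensor_apply, Bits.left_append,
      Bits.right_append, Bits.append_inj, Fintype.sum_prod_type, _root_.ket]
    rw [Finset.sum_eq_single u, Finset.sum_eq_single u']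
    · by_cases h1 : v = y <;> by_cases h2 : v' = y <;> simp [h1, h2]
    · intro w _ hw; simp [Ne.symm hw]
    · simp
    · intro w _ hw; simp [Ne.symm hw]
    · simp
  rw [← h]
  exact hS.isState hρ

theorem IsState.prob_nonneg {ρ : QState a} (hρ : ρ.IsState) (x : Bits a) : 0 ≤ ρ.prob x := by
  have := hρ.1.diag_nonneg (i := x)
  exact (Complex.le_def.1 this).1

theorem IsState.sum_prob {ρ : QState a} (hρ : ρ.IsState) : ∑ x, ρ.prob x = 1 := by
  have := congrArg Complex.re hρ.2
  simpa [Matrix.trace, prob] using this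

theorem IsState.prob_le_one {ρ : QState a} (hρ : ρ.IsState) (x : Bits a) : ρ.prob x ≤ 1 := by
  rw [← hρ.sum_prob]
  exact Finset.single_le_sum (fun y _ => hρ.prob_nonneg y) (Finset.mem_univ x)

end QState

theorem QCirc.prob_mem {a : ℕ} (F : QCirc a 1) (x : Bits a) :
    0 ≤ F.acceptProb x ∧ F.acceptProb x ≤ 1 :=
  ⟨(F.isChannel.isState (.ket x)).prob_nonneg _, (F.isChannel.isState (.ket x)).prob_le_one _⟩

end Positivity

/-! ### Negligible functions and finite averages -/

namespace Negl

variable {f g : ℕ → ℝ}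

theorem add (hf : Negl f) (hg : Negl g) : Negl fun i => f i + g i :=
  Asymptotics.SuperpolynomialDecay.add hf hg

theorem const_mul (hf : Negl f) (c : ℝ) : Negl fun i => c * f i :=
  Asymptotics.SuperpolynomialDecay.const_mul hf c

theorem mono (hg : Negl g) (h0 : ∀ i, 0 ≤ f i) (h : ∀ i, f i ≤ g i) : Negl f :=
  Asymptotics.SuperpolynomialDecay.trans_abs_le hg fun i => by
    rw [abs_of_nonneg (h0 i), abs_of_nonneg ((h0 i).trans (h i))]
    exact h i

end Negl

section Expect

variable {ι κ : Type*} [Fintype ι] [Fintype κ]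

theorem abs_expect_sub_expect_le [Nonempty ι] {f g : ι → ℝ} {c : ℝ} (h : ∀ i, |f i - g i| ≤ c) :
    |(𝔼 i, f i) - 𝔼 i, g i| ≤ c := by
  rw [← Finset.expect_sub_distrib]
  exact (Finset.abs_expect_le _ _).trans
    (Finset.expect_le Finset.univ_nonempty fun i _ => h i)

theorem expect_mem_unit [Nonempty ι] {f : ι → ℝ} (h : ∀ i, 0 ≤ f i ∧ f i ≤ 1) :
    0 ≤ (𝔼 i, f i) ∧ (𝔼 i, f i) ≤ 1 :=
  ⟨Finset.expect_nonneg fun i _ => (h i).1,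
    Finset.expect_le Finset.univ_nonempty fun i _ => (h i).2⟩

theorem exists_expect_le [Nonempty ι] (f : ι → ℝ) : ∃ i, (𝔼 j, f j) ≤ f i := by
  obtain ⟨i, hi⟩ := Finite.exists_max f
  exact ⟨i, Finset.expect_le Finset.univ_nonempty fun j _ => hi j⟩

/-- Two averages of functions with values in the unit interval differ by at most the density of the
set on which the functions are not known to be close, plus their distance elsewhere. -/
theorem abs_expect_sub_expect_le_of_good [Nonempty ι] {f g : ι → ℝ} {c : ℝ} (hc : 0 ≤ c)
    (P : ι → Prop) [DecidablePred P] (hf : ∀ i, 0 ≤ f i ∧ f i ≤ 1) (hg : ∀ i, 0 ≤ g i ∧ g i ≤ 1)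
    (h : ∀ i, P i → |f i - g i| ≤ c) :
    |(𝔼 i, f i) - 𝔼 i, g i| ≤ (𝔼 i, if P i then (0 : ℝ) else 1) + c := by
  rw [← Finset.expect_sub_distrib]
  refine (Finset.abs_expect_le _ _).trans ?_
  rw [← Fintype.expect_const (ι := ι) c, ← Finset.expect_add_distrib]
  refine Finset.expect_le_expect fun i _ => ?_
  by_cases hP : P i
  · simpa [hP] using h i hP
  · have h1 := hf i
    have h2 := hg i
    simp only [hP, if_false]
    rw [abs_le]
    constructor <;> linarith

theorem PMF.sum_map_uniform {α β : Type} [Fintype α] [Nonempty α] [Fintype β] [DecidableEq β]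
    (h : α → β) (f : β → ℝ) :
    ∑ y, (((PMF.uniformOfFintype α).map h) y).toReal * f y = 𝔼 a, f (h a) := by
  have e : ∀ y, (((PMF.uniformOfFintype α).map h) y).toReal =
      ∑ a, if y = h a then ((Fintype.card α : ℝ)⁻¹) else 0 := by
    intro y
    rw [PMF.map_apply, tsum_fintype, ENNReal.toReal_sum]
    · refine Finset.sum_congr rfl fun a _ => ?_
      by_cases hy : y = h a <;> simp [hy]
    · intro a _
      by_cases hy : y = h a <;> simp [hy]
  simp only [e, Finset.sum_mul, ite_mul, zero_mul]
  rw [Finset.sum_comm]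
  simp only [Finset.sum_ite_eq', Finset.mem_univ, if_true]
  rw [Fintype.expect_eq_sum_div_card, Finset.sum_div]
  exact Finset.sum_congr rfl fun a _ => by rw [div_eq_inv_mul]

end Expect

/-! ### State preparation -/

/-- The preparation of the state `ρ`. -/
def Superop.prep {b : ℕ} (ρ : QState b) : Superop 0 b := Matrix.of fun z _ => ρ z.1 z.2

theorem Superop.prep_apply {b : ℕ} (ρ : QState b) (y : Bits 0) : (prep ρ).apply (ket y) = ρ := by
  ext z z'
  rw [ket_eq_unitState, apply_unitState]
  rfl

theorem Superop.comp_prep {b c : ℕ} (S : Superop b c) (ρ : QState b) :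
    S.comp (prep ρ) = prep (S.apply ρ) :=
  ext_unitState fun x x' => by
    rw [Subsingleton.elim x' x, ← ket_eq_unitState, apply_comp, prep_apply, prep_apply]

/-- The map `σ ↦ σ ⊗ ρ`. -/
def Superop.adjoinRight {a b : ℕ} (ρ : QState b) : Superop a (a + b) :=
  Superop.tensor (a := a) (c := 0) 1 (prep ρ)

theorem Superop.adjoinRight_apply {a b : ℕ} (ρ : QState b) (σ : QState a) :
    (adjoinRight ρ).apply σ = σ.tensor ρ := by
  have h : σ = QState.tensor (a := a) (b := 0) σ (ket Fin.elim0) := by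
    ext z z'
    refine Eq.trans ?_ (QState.tensor_apply (a := a) (b := 0) _ _ z z').symm
    simp [ket, eq_iff_true_of_subsingleton]
    rfl
  refine (congrArg (adjoinRight (a := a) ρ).apply h).trans ?_
  refine (Superop.tensor_apply_tensor (a := a) (c := 0) _ _ _ _).trans ?_
  rw [one_apply, prep_apply]

namespace CEff

variable {X : ℕ → Type} [∀ i, Enc (X i)] {a b m : ℕ → ℕ}

/-- A controlled preparation of a state is a quantum algorithm that maps classical data to a
state. -/
theorem exists_run {T : ∀ i, X i → Superop 0 (b i)} (hT : CEff T) :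
    ∃ Q : ∀ i, QCirc (len (X i)) (b i), QPT Q ∧
      ∀ i x, (Q i).run (ket (enc x)) = (T i x).apply (ket Fin.elim0) := by
  obtain ⟨Q, hQ, h⟩ := id hT
  refine ⟨_, (QPT.perm hT.ctrl fun i => finCongr (Nat.add_zero (len (X i)))).seq hQ,
    fun i x => ?_⟩
  have e : Fin.append (enc x) Fin.elim0 = enc x ∘ finCongr (Nat.add_zero (len (X i))) := by
    rw [Fin.append_elim0]
    rfl
  simp only [← h, QCirc.run, QCirc.op_seq, Superop.apply_comp, QCirc.op_perm,
    Superop.ofFun_apply_ket, Superop.feed_apply, QState.ket_tensor_ket, e]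

theorem prep {f : ∀ i, X i → Bits (m i)} (hf : PEff f) {Q : ∀ i, QCirc (m i) (b i)} (hQ : QPT Q) :
    CEff fun i x => Superop.prep ((Q i).run (ket (f i x))) := by
  have h := (const (X := X) hQ hf.dom).comp (adjoin (a := fun _ => 0) (.const 0) hf)
  refine (Eq.mp (congrArg CEff ?_) h : CEff (X := X) _)
  funext i x
  refine Superop.ext_unitState (a := 0) fun y y' => ?_
  rw [Subsingleton.elim y' y, ← ket_eq_unitState, Superop.prep_apply]
  refine (Superop.apply_comp _ _ _).trans ?_
  refine congrArg (Q i).op.apply ?_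
  refine (Superop.adjoin_apply (b := 0) _ _).trans ?_
  refine (QState.ket_tensor_ket (b := 0) _ _).trans ?_
  refine congrArg ket ?_
  funext j
  exact Fin.append_left (n := 0) _ _ j

/-- A state that is prepared by a quantum algorithm can be adjoined. -/
theorem adjoinRight (ha : PolyBdd a) {ρ : ∀ i, X i → QState (b i)}
    (h : CEff fun i x => Superop.prep (ρ i x)) :
    CEff (b := fun i => a i + b i) fun i x => (Superop.adjoinRight (ρ i x) : Superop (a i) _) :=
  (one ha h.ctrl).tensor h

/-- The tensor product of a prepared state with classical data. -/
theorem prep_tensor_ket {ρ : ∀ i, X i → QState (b i)} (h : CEff fun i x => Superop.prep (ρ i x))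
    {f : ∀ i, X i → Bits (m i)} (hf : PEff f) :
    CEff fun i x => Superop.prep ((ρ i x).tensor (ket (f i x))) := by
  have h1 := prep hf (QPT.idle hf.cod)
  simp only [QCirc.run, QCirc.op_idle, Superop.one_apply] at h1
  have h2 := (adjoinRight h.cod h1).comp h
  simpa only [Superop.comp_prep, Superop.adjoinRight_apply] using h2

end CEff

/-! ### Quantum tests and distinguishers -/

/-- The function `p i` on classical data is the acceptance probability of a quantum polynomial time
algorithm. -/
def QAcc {X : ℕ → Type} [∀ i, Enc (X i)] (p : ∀ i, X i → ℝ) : Prop :=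
  ∃ D : ∀ i, QCirc (len (X i)) 1, QPT D ∧ ∀ i x, (D i).acceptProb (enc x) = p i x

namespace QAcc

variable {X Y Z : ℕ → Type} [∀ i, Enc (X i)] [∀ i, Enc (Y i)] [∀ i, Enc (Z i)]

theorem dom {p : ∀ i, X i → ℝ} (hp : QAcc p) : PolyBdd fun i => len (X i) := by
  obtain ⟨D, hD, -⟩ := hp
  exact hD.dom

theorem mem_unit {p : ∀ i, X i → ℝ} (hp : QAcc p) (i : ℕ) (x : X i) : 0 ≤ p i x ∧ p i x ≤ 1 := by
  obtain ⟨D, -, h⟩ := hp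
  rw [← h]
  exact (D i).prob_mem _

theorem comp {p : ∀ i, Y i → ℝ} (hp : QAcc p) {f : ∀ i, X i → Y i} (hf : PEff f) :
    QAcc fun i x => p i (f i x) := by
  obtain ⟨D, hD, h⟩ := hp
  obtain ⟨Q, hQ, hf'⟩ := hf.exists_qpt_apply
  refine ⟨_, hQ.seq hD, fun i x => ?_⟩
  simp only [← h, QCirc.acceptProb, QCirc.run, QCirc.op_seq, Superop.apply_comp, hf']

/-- The outcome of a controlled quantum algorithm that starts without quantum input. -/
theorem of_cEff {T : ∀ i, X i → Superop 0 1} (hT : CEff T) :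
    QAcc fun i x => ((T i x).apply (ket Fin.elim0)).prob (Bits.single true) := by
  obtain ⟨Q, hQ, h⟩ := hT.exists_run
  exact ⟨Q, hQ, fun i x => congrArg (QState.prob · (Bits.single true)) (h i x)⟩

end QAcc

/-- A generator fools tests with arbitrary classical side information: the best side information is
hardwired. -/
theorem Prg.Secure.fools {ℓ : ℕ → ℕ} {G : Prg ℓ} (hG : G.Secure) {Z : ℕ → Type} [∀ i, Enc (Z i)]
    [∀ i, Fintype (Z i)] [∀ i, Nonempty (Z i)] {p : ∀ i, Z i × Bits (2 * ℓ i) → ℝ} (hp : QAcc p) :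
    ∃ μ, Negl μ ∧ ∀ i z, |(𝔼 r : Bits (ℓ i), p i (z, (G.circ i).eval r)) -
      𝔼 y : Bits (2 * ℓ i), p i (z, y)| ≤ μ i := by
  choose z hz using fun i => Finite.exists_max fun z : Z i =>
    |(𝔼 r : Bits (ℓ i), p i (z, (G.circ i).eval r)) - 𝔼 y : Bits (2 * ℓ i), p i (z, y)|
  have hZ : PolyBdd fun i => len (Z i) := hp.dom.mono fun i => Nat.le_add_right _ _
  have hY : PolyBdd fun i => 2 * ℓ i := hp.dom.mono fun i => Nat.le_add_left _ _
  obtain ⟨D, hD, h⟩ := hp.comp ((PEff.const (X := fun i => Bits (2 * ℓ i)) hY hZ z).pair (.id hY))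
  obtain ⟨μ, hμ, hb⟩ := hG D hD
  refine ⟨μ, hμ, fun i z' => (hz i z').trans ?_⟩
  have := hb i
  have h' : ∀ y, (D i).acceptProb y = p i (z i, y) := h i
  simpa only [h'] using this

/-- The values of a function family at the punctured points fool tests with arbitrary classical
side information. -/
theorem PuncPrf.PunctureSecure.fools {n : ℕ → ℕ} {F : PuncPrf n} (hF : F.PunctureSecure)
    {Z : ℕ → Type} [∀ i, Enc (Z i)] [∀ i, Fintype (Z i)] [∀ i, Nonempty (Z i)]
    {p : ∀ i, Z i × (Bits (F.puncLen i) × ((Bits (n i) × Bits (n i)) ×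
      (Bits (n i) × Bits (n i)))) → ℝ} (hp : QAcc p) :
    ∃ μ, Negl μ ∧ ∀ i z (x₁ x₂ : Bits (n i)),
      |(𝔼 g : Bits (F.coins i), p i (z, F.puncture i (F.gen i g) x₁ x₂, (x₁, x₂),
          (F.app (F.gen i g) x₁, F.app (F.gen i g) x₂))) -
        𝔼 g : Bits (F.coins i), 𝔼 u₁ : Bits (n i), 𝔼 u₂ : Bits (n i),
          p i (z, F.puncture i (F.gen i g) x₁ x₂, (x₁, x₂),
            (u₁, if x₂ = x₁ then u₁ else u₂))| ≤ μ i := by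
  choose z hz using fun i => Finite.exists_max fun z : Z i × (Bits (n i) × Bits (n i)) =>
    |(𝔼 g : Bits (F.coins i), p i (z.1, F.puncture i (F.gen i g) z.2.1 z.2.2, (z.2.1, z.2.2),
          (F.app (F.gen i g) z.2.1, F.app (F.gen i g) z.2.2))) -
        𝔼 g : Bits (F.coins i), 𝔼 u₁ : Bits (n i), 𝔼 u₂ : Bits (n i),
          p i (z.1, F.puncture i (F.gen i g) z.2.1 z.2.2, (z.2.1, z.2.2),
            (u₁, if z.2.2 = z.2.1 then u₁ else u₂))|
  have hZ : PolyBdd fun i => len (Z i) := hp.dom.mono fun i => Nat.le_add_right _ _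
  have hY : PolyBdd fun i => len (Bits (F.puncLen i) × ((Bits (n i) × Bits (n i)) ×
      (Bits (n i) × Bits (n i)))) := hp.dom.mono fun i => Nat.le_add_left _ _
  obtain ⟨D, hD, h⟩ := hp.comp ((PEff.const hY hZ fun i => (z i).1).pair (.id hY))
  obtain ⟨μ, hμ, hb⟩ := hF D hD
  refine ⟨μ, hμ, fun i z' x₁ x₂ => (hz i (z', x₁, x₂)).trans ?_⟩
  have := hb i (z i).2.1 (z i).2.2
  have h' : ∀ κ x₁ x₂ u₁ u₂, (D i).acceptProb
      (Fin.append κ (Fin.append (Fin.append x₁ x₂) (Fin.append u₁ u₂))) =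
        p i ((z i).1, κ, (x₁, x₂), (u₁, u₂)) := fun κ x₁ x₂ u₁ u₂ =>
    h i (κ, (x₁, x₂), (u₁, u₂))
  simpa only [h'] using this

/-- Obfuscations of equivalent circuits fool tests with arbitrary classical side information. -/
theorem Obfuscator.IsIndist.fools {O : Obfuscator} (hO : O.IsIndist) {n m s : ℕ → ℕ}
    (hn : PolyBdd n) (hm : PolyBdd m) (hs : PolyBdd s) {Z : ℕ → Type} [∀ i, Enc (Z i)]
    [∀ i, Fintype (Z i)] [∀ i, Nonempty (Z i)]
    {p : ∀ i, Z i × BCirc (n i) (m i) (O.outSize i (n i) (m i) (s i)) → ℝ} (hp : QAcc p) :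
    ∃ μ, Negl μ ∧ ∀ i z (C₀ C₁ : BCirc (n i) (m i) (s i)), (∀ x, C₀.eval x = C₁.eval x) →
      |(𝔼 r, p i (z, O.obf i C₀ r)) - 𝔼 r, p i (z, O.obf i C₁ r)| ≤ μ i := by
  let W := fun i => { w : Z i × (BCirc (n i) (m i) (s i) × BCirc (n i) (m i) (s i)) //
    ∀ x, w.2.1.eval x = w.2.2.eval x }
  have : ∀ i, Nonempty (W i) := fun i =>
    ⟨⟨(Classical.arbitrary _, default, default), fun _ => rfl⟩⟩
  choose w hw using fun i => Finite.exists_max fun w : W i =>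
    |(𝔼 r, p i (w.1.1, O.obf i w.1.2.1 r)) - 𝔼 r, p i (w.1.1, O.obf i w.1.2.2 r)|
  have hZ : PolyBdd fun i => len (Z i) := hp.dom.mono fun i => Nat.le_add_right _ _
  have hC : PolyBdd fun i => len (BCirc (n i) (m i) (O.outSize i (n i) (m i) (s i))) :=
    hp.dom.mono fun i => Nat.le_add_left _ _
  have hX : PolyBdd fun i => len (BCirc (n i) (m i) (O.outSize i (n i) (m i) (s i)) ×
      (BCirc (n i) (m i) (s i) × BCirc (n i) (m i) (s i))) :=
    hC.add ((PolyBdd.descLen hn hm hs).add (PolyBdd.descLen hn hm hs))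
  obtain ⟨D, hD, h⟩ := hp.comp ((PEff.const hX hZ fun i => (w i).1.1).pair (PEff.id hX).fst)
  obtain ⟨μ, hμ, hb⟩ := hO.2 n m s hn hm hs D hD
  refine ⟨μ, hμ, fun i z C₀ C₁ hC => (hw i ⟨(z, C₀, C₁), hC⟩).trans ?_⟩
  have := hb i (w i).1.2.1 (w i).1.2.2 (w i).2
  have h' : ∀ C C₀ C₁, (D i).acceptProb (Fin.append (BCirc.encode C)
      (Fin.append (BCirc.encode C₀) (BCirc.encode C₁))) = p i ((w i).1.1, C) :=
    fun C C₀ C₁ => h i (C, C₀, C₁)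
  simpa only [h'] using this

/-! ### Coherent exclusive or -/

theorem Coherent.xorRight (n : ℕ) :
    Coherent (n + n + n * (1 + 3 * (n + n)))
      fun x : Bits (n + n) => Fin.append x.left (x.right.xor x.left) := by
  have key : ∀ j ≤ n, Coherent (n + n + j * (1 + 3 * (n + n))) fun x : Bits (n + n) =>
      (Fin.append x.left fun i : Fin n =>
        if (i : ℕ) < j then Bool.xor (x.right i) (x.left i) else x.right i) := by
    intro j
    induction j with
    | zero => exact fun _ => ((Coherent.id (n + n)).mono (by omega)).congr fun x => by simp
    | succ j ih =>
      intro hj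
      have hg : Coherent (1 + 3 * (n + n)) fun x : Bits (n + n) =>
          (Fin.append x.left fun i : Fin n =>
            if (i : ℕ) = j then Bool.xor (x.right i) (x.left i) else x.right i) := by
        refine Coherent.onWires (ι := ![Fin.castAdd n ⟨j, hj⟩, Fin.natAdd n ⟨j, hj⟩])
          ⟨QCirc.cnot, le_rfl, QCirc.op_cnot⟩ ?_ (fun x k => ?_) fun x w hw => ?_
        · intro p q hpq
          fin_cases p <;> fin_cases q <;> simp_all [Fin.ext_iff] <;> omega
        · refine Fin.cases ?_ (fun k => ?_) k
          · simp only [Matrix.cons_val_zero]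
            exact Fin.append_left _ _ _
          · rw [Subsingleton.elim k 0]
            refine (Fin.append_right x.left _ (⟨j, hj⟩ : Fin n)).trans ?_
            exact if_pos rfl
        · refine Fin.addCases (fun w hw => ?_) (fun w hw => ?_) w hw
          · exact Fin.append_left _ _ _
          · refine (Fin.append_right _ _ _).trans (if_neg fun h => hw ⟨1, ?_⟩)
            exact congrArg (Fin.natAdd n) (Fin.ext h.symm)
      refine ((hg.comp (ih (by omega))).mono (le_of_eq (by ring))).congr fun x => ?_
      rw [Bits.left_append, Bits.right_append]
      congr 1
      funext i
      rcases lt_trichotomy (i : ℕ) j with h | h | h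
      · rw [if_neg h.ne, if_pos h, if_pos (by omega)]
      · rw [if_pos h, if_neg (by omega), if_pos (by omega)]
      · rw [if_neg h.ne', if_neg (by omega), if_neg (by omega)]
  refine (key n le_rfl).congr fun x => ?_
  congr 1
  funext i
  exact if_pos i.2

theorem CEff.xor {n : ℕ → ℕ} (hn : PolyBdd n) :
    CEff (X := fun i => Bits (n i)) fun i m => Superop.ofFun fun x : Bits (n i) => x.xor m := by
  choose Q hQ hop using fun i => Coherent.xorRight (n i)
  have hQ' : QPT Q := ((hn.add hn).add (hn.mul
    ((PolyBdd.const 1).add ((PolyBdd.const 3).mul (hn.add hn))))).mono hQ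
  have hD : QPT fun i => QCirc.discardAll (n i) :=
    hn.mono fun i => (QCirc.size_discardAll _).le
  refine ⟨_, (hQ'.seq (hD.par (QPT.idle hn))).seq (QPT.perm ((PolyBdd.const 0).add hn) fun i =>
    finCongr (Nat.zero_add (n i)).symm), fun i m => Superop.ext_unitState fun x x' => ?_⟩
  rw [Superop.feed_apply, QCirc.op_seq, Superop.apply_comp, QCirc.op_seq, Superop.apply_comp,
    ket_eq_unitState, QState.unitState_tensor, hop, Superop.ofFun_apply_unitState,
    ← QState.unitState_tensor, QCirc.op_par, Superop.tensor_apply_tensor,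
    QCirc.discardAll_apply_unitState, Bits.left_append, Bits.left_append, if_pos rfl,
    QCirc.op_perm, Superop.unitL_apply, QCirc.op_idle, Superop.one_apply,
    Superop.ofFun_apply_unitState, Bits.right_append, Bits.right_append]
  rfl

theorem Bits.xor_comm {n : ℕ} (x y : Bits n) : x.xor y = y.xor x := by
  funext i; simp [Bits.xor, Bool.xor_comm]

theorem Superop.ofFun_xor_apply {n : ℕ} (m : Bits n) (ρ : QState n) (z z' : Bits n) :
    (ofFun fun x : Bits n => x.xor m).apply ρ z z' = ρ (z.xor m) (z'.xor m) := by
  have h : ∀ z x : Bits n, z = x.xor m ↔ x = z.xor m := fun z x => by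
    constructor <;> rintro rfl <;> rw [Bits.xor_xor_cancel]
  simp only [apply, ofFun, Matrix.of_apply, Fintype.sum_prod_type, h z, h z']
  rw [Finset.sum_eq_single (z.xor m), Finset.sum_eq_single (z'.xor m)]
  · simp
  · intro u _ hu; simp [hu]
  · simp
  · intro u _ hu; simp [hu]
  · simp

theorem QState.smul_nnrat {a : ℕ} (q : ℚ≥0) (ρ : QState a) : q • ρ = ((q : ℝ) : ℂ) • ρ := by
  ext z z'
  rw [Matrix.smul_apply, Matrix.smul_apply, NNRat.smul_def]
  simp

theorem Superop.apply_expect {a b : ℕ} {ι : Type*} [Fintype ι] (S : Superop a b)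
    (ρ : ι → QState a) : S.apply (𝔼 i, ρ i) = 𝔼 i, S.apply (ρ i) := by
  rw [Finset.expect, Finset.expect, QState.smul_nnrat, QState.smul_nnrat, apply_smul, apply_sum]

theorem QState.prob_expect {a : ℕ} {ι : Type*} [Fintype ι] (ρ : ι → QState a) (x : Bits a) :
    QState.prob (𝔼 i, ρ i) x = 𝔼 i, (ρ i).prob x := by
  rw [Finset.expect, Finset.expect, smul_nnrat, prob_smul, prob_sum, NNRat.smul_def]

theorem Superop.prob_apply_expect {a b : ℕ} {ι : Type*} [Fintype ι] (S : Superop a b)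
    (ρ : ι → QState a) (x : Bits b) :
    (S.apply (𝔼 i, ρ i)).prob x = 𝔼 i, (S.apply (ρ i)).prob x := by
  rw [Superop.apply_expect, QState.prob_expect]

theorem QState.tensor_expect {a b : ℕ} {ι : Type*} [Fintype ι] (ρ : QState a)
    (σ : ι → QState b) : ρ.tensor (𝔼 i, σ i) = 𝔼 i, ρ.tensor (σ i) := by
  rw [Finset.expect, Finset.expect, smul_nnrat, smul_nnrat, tensor_smul, tensor_sum]

theorem QState.expect_tensor {a b : ℕ} {ι : Type*} [Fintype ι] (ρ : ι → QState a)
    (σ : QState b) : QState.tensor (𝔼 i, ρ i) σ = 𝔼 i, (ρ i).tensor σ := by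
  rw [Finset.expect, Finset.expect, smul_nnrat, smul_nnrat, smul_tensor, sum_tensor]

/-! ### Circuits with hard-wired data -/

/-- Currying: a polynomial time function of two arguments gives circuits for the second argument
whose descriptions are computed from the first one. The circuits may be padded to any size above a
polynomial bound. -/
theorem PEff.exists_curry {X : ℕ → Type} [∀ i, Enc (X i)] {n m : ℕ → ℕ}
    {f : ∀ i, X i × Bits (n i) → Bits (m i)} (hf : PEff f) :
    ∃ s, PolyBdd s ∧ ∀ t, PolyBdd t → (∀ i, s i ≤ t i) →
      ∃ C : ∀ i, X i → BCirc (n i) (m i) (t i), PEff C ∧ ∀ i x z, (C i x).eval z = f i (x, z) := by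
  obtain ⟨s, E, hs, hE⟩ := hf.exists_circ
  have hX : PolyBdd fun i => len (X i) := hf.dom.mono fun i => Nat.le_add_right _ _
  have hn : PolyBdd n := hf.dom.mono fun i => Nat.le_add_left _ _
  refine ⟨s, hs, fun t ht hst => ?_⟩
  let E' : ∀ i, BCirc (len (X i) + n i) (m i) (s i) := E
  have hst' : ∀ i, 0 + s i ≤ t i := fun i => by have := hst i; omega
  refine ⟨fun i x => ((E' i).hardwire (enc x)).padTo (t i) (hst' i), ?_, fun i x z => ?_⟩
  · exact (PEff.of_refLocal (C := fun i k => ((E' i).hardwire k).padTo (t i) (hst' i)) hX hn hf.cod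
      ht fun i => (RefLocal.hardwire _).padTo _).comp (PEff.id hX).to_enc
  · rw [BCirc.eval_padTo, BCirc.eval_hardwire]
    exact hE i (x, z)

theorem Obfuscator.pEff (O : Obfuscator) {n m s : ℕ → ℕ} (hn : PolyBdd n) (hm : PolyBdd m)
    (hs : PolyBdd s) :
    PEff (X := fun i => BCirc (n i) (m i) (s i) × Bits (O.coins i (n i) (m i) (s i)))
      (Y := fun i => BCirc (n i) (m i) (O.outSize i (n i) (m i) (s i)))
      fun i x => O.obf i x.1 x.2 := by
  obtain ⟨p, hp⟩ := O.poly
  have hq : PolyBdd fun i => p.eval (i + n i + m i + s i) :=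
    .eval p (((PolyBdd.self.add hn).add hm).add hs)
  choose t ht D hD using fun i => (hp i (n i) (m i) (s i)).2.2
  exact .of_circ ((PolyBdd.descLen hn hm hs).add (hq.mono fun i => (hp i _ _ _).1))
    (.descLen hn hm (hq.mono fun i => (hp i _ _ _).2.1)) (hq.mono ht) D
    fun i x => hD i x.1 x.2

/-! ### The scheme -/

section Scheme

variable {ℓ : ℕ → ℕ} (F : PuncPrf fun lam => 2 * ℓ lam) (G : Prg ℓ) (O : Obfuscator) (U : Upo)
  (padC padF : ℕ → ℕ)

/-- The size of the padded encryption circuit. -/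
abbrev encSize (lam : ℕ) : ℕ :=
  G.size lam + 0 + 0 + (0 + (0 + F.evalSize lam + 0)) + (0 + 4 * (2 * ℓ lam)) + padC lam

/-- The size of the padded circuit of the function family. -/
abbrev decSize (lam : ℕ) : ℕ := 0 + F.evalSize lam + padF lam

/-- The circuits that are public keys. -/
abbrev PkCirc (lam : ℕ) : Type :=
  BCirc (ℓ lam + 2 * ℓ lam) (2 * ℓ lam + 2 * ℓ lam)
    (O.outSize lam (ℓ lam + 2 * ℓ lam) (2 * ℓ lam + 2 * ℓ lam) (encSize F G padC lam))

/-- The circuits that the unclonable obfuscator is applied to. -/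
abbrev SkCirc (lam : ℕ) : Type :=
  BCirc (2 * ℓ lam) (2 * ℓ lam) (O.outSize lam (2 * ℓ lam) (2 * ℓ lam) (decSize F padF lam))

/-- The padded encryption circuit. -/
def pkCircuit (lam : ℕ) (k : Bits (F.keyLen lam)) :
    BCirc (ℓ lam + 2 * ℓ lam) (2 * ℓ lam + 2 * ℓ lam) (encSize F G padC lam) :=
  (encCircuit F G lam k).pad (padC lam)

/-- The padded circuit of the function family. -/
def skCircuit (lam : ℕ) (k : Bits (F.keyLen lam)) :
    BCirc (2 * ℓ lam) (2 * ℓ lam) (decSize F padF lam) :=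
  decCircuit F padF lam k

theorem eval_pkCircuit (lam : ℕ) (k : Bits (F.keyLen lam)) (r : Bits (ℓ lam))
    (msg : Bits (2 * ℓ lam)) :
    (pkCircuit F G padC lam k).eval (Fin.append r msg) =
      Fin.append ((G.circ lam).eval r) ((F.app k ((G.circ lam).eval r)).xor msg) := by
  rw [pkCircuit, BCirc.pad_eq_padTo, BCirc.eval_padTo, encCircuit, BCirc.eval_comp,
    BCirc.eval_comp, BCirc.eval_comp, BCirc.eval_par, BCirc.eval_id, BCirc.eval_par,
    BCirc.eval_par, BCirc.eval_par, BCirc.eval_id, BCirc.eval_id, BCirc.eval_id,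
    BCirc.eval_xorCirc, BCirc.eval_hardwire, Bits.left_append, Bits.right_append]
  have h : ∀ y m : Bits (2 * ℓ lam), (BCirc.wires (Fin.append
      (fun i => Sum.inr (Fin.castAdd (2 * ℓ lam) i)) (fun i => Sum.inr i))).eval
        (Fin.append y m) = Fin.append y (Fin.append y m) := by
    intro y m
    funext i
    rw [BCirc.eval_wires]
    refine Fin.addCases (fun i => ?_) (fun i => ?_) i <;> simp
  rw [h]
  simp [PuncPrf.app]

theorem eval_skCircuit (lam : ℕ) (k : Bits (F.keyLen lam)) (x : Bits (2 * ℓ lam)) :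
    (skCircuit F padF lam k).eval x = F.app k x := by
  rw [skCircuit, decCircuit, BCirc.pad_eq_padTo, BCirc.eval_padTo, BCirc.eval_hardwire,
    PuncPrf.app]

variable {F G O U padC padF}

theorem PuncPrf.keyLen_poly : PolyBdd F.keyLen := F.gen_poly.2.1

theorem encSize_poly (hℓ : PolyBdd ℓ) (hC : PolyBdd padC) : PolyBdd (encSize F G padC) := by
  have h0 := PolyBdd.const 0
  exact ((((G.poly.add h0).add h0).add (h0.add ((h0.add F.eval_poly).add h0))).add
    (h0.add ((PolyBdd.const 4).mul ((PolyBdd.const 2).mul hℓ)))).add hC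

theorem decSize_poly (hF : PolyBdd padF) : PolyBdd (decSize F padF) :=
  ((PolyBdd.const 0).add F.eval_poly).add hF

theorem pkCircuit_pEff (hℓ : PolyBdd ℓ) (hC : PolyBdd padC) : PEff (pkCircuit F G padC) := by
  have hn : PolyBdd fun lam => 2 * ℓ lam := (PolyBdd.const 2).mul hℓ
  refine PEff.of_refLocal F.keyLen_poly (hℓ.add hn) (hn.add hn) (encSize_poly hℓ hC) fun i => ?_
  exact (((RefLocal.par (.const _) ((RefLocal.hardwire _).par (.const _))).comp_right _).comp_left
    _).padTo (Nat.le_add_right _ _)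

theorem skCircuit_pEff (hℓ : PolyBdd ℓ) (hF : PolyBdd padF) : PEff (skCircuit F padF) := by
  have hn : PolyBdd fun lam => 2 * ℓ lam := (PolyBdd.const 2).mul hℓ
  exact PEff.of_refLocal F.keyLen_poly hn hn (decSize_poly hF) fun i =>
    (RefLocal.hardwire _).padTo (Nat.le_add_right _ _)

theorem Upo.obfState_cEff (U : Upo) {X : ℕ → Type} [∀ i, Enc (X i)] {n m s : ℕ → ℕ}
    (hn : PolyBdd n) (hm : PolyBdd m) (hs : PolyBdd s) {C : ∀ i, X i → BCirc (n i) (m i) (s i)}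
    (hC : PEff C) : CEff fun i x => Superop.prep (U.obfState i (C i x)) := by
  obtain ⟨p, hp⟩ := U.poly
  have hq : PolyBdd fun i => p.eval (i + n i + m i + s i) :=
    .eval p (((PolyBdd.self.add hn).add hm).add hs)
  have : QPT fun i => U.obf i (n i) (m i) (s i) := hq.mono fun i => (hp i _ _ _).2.1
  exact CEff.prep hC.to_enc this

theorem Upo.eval_qpt (U : Upo) {n m s : ℕ → ℕ}
    (hn : PolyBdd n) (hm : PolyBdd m) (hs : PolyBdd s) :
    QPT fun i => U.eval i (n i) (m i) (s i) := by
  obtain ⟨p, hp⟩ := U.poly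
  have hq : PolyBdd fun i => p.eval (i + n i + m i + s i) :=
    .eval p (((PolyBdd.self.add hn).add hm).add hs)
  exact hq.mono fun i => (hp i _ _ _).2.2

theorem Upo.qubits_poly (U : Upo) {n m s : ℕ → ℕ}
    (hn : PolyBdd n) (hm : PolyBdd m) (hs : PolyBdd s) :
    PolyBdd fun i => U.qubits i (n i) (m i) (s i) := by
  obtain ⟨p, hp⟩ := U.poly
  have hq : PolyBdd fun i => p.eval (i + n i + m i + s i) :=
    .eval p (((PolyBdd.self.add hn).add hm).add hs)
  exact hq.mono fun i => (hp i _ _ _).1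

theorem Obfuscator.outSize_poly (O : Obfuscator) {n m s : ℕ → ℕ}
    (hn : PolyBdd n) (hm : PolyBdd m) (hs : PolyBdd s) :
    PolyBdd fun i => O.outSize i (n i) (m i) (s i) := by
  obtain ⟨p, hp⟩ := O.poly
  have hq : PolyBdd fun i => p.eval (i + n i + m i + s i) :=
    .eval p (((PolyBdd.self.add hn).add hm).add hs)
  exact hq.mono fun i => (hp i _ _ _).2.1

theorem Obfuscator.coins_poly (O : Obfuscator) {n m s : ℕ → ℕ}
    (hn : PolyBdd n) (hm : PolyBdd m) (hs : PolyBdd s) :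
    PolyBdd fun i => O.coins i (n i) (m i) (s i) := by
  obtain ⟨p, hp⟩ := O.poly
  have hq : PolyBdd fun i => p.eval (i + n i + m i + s i) :=
    .eval p (((PolyBdd.self.add hn).add hm).add hs)
  exact hq.mono fun i => (hp i _ _ _).1

theorem sde_efficient (hℓ : PolyBdd ℓ) (hC : PolyBdd padC) (hF : PolyBdd padF) :
    (sde F G O U padC padF).Efficient := by
  have hn : PolyBdd fun lam => 2 * ℓ lam := (PolyBdd.const 2).mul hℓ
  have hsC := encSize_poly (F := F) (G := G) hℓ hC
  have hsF := decSize_poly (F := F) hF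
  have hoC := O.outSize_poly (hℓ.add hn) (hn.add hn) hsC
  have hoF := O.outSize_poly hn hn hsF
  refine ⟨hn, hn.add hn, U.qubits_poly hn hn hoF, hℓ, ?_, ?_, ?_, ?_⟩
  · have hg : PolyBdd fun lam => F.coins lam + O.coins lam (ℓ lam + 2 * ℓ lam)
        (2 * ℓ lam + 2 * ℓ lam) (encSize F G padC lam) :=
      F.gen_poly.1.add (O.coins_poly (hℓ.add hn) (hn.add hn) hsC)
    have hk : PEff (X := fun lam => Bits (F.coins lam + O.coins lam (ℓ lam + 2 * ℓ lam)
        (2 * ℓ lam + 2 * ℓ lam) (encSize F G padC lam))) (Y := fun lam => Bits (F.keyLen lam))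
        fun lam g => F.gen lam g.left := (PEff.of_polyFun F.gen_poly).comp (PEff.id hg).left
    exact (hk.append ((O.pEff (hℓ.add hn) (hn.add hn) hsC).comp
      (((pkCircuit_pEff hℓ hC).comp hk).pair (PEff.id hg).right)).to_enc).polyFun
  · have hX : PolyBdd fun lam => F.keyLen lam + O.coins lam (2 * ℓ lam) (2 * ℓ lam)
        (decSize F padF lam) := F.keyLen_poly.add (O.coins_poly hn hn hsF)
    have h1 : PEff (X := fun lam => Bits (F.keyLen lam) × Bits (O.coins lam (2 * ℓ lam) (2 * ℓ lam)
        (decSize F padF lam))) (Y := fun lam => SkCirc F O padF lam)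
        fun lam x => O.obf lam (skCircuit F padF lam x.1) x.2 :=
      (O.pEff hn hn hsF).comp (((skCircuit_pEff hℓ hF).comp (PEff.id hX).fst).pair (PEff.id hX).snd)
    obtain ⟨Q, hQ, h⟩ := (U.obfState_cEff hn hn hoF h1).expect.exists_run
    refine ⟨Q, hQ, fun lam sk => (h lam sk).trans ?_⟩
    rw [Superop.expect_apply]
    exact Finset.expect_congr rfl fun r _ => Superop.prep_apply _ _
  · have hX : PolyBdd fun lam => len (PkCirc F G O padC lam × (Bits (2 * ℓ lam) × Bits (ℓ lam))) :=
      (PolyBdd.descLen (hℓ.add hn) (hn.add hn) hoC).add (hn.add hℓ)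
    obtain ⟨s, E, hs, hE⟩ := (PEff.evalCirc (hℓ.add hn) (hn.add hn) hoC (PEff.id hX).fst
      ((PEff.id hX).snd.snd.append (PEff.id hX).snd.fst)).exists_circ
    refine ⟨s, E, hs, fun lam g msg r => ?_⟩
    refine (hE lam (O.obf lam (pkCircuit F G padC lam (F.gen lam g.left)) g.right, msg, r)).trans ?_
    exact (congrArg (BCirc.eval · _) (BCirc.decode_encode _)).symm
  · have hct : PolyBdd fun lam => len (Bits (2 * ℓ lam + 2 * ℓ lam)) := hn.add hn
    obtain ⟨D, hD, h⟩ := ((CEff.xor hn).map (PEff.id hct).right).comp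
      ((CEff.of_circ (U.eval_qpt hn hn hoF)).map (PEff.id hct).left)
    refine ⟨D, hD, fun lam ct => (h lam ct).trans ?_⟩
    refine Superop.ext_unitState fun x x' => ?_
    ext z z'
    refine (congrFun (congrFun (Superop.apply_comp _ _ _) z) z').trans ?_
    refine (Superop.ofFun_xor_apply _ _ z z').trans ?_
    refine (Superop.apply_unitState _ _ _ _ _).trans ?_
    exact (Superop.apply_unitState _ _ _ _ _).symm

theorem sde_enc (hO : O.IsIndist) (lam : ℕ) (g : Bits ((sde F G O U padC padF).genCoins lam))
    (msg : Bits (2 * ℓ lam)) (r : Bits (ℓ lam)) :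
    (sde F G O U padC padF).enc lam ((sde F G O U padC padF).gen lam g).2 msg r =
      Fin.append ((G.circ lam).eval r)
        ((F.app (F.gen lam (Bits.left g)) ((G.circ lam).eval r)).xor msg) := by
  have h1 : (sde F G O U padC padF).enc lam ((sde F G O U padC padF).gen lam g).2 msg r =
      (O.obf lam (pkCircuit F G padC lam (F.gen lam (Bits.left g))) (Bits.right g)).eval
        (Fin.append r msg) :=
    congrArg (BCirc.eval · _) (BCirc.decode_encode _)
  rw [h1, hO.1]
  exact eval_pkCircuit F G padC lam _ r msg

theorem sde_correctWith (hO : O.IsIndist) {δ : ℕ → ℝ}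
    (hδ : ∀ lam g r x, 1 - δ lam ≤
      U.evalProb lam (O.obf lam (decCircuit F padF lam (F.gen lam g)) r) x) :
    (sde F G O U padC padF).CorrectWith δ := by
  intro lam msg
  refine Finset.le_expect Finset.univ_nonempty fun g _ => ?_
  refine Finset.le_expect Finset.univ_nonempty fun r _ => ?_
  let k : Bits (F.keyLen lam) := F.gen lam (Bits.left g)
  let y : Bits (2 * ℓ lam) := (G.circ lam).eval r
  rw [show (sde F G O U padC padF).enc lam _ msg r = _ from sde_enc hO lam g msg r]
  -- the decryption key is an average over the coins of the obfuscator
  have key : ∀ r', 1 - δ lam ≤ (((sde F G O U padC padF).dec lam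
      (Fin.append y ((F.app k y).xor msg))).apply
        (U.obfState lam (O.obf lam (decCircuit F padF lam k) r'))).prob msg := by
    intro r'
    refine (hδ lam (Bits.left g) r' y).trans (le_of_eq ?_)
    have h2 : (O.obf lam (decCircuit F padF lam k) r').eval y = F.app k y :=
      (hO.1 _ _ _ _ _ _ _).trans (eval_skCircuit F padF lam k y)
    have h3 : msg.xor (Bits.right (Fin.append y ((F.app k y).xor msg))) = F.app k y := by
      refine (congrArg (Bits.xor (n := 2 * ℓ lam) msg) (Bits.right_append _ _)).trans ?_
      exact (Bits.xor_comm _ _).trans (Bits.xor_xor_cancel _ _)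
    unfold Upo.evalProb
    rw [h2]
    refine Eq.trans ?_ (congrArg (fun u => (((U.eval lam _ _ _).op.feed
      (Bits.left (Fin.append y ((F.app k y).xor msg)))).apply
        (U.obfState lam (O.obf lam (decCircuit F padF lam k) r'))).prob u) h3.symm)
    rw [Bits.left_append]
  exact (Finset.le_expect Finset.univ_nonempty fun r' _ => key r').trans_eq
    (Superop.prob_apply_expect _ _ _).symm

end Scheme

/-! ### Selective attacks -/

/-- Selective attacks on schemes with messages of length `n`, ciphertexts of length `2 n`,
decryption keys of `q` qubits and public keys of length `p`. -/
structure Attack (n q p : ℕ → ℕ) where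
  st : ℕ → ℕ
  β : ℕ → ℕ
  γ : ℕ → ℕ
  A₁ : ∀ i, QCirc 0 (((n i + n i) + (n i + n i)) + st i)
  A₂ : ∀ i, QCirc (st i + (q i + p i)) (β i + γ i)
  B : ∀ i, QCirc ((n i + n i) + β i) 1
  C : ∀ i, QCirc ((n i + n i) + γ i) 1
  A₁_qpt : QPT A₁
  A₂_qpt : QPT A₂
  B_qpt : QPT B
  C_qpt : QPT C

/-- Four messages, written one after the other. -/
abbrev Msgs (n : ℕ) : Type := Bits ((n + n) + (n + n))

/-- The message that is encrypted for the first party. -/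
def Msgs.toB {n : ℕ} (b : Bool) (M : Msgs n) : Bits n :=
  if b then M.left.right else M.left.left

/-- The message that is encrypted for the second party; it is the message of the first party if
the challenges are identical. -/
def Msgs.toC {n : ℕ} (same b : Bool) (M : Msgs n) : Bits n :=
  if same then M.toB b else if b then M.right.right else M.right.left

theorem Msgs.toB_pEff {X : ℕ → Type} [∀ i, Enc (X i)] {n : ℕ → ℕ} (b : Bool)
    {M : ∀ i, X i → Msgs (n i)} (hM : PEff M) : PEff fun i x => (M i x).toB b := by
  cases b
  · exact hM.left.left
  · exact hM.left.right

theorem Msgs.toC_pEff {X : ℕ → Type} [∀ i, Enc (X i)] {n : ℕ → ℕ} (same b : Bool)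
    {M : ∀ i, X i → Msgs (n i)} (hM : PEff M) : PEff fun i x => (M i x).toC same b := by
  cases same
  · cases b
    · exact hM.right.left
    · exact hM.right.right
  · exact Msgs.toB_pEff b hM

theorem jointProb_expect {n n' β γ c d : ℕ} {ι : Type*} [Fintype ι] (B : QCirc (n + β) c)
    (C : QCirc (n' + γ) d) (x : Bits n) (y : Bits n') (σ : ι → QState (β + γ)) (u : Bits c)
    (v : Bits d) :
    jointProb B C x y (𝔼 i, σ i) u v = 𝔼 i, jointProb B C x y (σ i) u v :=
  Superop.prob_apply_expect _ _ _

theorem jointProb_sum {n n' β γ c d : ℕ} {ι : Type*} (s : Finset ι) (B : QCirc (n + β) c)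
    (C : QCirc (n' + γ) d) (x : Bits n) (y : Bits n') (σ : ι → QState (β + γ)) (u : Bits c)
    (v : Bits d) :
    jointProb B C x y (∑ i ∈ s, σ i) u v = ∑ i ∈ s, jointProb B C x y (σ i) u v := by
  rw [jointProb, Superop.apply_sum, QState.prob_sum]
  rfl

/-- The test whether the measured string is `y`. -/
def Superop.test {a : ℕ} (y : Bits a) : Superop a 1 :=
  classical fun z => if z = y then Bits.single true else Bits.single false

theorem Superop.prob_test {a : ℕ} (y : Bits a) (ρ : QState a) :
    ((test y).apply ρ).prob (Bits.single true) = ρ.prob y := by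
  rw [test, classical_apply, QState.prob, Matrix.sum_apply, Finset.sum_eq_single y]
  · simp [ket, QState.prob]
  · intro z _ hz
    simp [ket, hz, Bits.single_injective.eq_iff]
  · simp

theorem CEff.test {X : ℕ → Type} [∀ i, Enc (X i)] {a : ℕ → ℕ} (hX : PolyBdd fun i => len (X i))
    (ha : PolyBdd a) (y : ∀ i, Bits (a i)) : CEff fun i (_ : X i) => Superop.test (y i) :=
  CEff.classical hX (((PEff.id (X := fun i => Bits (a i)) ha).ite_eq (.const ha ha y)
    (.const (Y := fun _ => Bits 1) ha (.const 1) _) (.const (Y := fun _ => Bits 1) ha (.const 1) _)))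

namespace Attack

variable {n q p : ℕ → ℕ} (𝒜 : Attack n q p)

theorem n_poly (𝒜 : Attack n q p) : PolyBdd n :=
  𝒜.A₁_qpt.cod.mono fun i => by omega

theorem st_poly (𝒜 : Attack n q p) : PolyBdd 𝒜.st := 𝒜.A₁_qpt.cod.mono fun i => by omega

theorem q_poly (𝒜 : Attack n q p) : PolyBdd q := 𝒜.A₂_qpt.dom.mono fun i => by omega

theorem p_poly (𝒜 : Attack n q p) : PolyBdd p := 𝒜.A₂_qpt.dom.mono fun i => by omega

theorem β_poly (𝒜 : Attack n q p) : PolyBdd 𝒜.β := 𝒜.A₂_qpt.cod.mono fun i => by omega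

theorem γ_poly (𝒜 : Attack n q p) : PolyBdd 𝒜.γ := 𝒜.A₂_qpt.cod.mono fun i => by omega

theorem msgs_poly (𝒜 : Attack n q p) : PolyBdd fun i => len (Msgs (n i)) :=
  (𝒜.n_poly.add 𝒜.n_poly).add (𝒜.n_poly.add 𝒜.n_poly)

/-- The weight of the event that the messages `M` are chosen and both parties output `b`, when the
decryption key is `ρ`, the public key is `pk` and the ciphertexts are `ctB` and `ctC`. -/
def value (i : ℕ) (b : Bool) (M : Msgs (n i)) (ρ : QState (q i)) (pk : Bits (p i))
    (ctB ctC : Bits (n i + n i)) : ℝ :=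
  jointProb (𝒜.B i) (𝒜.C i) ctB ctC
    ((𝒜.A₂ i).run (((𝒜.A₁ i).prepare.postMeasure M).tensor (ρ.tensor (ket pk))))
    (Bits.single b) (Bits.single b)

theorem value_expect {ι : Type*} [Fintype ι] (i : ℕ) (b : Bool) (M : Msgs (n i))
    (ρ : ι → QState (q i)) (pk : Bits (p i)) (ctB ctC : Bits (n i + n i)) :
    𝒜.value i b M (𝔼 j, ρ j) pk ctB ctC = 𝔼 j, 𝒜.value i b M (ρ j) pk ctB ctC := by
  rw [value, QState.expect_tensor, QState.tensor_expect, QCirc.run, Superop.apply_expect,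
    jointProb_expect]
  rfl

/-- The probability that both parties output `b`, when the decryption key is `ρ M` for the chosen
messages `M` and the ciphertexts consist of the points `y` and of the messages with index `c`
masked with `v`. -/
def total (same : Bool) (i : ℕ) (b c : Bool) (ρ : Msgs (n i) → QState (q i)) (pk : Bits (p i))
    (y v : Bits (n i) × Bits (n i)) : ℝ :=
  ∑ M : Msgs (n i), 𝒜.value i b M (ρ M) pk (Fin.append y.1 (v.1.xor (M.toB c)))
    (Fin.append y.2 (v.2.xor (M.toC same c)))

theorem total_qAcc (same : Bool) (b c : Bool) {X : ℕ → Type} [∀ i, Enc (X i)]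
    {ρ : ∀ i, X i × Msgs (n i) → QState (q i)} {pk : ∀ i, X i → Bits (p i)}
    {y v : ∀ i, X i → Bits (n i) × Bits (n i)} (hρ : CEff fun i x => Superop.prep (ρ i x))
    (hpk : PEff pk) (hy : PEff y) (hv : PEff v) :
    QAcc fun i x => 𝒜.total same i b c (fun M => ρ i (x, M)) (pk i x) (y i x) (v i x) := by
  have hX := hpk.dom
  have hM := 𝒜.msgs_poly
  have hXM : PolyBdd fun i => len (X i × Msgs (n i)) := hX.add hM
  have h1 : PEff fun i (x : X i × Msgs (n i)) => x.1 := (PEff.id hXM).fst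
  have h2 : PEff fun i (x : X i × Msgs (n i)) => x.2 := (PEff.id hXM).snd
  have hB : CEff fun i (x : X i × Msgs (n i)) => (𝒜.B i).op.feed
      (Fin.append (y i x.1).1 ((v i x.1).1.xor (x.2.toB c))) :=
    (CEff.of_circ 𝒜.B_qpt).map
      ((hy.comp h1).fst.append ((hv.comp h1).fst.xor (Msgs.toB_pEff c h2)))
  have hC : CEff fun i (x : X i × Msgs (n i)) => (𝒜.C i).op.feed
      (Fin.append (y i x.1).2 ((v i x.1).2.xor (x.2.toC same c))) :=
    (CEff.of_circ 𝒜.C_qpt).map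
      ((hy.comp h1).snd.append ((hv.comp h1).snd.xor (Msgs.toC_pEff same c h2)))
  have hA := (CEff.const 𝒜.A₂_qpt hXM).comp
    (CEff.adjoinRight 𝒜.st_poly (hρ.prep_tensor_ket (hpk.comp h1)))
  have hT := (CEff.test hXM (.const 2) fun _ => Fin.append (Bits.single b) (Bits.single b)).comp
    ((hB.tensor hC).comp hA)
  have := QAcc.of_cEff (hT.measure.comp (CEff.const (X := X) 𝒜.A₁_qpt hX))
  refine (Eq.mp (congrArg QAcc ?_) this : QAcc (X := X) _)
  funext i x
  rw [Superop.apply_comp, Superop.measure_apply, QState.prob_sum]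
  refine Finset.sum_congr rfl fun M _ => ?_
  rw [Superop.apply_comp, Superop.prob_test, Superop.apply_comp, Superop.apply_comp,
    Superop.adjoinRight_apply]
  rfl

end Attack

/-! ### From selective attacks to attacks on unclonable puncturable obfuscation -/

/-- Two parties that measure the first part of their registers, where a classical string was
copied. -/
theorem Superop.measure_tensor_measure_apply {a b c d e : ℕ} (T : Bits a → Superop b c)
    (S : Bits a → Superop d e) (x : Bits a) (σ : QState (b + d)) :
    ((measure T).tensor (measure S)).apply
      ((QCirc.perm (swapMid a a b d)).op.apply (((ket x).tensor (ket x)).tensor σ)) =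
        ((T x).tensor (S x)).apply σ := by
  have h : (((measure T).tensor (measure S)).comp (QCirc.perm (swapMid a a b d)).op).comp
      (adjoin (Fin.append x x)) = (T x).tensor (S x) := by
    refine ext_tensor fun ρ τ => ?_
    rw [apply_comp, apply_comp, adjoin_apply, ← QState.ket_tensor_ket, QCirc.op_perm,
      swapMid_apply, tensor_apply_tensor, measure_apply_ket_tensor, measure_apply_ket_tensor,
      tensor_apply_tensor]
  rw [← h, apply_comp, apply_comp, adjoin_apply, QState.ket_tensor_ket]

/-- An attack on a scheme whose ciphertexts are masked with the values of a polynomial time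
function gives an attack on the obfuscation of a circuit class: the messages select the circuits
for the two challenge points. The obfuscated circuit is the one with the fixed key `key`, and the
public key is the fixed string `pk`. -/
theorem Attack.exists_upo_adversary (U : Upo) (𝔠 : GenPuncClass) {p : ℕ → ℕ}
    (𝒜 : Attack 𝔠.n (fun i => U.qubits i (𝔠.n i) (𝔠.m i) (𝔠.s i)) p) (same : Bool)
    (key : ∀ i, Bits (𝔠.keyLen i)) (hkey : ∀ i, key i ∈ 𝔠.K i) (pk : ∀ i, Bits (p i))
    {μB μC : ∀ i, Msgs (𝔠.n i) → BCirc (𝔠.n i) (𝔠.m i) (𝔠.t i)} (hμB : PEff μB) (hμC : PEff μC)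
    {v : ∀ i, Bits (𝔠.n i) → Bits (𝔠.n i)} (hv : PEff v) :
    ∃ 𝒜' : U.Adversary 𝔠, ∀ (𝒟 : ∀ n, PMF (Bits n × Bits n)) (i : ℕ) (b : Bool),
      Upo.exptProb 𝒜' 𝒟 i b = ∑ y : Bits (𝔠.n i) × Bits (𝔠.n i), (𝒟 (𝔠.n i) y).toReal *
        𝒜.total same i b false (fun M => U.obfState i
          (if b then 𝔠.genPuncture i (key i) (μB i M) (μC i M) y.1 y.2 else 𝔠.C i (key i)))
          (pk i) y (v i y.1, v i y.2) := by
  classical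
  have hn := 𝒜.n_poly
  have hM := 𝒜.msgs_poly
  have h0 : PolyBdd fun i => len (Bits 0) := .const 0
  have h0M : PolyBdd fun i => len (Bits 0 × Msgs (𝔠.n i)) := h0.add hM
  have hst := 𝒜.st_poly
  have hq := 𝒜.q_poly
  have hp := 𝒜.p_poly
  -- the first stage outputs the key and the circuits, and keeps the messages
  let kd : ∀ i, Msgs (𝔠.n i) → Bits (𝔠.keyLen i +
      (BCirc.descLen (𝔠.n i) (𝔠.m i) (𝔠.t i) + BCirc.descLen (𝔠.n i) (𝔠.m i) (𝔠.t i))) :=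
    fun i M => Fin.append (key i) (Fin.append (μB i M).encode (μC i M).encode)
  have hkd : PEff kd :=
    (PEff.const hM 𝔠.C_poly.1 key).append (hμB.to_enc.append hμC.to_enc)
  have hsnd : PEff fun i (x : Bits 0 × Msgs (𝔠.n i)) => x.2 := (PEff.id h0M).snd
  have h1 : CEff (X := fun _ => Bits 0) fun i _ => (Superop.measure fun M : Msgs (𝔠.n i) =>
      (Superop.adjoin (kd i M)).comp (Superop.adjoin M)).comp (𝒜.A₁ i).op :=
    ((CEff.adjoin (hM.add hst) (hkd.comp hsnd)).comp (CEff.adjoin hst hsnd)).measure.comp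
      (CEff.const 𝒜.A₁_qpt h0)
  obtain ⟨A₁, hA₁, hA₁op⟩ := h1.exists_circ
  -- the second stage adds the public key and hands the messages to both parties
  have hk := CEff.prep (PEff.const (Y := fun i => Bits (p i)) h0M hp pk) (QPT.idle hp)
  simp only [QCirc.run, QCirc.op_idle, Superop.one_apply] at hk
  have h2 : CEff fun i (x : Bits 0 × Msgs (𝔠.n i)) =>
      (QCirc.perm (Superop.swapMid ((𝔠.n i + 𝔠.n i) + (𝔠.n i + 𝔠.n i))
        ((𝔠.n i + 𝔠.n i) + (𝔠.n i + 𝔠.n i)) (𝒜.β i) (𝒜.γ i))).op.comp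
        ((Superop.adjoin (Fin.append x.2 x.2)).comp ((𝒜.A₂ i).op.comp
          ((QCirc.perm (Superop.assocR (𝒜.st i) (U.qubits i (𝔠.n i) (𝔠.m i) (𝔠.s i)) (p i))).op.comp
            (Superop.adjoinRight (ket (pk i)))))) :=
    (CEff.const (QPT.perm ((hM.add hM).add (𝒜.β_poly.add 𝒜.γ_poly)) _) h0M).comp
      ((CEff.adjoin (𝒜.β_poly.add 𝒜.γ_poly) (hsnd.append hsnd)).comp
        ((CEff.const 𝒜.A₂_qpt h0M).comp
          ((CEff.const (QPT.perm ((hst.add hq).add hp) _) h0M).comp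
            (CEff.adjoinRight (hst.add hq) hk))))
  have h3 := h2.measure.comp (CEff.const (X := fun _ => Bits 0) (QPT.perm ((hM.add hst).add hq)
    fun i => Superop.assocR ((𝔠.n i + 𝔠.n i) + (𝔠.n i + 𝔠.n i)) (𝒜.st i)
      (U.qubits i (𝔠.n i) (𝔠.m i) (𝔠.s i))) h0)
  obtain ⟨A₂, hA₂, hA₂op⟩ := h3.exists_circ
  have hxM : PolyBdd fun i => len (Bits (𝔠.n i) × Msgs (𝔠.n i)) := hn.add hM
  have hx1 : PEff fun i (x : Bits (𝔠.n i) × Msgs (𝔠.n i)) => x.1 := (PEff.id hxM).fst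
  have hx2 : PEff fun i (x : Bits (𝔠.n i) × Msgs (𝔠.n i)) => x.2 := (PEff.id hxM).snd
  -- the two parties compute their ciphertexts from the challenge points
  obtain ⟨B, hB, hBop⟩ := ((CEff.of_circ 𝒜.B_qpt).map
    (hx1.append ((hv.comp hx1).xor (Msgs.toB_pEff false hx2)))).measure
  obtain ⟨C, hC, hCop⟩ := ((CEff.of_circ 𝒜.C_qpt).map
    (hx1.append ((hv.comp hx1).xor (Msgs.toC_pEff same false hx2)))).measure
  have hpost : ∀ i w, (A₁ i).prepare.postMeasure w = ∑ M : Msgs (𝔠.n i),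
      if w = kd i M then (ket M).tensor ((𝒜.A₁ i).prepare.postMeasure M) else 0 := by
    intro i w
    rw [QCirc.prepare, QCirc.run, hA₁op, Superop.apply_comp, Superop.measure_apply,
      QState.postMeasure_sum]
    refine Finset.sum_congr rfl fun M _ => ?_
    rw [Superop.apply_comp, Superop.adjoin_apply, Superop.adjoin_apply,
      QState.postMeasure_ket_tensor]
    rfl
  let 𝒜' : U.Adversary 𝔠 :=
    { st := fun i => ((𝔠.n i + 𝔠.n i) + (𝔠.n i + 𝔠.n i)) + 𝒜.st i
      β := fun i => ((𝔠.n i + 𝔠.n i) + (𝔠.n i + 𝔠.n i)) + 𝒜.β i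
      γ := fun i => ((𝔠.n i + 𝔠.n i) + (𝔠.n i + 𝔠.n i)) + 𝒜.γ i
      A₁ := A₁
      A₂ := A₂
      B := B
      C := C
      A₁_qpt := hA₁
      A₂_qpt := hA₂
      B_qpt := hB
      C_qpt := hC
      valid := by
        intro i y z hyz
        by_contra hne
        refine hyz ?_
        have h3 : (A₁ i).prepare.postMeasure y = 0 := by
          rw [hpost]
          refine Finset.sum_eq_zero fun M _ => if_neg fun hM => hne ?_
          exact ⟨key i, hkey i, μB i M, μC i M, hM⟩
        exact congrArg (fun ρ : QState _ => ρ.prob z) h3 }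
  refine ⟨𝒜', fun 𝒟 i b => ?_⟩
  let D := 𝒟 (𝔠.n i)
  let ρ : (Bits (𝔠.keyLen i) × (BCirc (𝔠.n i) (𝔠.m i) (𝔠.t i) × BCirc (𝔠.n i) (𝔠.m i) (𝔠.t i))) →
      Bits (𝔠.n i) × Bits (𝔠.n i) → QState (U.qubits i (𝔠.n i) (𝔠.m i) (𝔠.s i)) := fun w y =>
    U.obfState i (if b then 𝔠.genPuncture i w.1 w.2.1 w.2.2 y.1 y.2 else 𝔠.C i w.1)
  let V : (Bits (𝔠.keyLen i) × (BCirc (𝔠.n i) (𝔠.m i) (𝔠.t i) × BCirc (𝔠.n i) (𝔠.m i) (𝔠.t i))) →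
      Bits (𝔠.n i) × Bits (𝔠.n i) → Msgs (𝔠.n i) → ℝ := fun w y M =>
    𝒜.value i b M (ρ w y) (pk i) (Fin.append y.1 ((v i y.1).xor (Msgs.toB false M)))
      (Fin.append y.2 ((v i y.2).xor (Msgs.toC same false M)))
  have hrun : ∀ (M : Msgs (𝔠.n i)) τ (σ : Bits (𝔠.n i) × Bits (𝔠.n i)), jointProb (B i) (C i) σ.1 σ.2
      ((A₂ i).run (((ket M).tensor ((𝒜.A₁ i).prepare.postMeasure M)).tensor τ))
        (Bits.single b) (Bits.single b) =
      𝒜.value i b M τ (pk i) (Fin.append σ.1 ((v i σ.1).xor (Msgs.toB false M)))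
        (Fin.append σ.2 ((v i σ.2).xor (Msgs.toC same false M))) := by
    intro M τ σ
    have e1 : (A₂ i).run (((ket M).tensor ((𝒜.A₁ i).prepare.postMeasure M)).tensor τ) =
        (QCirc.perm (Superop.swapMid _ _ _ _)).op.apply (((ket M).tensor (ket M)).tensor
          ((𝒜.A₂ i).run (((𝒜.A₁ i).prepare.postMeasure M).tensor (τ.tensor (ket (pk i)))))) := by
      rw [QCirc.run, hA₂op, Superop.apply_comp]
      refine (congrArg (Superop.apply _) (Superop.assocR_apply _ _ _)).trans ?_
      refine (Superop.measure_apply_ket_tensor _ _ _).trans ?_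
      rw [Superop.apply_comp, Superop.apply_comp, Superop.adjoin_apply, ← QState.ket_tensor_ket,
        Superop.apply_comp, Superop.apply_comp, Superop.adjoinRight_apply]
      refine congrArg (fun υ => (QCirc.perm (Superop.swapMid _ _ _ _)).op.apply
        (((ket M).tensor (ket M)).tensor ((𝒜.A₂ i).op.apply υ))) ?_
      exact Superop.assocR_apply _ _ _
    rw [e1, Attack.value, jointProb, jointProb]
    have e2 := Superop.measure_tensor_measure_apply
      (fun M : Msgs (𝔠.n i) =>
        (𝒜.B i).op.feed (Fin.append σ.1 ((v i σ.1).xor (Msgs.toB false M))))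
      (fun M : Msgs (𝔠.n i) =>
        (𝒜.C i).op.feed (Fin.append σ.2 ((v i σ.2).xor (Msgs.toC same false M)))) M
      ((𝒜.A₂ i).run (((𝒜.A₁ i).prepare.postMeasure M).tensor (τ.tensor (ket (pk i)))))
    refine congrArg (fun υ => QState.prob υ _) (Eq.trans ?_ e2)
    refine congrArg₂ (fun S T => (Superop.tensor S T).apply _) (hBop i σ.1) (hCop i σ.2)
  have hE : ∀ w y, jointProb (B i) (C i) y.1 y.2 ((A₂ i).run
      (((A₁ i).prepare.postMeasure (Fin.append w.1 (Fin.append w.2.1.encode w.2.2.encode))).tensor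
        (ρ w y))) (Bits.single b) (Bits.single b) =
      ∑ M, if w = (key i, μB i M, μC i M) then V w y M else 0 := by
    intro w y
    rw [hpost, QState.sum_tensor, QCirc.run, Superop.apply_sum, jointProb_sum]
    refine Finset.sum_congr rfl fun M _ => ?_
    have hw : Fin.append w.1 (Fin.append w.2.1.encode w.2.2.encode) = kd i M ↔
        w = (key i, μB i M, μC i M) := by
      simp only [kd, Bits.append_inj, BCirc.encode_injective.eq_iff, Prod.ext_iff]
    by_cases h : w = (key i, μB i M, μC i M)
    · rw [if_pos (hw.2 h), if_pos h]
      exact hrun M _ y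
    · rw [if_neg (mt hw.1 h), if_neg h, QState.zero_tensor, Superop.apply_zero, jointProb,
        Superop.apply_zero, QState.prob_zero]
  calc Upo.exptProb 𝒜' 𝒟 i b = ∑ w, ∑ y, (D y).toReal *
        ∑ M, if w = (key i, μB i M, μC i M) then V w y M else 0 := by
        simp only [← hE, Upo.exptProb, Fintype.sum_prod_type]
        rfl
    _ = ∑ y, (D y).toReal * ∑ M, V (key i, μB i M, μC i M) y M := by
        rw [Finset.sum_comm]
        refine Finset.sum_congr rfl fun y _ => ?_
        rw [← Finset.mul_sum, Finset.sum_comm]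
        simp only [Finset.sum_ite_eq', Finset.mem_univ, if_true]
    _ = _ := rfl

/-! ### Punctured circuits and the circuit class -/

section Hybrids

variable {ℓ : ℕ → ℕ} {F : PuncPrf fun lam => 2 * ℓ lam} {G : Prg ℓ} {O : Obfuscator} {U : Upo}
  {padC padF : ℕ → ℕ}

/-- A punctured key, the two punctured points, and the values that are to be programmed there. -/
abbrev PuncPrf.Patch (F : PuncPrf fun lam => 2 * ℓ lam) (i : ℕ) : Type :=
  Bits (F.puncLen i) × ((Bits (2 * ℓ i) × Bits (2 * ℓ i)) × (Bits (2 * ℓ i) × Bits (2 * ℓ i)))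

/-- Evaluation with a punctured key and programmed values at the punctured points. -/
def PuncPrf.patched (F : PuncPrf fun lam => 2 * ℓ lam) (i : ℕ) (d : F.Patch i)
    (x : Bits (2 * ℓ i)) : Bits (2 * ℓ i) :=
  if x = d.2.1.1 then d.2.2.1 else if x = d.2.1.2 then d.2.2.2
    else (F.peval i).eval (Fin.append d.1 x)

theorem PuncPrf.app_pEff (hℓ : PolyBdd ℓ) {X : ℕ → Type} [∀ i, Enc (X i)]
    {k : ∀ i, X i → Bits (F.keyLen i)} {x : ∀ i, X i → Bits (2 * ℓ i)} (hk : PEff k)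
    (hx : PEff x) : PEff fun i z => F.app (k i z) (x i z) :=
  PEff.evalFixed (Y := fun i => Bits (F.keyLen i) × Bits (2 * ℓ i)) F.eval_poly
    ((PolyBdd.const 2).mul hℓ) F.eval (hk.pair hx)

theorem PuncPrf.peval_pEff (hℓ : PolyBdd ℓ) {X : ℕ → Type} [∀ i, Enc (X i)]
    {k : ∀ i, X i → Bits (F.puncLen i)} {x : ∀ i, X i → Bits (2 * ℓ i)} (hk : PEff k)
    (hx : PEff x) : PEff fun i z => (F.peval i).eval (Fin.append (k i z) (x i z)) :=
  PEff.evalFixed (Y := fun i => Bits (F.puncLen i) × Bits (2 * ℓ i)) F.peval_poly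
    ((PolyBdd.const 2).mul hℓ) F.peval (hk.pair hx)

theorem PuncPrf.puncture_pEff {X : ℕ → Type} [∀ i, Enc (X i)]
    {k : ∀ i, X i → Bits (F.keyLen i)} {x y : ∀ i, X i → Bits (2 * ℓ i)} (hk : PEff k)
    (hx : PEff x) (hy : PEff y) : PEff fun i z => F.puncture i (k i z) (x i z) (y i z) := by
  have := (PEff.of_polyFun F.puncture_poly).comp (hk.append (hx.append hy))
  simpa only [Bits.left_append, Bits.right_append] using this

theorem Prg.eval_pEff (hℓ : PolyBdd ℓ) {X : ℕ → Type} [∀ i, Enc (X i)]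
    {r : ∀ i, X i → Bits (ℓ i)} (hr : PEff r) : PEff fun i z => (G.circ i).eval (r i z) :=
  PEff.evalFixed (Y := fun i => Bits (ℓ i)) G.poly ((PolyBdd.const 2).mul hℓ) G.circ hr

variable (F G padC padF) in
/-- The circuits, of the same sizes as the circuits of the scheme, that are obfuscated in the
hybrid experiments. -/
structure PuncturedCircuits where
  /-- The circuit of the function family, patched at two points. -/
  sk : ∀ i, F.Patch i → BCirc (2 * ℓ i) (2 * ℓ i) (decSize F padF i)
  /-- The encryption circuit with a punctured key. -/
  pk : ∀ i, Bits (F.puncLen i) →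
    BCirc (ℓ i + 2 * ℓ i) (2 * ℓ i + 2 * ℓ i) (encSize F G padC i)
  sk_pEff : PEff sk
  pk_pEff : PEff pk
  eval_sk : ∀ i d x, (sk i d).eval x = F.patched i d x
  eval_pk : ∀ i κ z, (pk i κ).eval z = Fin.append ((G.circ i).eval z.left)
    (((F.peval i).eval (Fin.append κ ((G.circ i).eval z.left))).xor z.right)

variable (F G) in
/-- The circuits with punctured keys fit into all sufficiently large paddings. The bound depends
neither on the obfuscator nor on the unclonable obfuscation. -/
theorem exists_puncturedCircuits (hℓ : PolyBdd ℓ) :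
    ∃ p₀ : ℕ → ℕ, PolyBdd p₀ ∧ ∀ padC padF : ℕ → ℕ, PolyBdd padC → PolyBdd padF →
      (∀ lam, p₀ lam ≤ padC lam) → (∀ lam, p₀ lam ≤ padF lam) →
        Nonempty (PuncturedCircuits F G padC padF) := by
  have hn : PolyBdd fun lam => 2 * ℓ lam := (PolyBdd.const 2).mul hℓ
  have hκ : PolyBdd F.puncLen := F.puncture_poly.2.1
  have hd : PolyBdd fun i => len (F.Patch i × Bits (2 * ℓ i)) :=
    (hκ.add ((hn.add hn).add (hn.add hn))).add hn
  have he : PolyBdd fun i => len (Bits (F.puncLen i) × Bits (ℓ i + 2 * ℓ i)) :=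
    hκ.add (hℓ.add hn)
  have h1 : PEff fun i (z : F.Patch i × Bits (2 * ℓ i)) => F.patched i z.1 z.2 := by
    have hx : PEff fun i (z : F.Patch i × Bits (2 * ℓ i)) => z.2 := (PEff.id hd).snd
    have hz : PEff fun i (z : F.Patch i × Bits (2 * ℓ i)) => z.1 := (PEff.id hd).fst
    exact hx.ite_eq hz.snd.fst.fst hz.snd.snd.fst
      (hx.ite_eq hz.snd.fst.snd hz.snd.snd.snd (PuncPrf.peval_pEff hℓ hz.fst hx))
  have h2 : PEff fun i (z : Bits (F.puncLen i) × Bits (ℓ i + 2 * ℓ i)) =>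
      Fin.append ((G.circ i).eval z.2.left)
        (((F.peval i).eval (Fin.append z.1 ((G.circ i).eval z.2.left))).xor z.2.right) := by
    have hz : PEff fun i (z : Bits (F.puncLen i) × Bits (ℓ i + 2 * ℓ i)) => z.2 :=
      (PEff.id he).snd
    have hy : PEff fun i (z : Bits (F.puncLen i) × Bits (ℓ i + 2 * ℓ i)) =>
        (G.circ i).eval z.2.left := Prg.eval_pEff hℓ hz.left
    exact hy.append ((PuncPrf.peval_pEff hℓ (PEff.id he).fst hy).xor hz.right)
  obtain ⟨s, hs, hsk⟩ := h1.exists_curry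
  obtain ⟨t, ht, hpk⟩ := h2.exists_curry
  refine ⟨fun i => s i + t i, hs.add ht, fun padC padF hC hF hpC hpF => ?_⟩
  obtain ⟨sk, hsk, hsk'⟩ := hsk (decSize F padF) (decSize_poly hF) fun i => by
    have : s i + t i ≤ padF i := hpF i
    simp only [decSize]; omega
  obtain ⟨pk, hpk, hpk'⟩ := hpk (encSize F G padC) (encSize_poly hℓ hC) fun i => by
    have : s i + t i ≤ padC i := hpC i
    simp only [encSize]; omega
  exact ⟨⟨sk, pk, hsk, hpk, hsk', hpk'⟩⟩

variable (F) in
/-- Circuits that compute the function family masked with a fixed string. -/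
theorem exists_maskCircuits (hℓ : PolyBdd ℓ) : ∃ t : ℕ → ℕ, PolyBdd t ∧
    ∃ C : ∀ i, Bits (F.keyLen i) × Bits (2 * ℓ i) → BCirc (2 * ℓ i) (2 * ℓ i) (t i), PEff C ∧
      ∀ i z x, (C i z).eval x = (F.app z.1 x).xor z.2 := by
  have hn : PolyBdd fun lam => 2 * ℓ lam := (PolyBdd.const 2).mul hℓ
  have hd : PolyBdd fun i => len ((Bits (F.keyLen i) × Bits (2 * ℓ i)) × Bits (2 * ℓ i)) :=
    (F.keyLen_poly.add hn).add hn
  obtain ⟨t, ht, h⟩ := PEff.exists_curry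
    (f := fun i (z : (Bits (F.keyLen i) × Bits (2 * ℓ i)) × Bits (2 * ℓ i)) =>
      (F.app z.1.1 z.2).xor z.1.2)
    ((PuncPrf.app_pEff hℓ (PEff.id hd).fst.fst (PEff.id hd).snd).xor (PEff.id hd).fst.snd)
  exact ⟨t, ht, h t ht fun _ => le_rfl⟩

/-- The generalized puncturable class of the obfuscated circuits of the function family. The keys
are the coins of the key generation and of the obfuscator. The punctured circuit is the obfuscation
of the function family, patched with the values of the two given circuits. -/
def PuncturedCircuits.upoClass (P : PuncturedCircuits F G padC padF) (hℓ : PolyBdd ℓ)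
    (hℓ' : Negl fun lam => (1 / 2 : ℝ) ^ ℓ lam) (hF : PolyBdd padF) (hP : F.PunctureCorrect)
    (hO : O.IsIndist) {t : ℕ → ℕ} (ht : PolyBdd t) : GenPuncClass :=
  have hn : PolyBdd fun lam => 2 * ℓ lam := (PolyBdd.const 2).mul hℓ
  have hs := O.outSize_poly hn hn (decSize_poly (F := F) hF)
  have hc := O.coins_poly hn hn (decSize_poly (F := F) hF)
  have hk : PolyBdd fun lam => F.coins lam +
    O.coins lam (2 * ℓ lam) (2 * ℓ lam) (decSize F padF lam) := F.gen_poly.1.add hc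
  have hg := PEff.of_polyFun F.gen_poly
  { n := fun lam => 2 * ℓ lam
    m := fun lam => 2 * ℓ lam
    s := fun lam => O.outSize lam (2 * ℓ lam) (2 * ℓ lam) (decSize F padF lam)
    t := t
    keyLen := fun lam => F.coins lam + O.coins lam (2 * ℓ lam) (2 * ℓ lam) (decSize F padF lam)
    K := fun _ => Set.univ
    C := fun lam z => O.obf lam (skCircuit F padF lam (F.gen lam z.left)) z.right
    genPuncture := fun lam z μB μC xB xC => O.obf lam (P.sk lam
      (F.puncture lam (F.gen lam z.left) xB xC, (xB, xC), (μB.eval xB, μC.eval xC))) z.right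
    n_poly := hn
    m_poly := hn
    s_poly := hs
    t_poly := ht
    n_large := hℓ'.mono (fun _ => by positivity) fun lam =>
      pow_le_pow_of_le_one (by norm_num) (by norm_num) (by omega)
    C_poly := (PEff.to_enc ((O.pEff hn hn (decSize_poly hF)).comp
      (((skCircuit_pEff hℓ hF).comp (hg.comp (PEff.id hk).left)).pair (PEff.id hk).right))).polyFun
    genPuncture_poly := by
      have hX : PolyBdd fun i => len (Bits (F.coins i +
          O.coins i (2 * ℓ i) (2 * ℓ i) (decSize F padF i)) ×
          ((BCirc (2 * ℓ i) (2 * ℓ i) (t i) × BCirc (2 * ℓ i) (2 * ℓ i) (t i)) ×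
            (Bits (2 * ℓ i) × Bits (2 * ℓ i)))) :=
        hk.add (((PolyBdd.descLen hn hn ht).add (PolyBdd.descLen hn hn ht)).add (hn.add hn))
      have hi := PEff.id hX
      obtain ⟨z, D, hz, hD⟩ := ((O.pEff hn hn (decSize_poly hF)).comp ((P.sk_pEff.comp
        ((PuncPrf.puncture_pEff (hg.comp hi.fst.left) hi.snd.snd.fst hi.snd.snd.snd).pair
          (hi.snd.snd.pair ((PEff.evalCirc hn hn ht hi.snd.fst.fst hi.snd.snd.fst).pair
            (PEff.evalCirc hn hn ht hi.snd.fst.snd hi.snd.snd.snd))))).pair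
              hi.fst.right)).exists_circ
      exact ⟨z, D, hz, fun lam k μB μC xB xC => hD lam (k, (μB, μC), (xB, xC))⟩
    genPuncture_spec := by
      intro lam z _ μB μC xB xC x
      rw [hO.1, hO.1, P.eval_sk, eval_skCircuit, PuncPrf.patched]
      by_cases h1 : x = xB
      · simp [h1]
      · by_cases h2 : x = xC
        · simp [h2]
        · simp only [if_neg h1, if_neg h2]
          exact hP _ _ _ _ _ h1 h2 }

theorem PuncturedCircuits.upoClass_C (P : PuncturedCircuits F G padC padF) (hℓ : PolyBdd ℓ)
    (hℓ' : Negl fun lam => (1 / 2 : ℝ) ^ ℓ lam) (hF : PolyBdd padF) (hP : F.PunctureCorrect)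
    (hO : O.IsIndist) {t : ℕ → ℕ} (ht : PolyBdd t) (i : ℕ) (g : Bits (F.coins i))
    (r : Bits (O.coins i (2 * ℓ i) (2 * ℓ i) (decSize F padF i))) :
    (P.upoClass hℓ hℓ' hF hP hO ht).C i (Fin.append g r) =
      O.obf i (skCircuit F padF i (F.gen i g)) r := by
  change O.obf i (skCircuit F padF i (F.gen i (Bits.left (Fin.append g r))))
    (Bits.right (Fin.append g r)) = _
  rw [Bits.left_append, Bits.right_append]

theorem PuncturedCircuits.upoClass_genPuncture (P : PuncturedCircuits F G padC padF)
    (hℓ : PolyBdd ℓ) (hℓ' : Negl fun lam => (1 / 2 : ℝ) ^ ℓ lam) (hF : PolyBdd padF)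
    (hP : F.PunctureCorrect) (hO : O.IsIndist) {t : ℕ → ℕ} (ht : PolyBdd t) (i : ℕ)
    (g : Bits (F.coins i)) (r : Bits (O.coins i (2 * ℓ i) (2 * ℓ i) (decSize F padF i)))
    {μB μC : BCirc (2 * ℓ i) (2 * ℓ i) (t i)} {y u : Bits (2 * ℓ i) × Bits (2 * ℓ i)}
    (hB : μB.eval y.1 = u.1) (hC : μC.eval y.2 = u.2) :
    (P.upoClass hℓ hℓ' hF hP hO ht).genPuncture i (Fin.append g r) μB μC y.1 y.2 =
      O.obf i (P.sk i (F.puncture i (F.gen i g) y.1 y.2, y, u)) r := by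
  change O.obf i (P.sk i (F.puncture i (F.gen i (Bits.left (Fin.append g r))) y.1 y.2, y,
    (μB.eval y.1, μC.eval y.2))) (Bits.right (Fin.append g r)) = _
  rw [Bits.left_append, Bits.right_append, hB, hC]

end Hybrids

/-! ### Pairs of challenges -/

theorem expect_prod {α β : Type*} [Fintype α] [Fintype β] (f : α × β → ℝ) :
    𝔼 p, f p = 𝔼 a, 𝔼 b, f (a, b) := by
  rw [← Finset.univ_product_univ, Finset.expect_product]

theorem expect_fst {α β : Type*} [Fintype α] [Fintype β] [Nonempty β] (f : α → ℝ) :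
    𝔼 p : α × β, f p.1 = 𝔼 a, f a := by
  rw [expect_prod]
  exact Finset.expect_congr rfl fun a _ => Fintype.expect_const (f a)

theorem expect_snd {α β : Type*} [Fintype α] [Fintype β] [Nonempty α] (f : β → ℝ) :
    𝔼 p : α × β, f p.2 = 𝔼 b, f b := by
  rw [expect_prod]
  exact Fintype.expect_const (𝔼 b, f b)

/-- The pair itself, or two copies of its first component if `same` is set. -/
def diag {α : Type*} (same : Bool) (p : α × α) : α × α := (p.1, if same then p.1 else p.2)

/-- The distribution of the challenges: identical or independent. -/
def pairDist (same : Bool) (n : ℕ) : PMF (Bits n × Bits n) :=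
  if same then idenPair n else unifPair n

theorem sum_pairDist (same : Bool) {n : ℕ} (h : Bits n × Bits n → ℝ) :
    ∑ y, (pairDist same n y).toReal * h y = 𝔼 p, h (diag same p) := by
  cases same
  · have := PMF.sum_map_uniform (fun y : Bits n × Bits n => y) h
    rw [show (fun y : Bits n × Bits n => y) = id from rfl, PMF.map_id] at this
    exact this
  · refine (PMF.sum_map_uniform (fun x : Bits n => (x, x)) h).trans ?_
    exact (expect_fst (β := Bits n) fun x => h (x, x)).symm

/-- A generator also fools tests on two of its values, which are replaced one after the other, or
on two copies of one value. -/
theorem Prg.Secure.fools_pair {ℓ : ℕ → ℕ} {G : Prg ℓ} (hG : G.Secure) (hℓ : PolyBdd ℓ)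
    (same : Bool) {Z : ℕ → Type} [∀ i, Enc (Z i)] [∀ i, Fintype (Z i)] [∀ i, Nonempty (Z i)]
    {p : ∀ i, Z i × (Bits (2 * ℓ i) × Bits (2 * ℓ i)) → ℝ} (hp : QAcc p) :
    ∃ μ, Negl μ ∧ ∀ i z,
      |(𝔼 r : Bits (ℓ i) × Bits (ℓ i),
          p i (z, (G.circ i).eval (diag same r).1, (G.circ i).eval (diag same r).2)) -
        𝔼 y : Bits (2 * ℓ i) × Bits (2 * ℓ i), p i (z, diag same y)| ≤ μ i := by
  have hn : PolyBdd fun lam => 2 * ℓ lam := (PolyBdd.const 2).mul hℓ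
  have hZ : PolyBdd fun i => len (Z i) := hp.dom.mono fun i => Nat.le_add_right _ _
  cases same
  · have hX : PolyBdd fun i => len ((Z i × Bits (2 * ℓ i)) × Bits (2 * ℓ i)) := (hZ.add hn).add hn
    obtain ⟨μ, hμ, h1⟩ := hG.fools (p := fun i (w : (Z i × Bits (2 * ℓ i)) × Bits (2 * ℓ i)) =>
      p i (w.1.1, w.1.2, w.2))
      (hp.comp ((PEff.id hX).fst.fst.pair ((PEff.id hX).fst.snd.pair (PEff.id hX).snd)))
    obtain ⟨ν, hν, h2⟩ := hG.fools (p := fun i (w : (Z i × Bits (2 * ℓ i)) × Bits (2 * ℓ i)) =>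
      p i (w.1.1, w.2, w.1.2))
      (hp.comp ((PEff.id hX).fst.fst.pair ((PEff.id hX).snd.pair (PEff.id hX).fst.snd)))
    refine ⟨_, hμ.add hν, fun i z => ?_⟩
    rw [expect_prod, expect_prod]
    refine (abs_sub_le _ (𝔼 r : Bits (ℓ i), 𝔼 y : Bits (2 * ℓ i),
      p i (z, (G.circ i).eval r, y)) _).trans (add_le_add ?_ ?_)
    · exact abs_expect_sub_expect_le fun r => h1 i (z, (G.circ i).eval r)
    · rw [Finset.expect_comm]
      refine le_of_eq_of_le (congrArg (fun t => |_ - t|) (Finset.expect_comm _ _ _)) ?_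
      exact abs_expect_sub_expect_le fun y => h2 i (z, y)
  · have hX : PolyBdd fun i => len (Z i × Bits (2 * ℓ i)) := hZ.add hn
    obtain ⟨μ, hμ, h⟩ := hG.fools (p := fun i (w : Z i × Bits (2 * ℓ i)) => p i (w.1, w.2, w.2))
      (hp.comp ((PEff.id hX).fst.pair ((PEff.id hX).snd.pair (PEff.id hX).snd)))
    refine ⟨μ, hμ, fun i z => ?_⟩
    rw [show (𝔼 r : Bits (ℓ i) × Bits (ℓ i), p i (z, (G.circ i).eval (diag true r).1,
        (G.circ i).eval (diag true r).2)) = _ from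
      expect_fst fun r => p i (z, (G.circ i).eval r, (G.circ i).eval r),
      show (𝔼 y : Bits (2 * ℓ i) × Bits (2 * ℓ i), p i (z, diag true y)) = _ from
      expect_fst fun y => p i (z, y, y)]
    exact h i z

/-- Challenge points outside the range of the generator, which are distinct unless the challenges
are identical. -/
def Prg.Good {ℓ : ℕ → ℕ} (G : Prg ℓ) (same : Bool) (i : ℕ)
    (y : Bits (2 * ℓ i) × Bits (2 * ℓ i)) : Prop :=
  (∀ r, (G.circ i).eval r ≠ y.1) ∧ (∀ r, (G.circ i).eval r ≠ y.2) ∧ (y.2 = y.1 → same = true)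

open scoped Classical in
/-- The union bound: at most a fraction `2 ^ (-ℓ)` of all strings are in the range of the generator,
and two independent points rarely coincide. -/
theorem Prg.expect_bad_le {ℓ : ℕ → ℕ} (G : Prg ℓ) (same : Bool) (i : ℕ) :
    (𝔼 y : Bits (2 * ℓ i) × Bits (2 * ℓ i), if G.Good same i (diag same y) then (0 : ℝ) else 1) ≤
      3 * (1 / 2 : ℝ) ^ ℓ i := by
  have hpt : ∀ c : Bits (2 * ℓ i), (𝔼 y : Bits (2 * ℓ i), if c = y then (1 : ℝ) else 0) =
      (1 / 2 : ℝ) ^ (2 * ℓ i) := by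
    intro c
    rw [Fintype.expect_eq_sum_div_card]
    simp
  have hle : (1 / 2 : ℝ) ^ (2 * ℓ i) ≤ (1 / 2 : ℝ) ^ ℓ i :=
    pow_le_pow_of_le_one (by norm_num) (by norm_num) (by omega)
  have hsum : (∑ r : Bits (ℓ i), (𝔼 y : Bits (2 * ℓ i),
      if (G.circ i).eval r = y then (1 : ℝ) else 0)) = (1 / 2 : ℝ) ^ ℓ i := by
    simp only [hpt]
    rw [Finset.sum_const, Finset.card_univ, Fintype.card_pi]
    simp only [Fintype.card_bool, Finset.prod_const, Finset.card_univ, Fintype.card_fin, nsmul_eq_mul]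
    rw [two_mul, pow_add, ← mul_assoc]
    push_cast
    rw [← mul_pow]
    norm_num
  calc (𝔼 y : Bits (2 * ℓ i) × Bits (2 * ℓ i),
        if G.Good same i (diag same y) then (0 : ℝ) else 1)
      ≤ 𝔼 y : Bits (2 * ℓ i) × Bits (2 * ℓ i),
        (((∑ r, if (G.circ i).eval r = y.1 then (1 : ℝ) else 0) +
          ∑ r, if (G.circ i).eval r = y.2 then (1 : ℝ) else 0) +
            if y.1 = y.2 then (1 : ℝ) else 0) := by
        refine Finset.expect_le_expect fun y _ => ?_
        have h0 : ∀ (c : Bits (2 * ℓ i)) r, (0 : ℝ) ≤ if (G.circ i).eval r = c then 1 else 0 :=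
          fun c r => by split_ifs <;> norm_num
        have h1 : ∀ c : Bits (2 * ℓ i), (0 : ℝ) ≤ ∑ r, if (G.circ i).eval r = c then 1 else 0 :=
          fun c => Finset.sum_nonneg fun r _ => h0 c r
        have h2 : (0 : ℝ) ≤ if y.1 = y.2 then 1 else 0 := by split_ifs <;> norm_num
        have h3 : ∀ c : Bits (2 * ℓ i), (∃ r, (G.circ i).eval r = c) →
            (1 : ℝ) ≤ ∑ r, if (G.circ i).eval r = c then 1 else 0 := by
          rintro c ⟨r, hr⟩
          refine le_trans ?_ (Finset.single_le_sum (fun r _ => h0 c r) (Finset.mem_univ r))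
          simp [hr]
        by_cases hg : G.Good same i (diag same y)
        · rw [if_pos hg]
          exact add_nonneg (add_nonneg (h1 _) (h1 _)) h2
        · rw [if_neg hg]
          by_cases e1 : ∃ r, (G.circ i).eval r = y.1
          · linarith [h3 _ e1, h1 y.2]
          · by_cases e2 : ∃ r, (G.circ i).eval r = y.2
            · linarith [h3 _ e2, h1 y.1]
            · have e3 : y.1 = y.2 := by
                by_contra hne
                refine hg ⟨fun r hr => e1 ⟨r, hr⟩, fun r hr => ?_, fun h => ?_⟩
                · cases same
                  · exact e2 ⟨r, hr⟩
                  · exact e1 ⟨r, hr⟩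
                · cases same
                  · exact absurd h.symm hne
                  · rfl
              rw [if_pos e3]
              linarith [h1 y.1, h1 y.2]
    _ ≤ (1 / 2 : ℝ) ^ ℓ i + (1 / 2 : ℝ) ^ ℓ i + (1 / 2 : ℝ) ^ ℓ i := by
        rw [Finset.expect_add_distrib, Finset.expect_add_distrib]
        refine add_le_add (add_le_add (le_of_eq ?_) (le_of_eq ?_)) ?_
        · rw [expect_fst (β := Bits (2 * ℓ i)) fun y =>
            ∑ r, if (G.circ i).eval r = y then (1 : ℝ) else 0, Finset.expect_sum_comm, hsum]
        · rw [expect_snd (α := Bits (2 * ℓ i)) fun y =>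
            ∑ r, if (G.circ i).eval r = y then (1 : ℝ) else 0, Finset.expect_sum_comm, hsum]
        · rw [expect_prod]
          simp only [hpt, Fintype.expect_const]
          exact hle
    _ = _ := by ring

/-! ### The hybrid argument -/

section HybridArgument

variable {ℓ : ℕ → ℕ} {F : PuncPrf fun lam => 2 * ℓ lam} {G : Prg ℓ} {O : Obfuscator} {U : Upo}
  {padC padF : ℕ → ℕ}

variable (F G O U padC padF) in
/-- Selective attacks on the scheme. -/
abbrev SdeAttack : Type := Attack (fun i => 2 * ℓ i)
  (fun i => U.qubits i (2 * ℓ i) (2 * ℓ i) (O.outSize i (2 * ℓ i) (2 * ℓ i) (decSize F padF i)))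
  (fun i => BCirc.descLen (ℓ i + 2 * ℓ i) (2 * ℓ i + 2 * ℓ i)
    (O.outSize i (ℓ i + 2 * ℓ i) (2 * ℓ i + 2 * ℓ i) (encSize F G padC i)))

namespace Attack

variable (𝒜 : SdeAttack F G O U padC padF)

/-- The probability that both parties output `b` when the decryption key is the unclonable
obfuscation of the circuit `sk M`, the public key is the circuit `pk`, and the ciphertexts consist
of the points `y` and of the messages with index `c` masked with `v`. -/
def game (same b c : Bool) (i : ℕ) (sk : Msgs (2 * ℓ i) → SkCirc F O padF i)
    (pk : PkCirc F G O padC i) (y v : Bits (2 * ℓ i) × Bits (2 * ℓ i)) : ℝ :=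
  𝒜.total same i b c (fun M => U.obfState i (sk M)) pk.encode y v

theorem game_qAcc (same b c : Bool) (hF : PolyBdd padF) {X : ℕ → Type} [∀ i, Enc (X i)]
    {sk : ∀ i, X i × Msgs (2 * ℓ i) → SkCirc F O padF i} {pk : ∀ i, X i → PkCirc F G O padC i}
    {y v : ∀ i, X i → Bits (2 * ℓ i) × Bits (2 * ℓ i)} (hsk : PEff sk) (hpk : PEff pk)
    (hy : PEff y) (hv : PEff v) :
    QAcc fun i x => 𝒜.game same b c i (fun M => sk i (x, M)) (pk i x) (y i x) (v i x) := by
  have hn : PolyBdd fun i => 2 * ℓ i := 𝒜.n_poly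
  have h1 : CEff fun i x => Superop.prep (U.obfState i (sk i x)) :=
    U.obfState_cEff hn hn (O.outSize_poly hn hn (decSize_poly hF)) hsk
  have h2 : PEff (Y := fun i => Bits (BCirc.descLen (ℓ i + 2 * ℓ i) (2 * ℓ i + 2 * ℓ i)
    (O.outSize i (ℓ i + 2 * ℓ i) (2 * ℓ i + 2 * ℓ i) (encSize F G padC i))))
      fun i x => (pk i x).encode := hpk.to_enc
  have h3 := 𝒜.total_qAcc same b c h1 h2 hy hv
  exact h3

/-- The key `k`, punctured at two points. -/
abbrev _root_.PuncPrf.puncAt (F : PuncPrf fun lam => 2 * ℓ lam) {i : ℕ} (k : Bits (F.keyLen i))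
    (y : Bits (2 * ℓ i) × Bits (2 * ℓ i)) : Bits (F.puncLen i) := F.puncture i k y.1 y.2

/-- The values of the function with key `k` at two points. -/
abbrev _root_.PuncPrf.app₂ (F : PuncPrf fun lam => 2 * ℓ lam) {i : ℕ} (k : Bits (F.keyLen i))
    (y : Bits (2 * ℓ i) × Bits (2 * ℓ i)) : Bits (2 * ℓ i) × Bits (2 * ℓ i) :=
  (F.app k y.1, F.app k y.2)

/-- The values `u`, shifted by the differences between the messages with index `c` and those with
index `1`. -/
def _root_.Msgs.shift {n : ℕ} (same c : Bool) (M : Msgs n) (u : Bits n × Bits n) :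
    Bits n × Bits n :=
  (u.1.xor ((M.toB c).xor (M.toB true)), u.2.xor ((M.toC same c).xor (M.toC same true)))

theorem _root_.Msgs.shift_true {n : ℕ} (same : Bool) (M : Msgs n) (u : Bits n × Bits n) :
    M.shift same true u = u := by
  have h : ∀ x m : Bits n, x.xor (m.xor m) = x := fun x m => by
    rw [← Bits.xor_assoc, Bits.xor_xor_cancel]
  rw [Msgs.shift, h, h]

/-- The game in which both parties are supposed to output `1`, the obfuscated circuit is patched
with the shifted values `u`, and the messages with index `c` are masked with `u`. -/
def hybrid (P : PuncturedCircuits F G padC padF) (same c : Bool) (i : ℕ) (κ : Bits (F.puncLen i))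
    (y u : Bits (2 * ℓ i) × Bits (2 * ℓ i))
    (r : Bits (O.coins i (2 * ℓ i) (2 * ℓ i) (decSize F padF i)))
    (pk : PkCirc F G O padC i) : ℝ :=
  𝒜.game same true c i (fun M => O.obf i (P.sk i (κ, y, M.shift same c u)) r) pk y u

theorem patchedObf_pEff (O : Obfuscator) (P : PuncturedCircuits F G padC padF) (hℓ : PolyBdd ℓ)
    (hF : PolyBdd padF) (same c : Bool) {X : ℕ → Type} [∀ i, Enc (X i)]
    {κ : ∀ i, X i → Bits (F.puncLen i)} {y u : ∀ i, X i → Bits (2 * ℓ i) × Bits (2 * ℓ i)}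
    {r : ∀ i, X i → Bits (O.coins i (2 * ℓ i) (2 * ℓ i) (decSize F padF i))}
    {M : ∀ i, X i → Msgs (2 * ℓ i)} (hκ : PEff κ) (hy : PEff y) (hu : PEff u) (hr : PEff r)
    (hM : PEff M) :
    PEff fun i x => O.obf i (P.sk i (κ i x, y i x, (M i x).shift same c (u i x))) (r i x) := by
  have hn : PolyBdd fun lam => 2 * ℓ lam := (PolyBdd.const 2).mul hℓ
  refine (O.pEff hn hn (decSize_poly hF)).comp ((P.sk_pEff.comp (hκ.pair (hy.pair ?_))).pair hr)
  exact (hu.fst.xor ((Msgs.toB_pEff c hM).xor (Msgs.toB_pEff true hM))).pair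
    (hu.snd.xor ((Msgs.toC_pEff same c hM).xor (Msgs.toC_pEff same true hM)))

/-- The public key may be replaced by an obfuscation of the encryption circuit with the punctured
key, since that circuit is never evaluated at good points. -/
theorem game_pk_punctured (P : PuncturedCircuits F G padC padF) (hℓ : PolyBdd ℓ)
    (hC : PolyBdd padC) (hF : PolyBdd padF) (hP : F.PunctureCorrect) (hO : O.IsIndist)
    (same b c : Bool) {Z : ℕ → Type} [∀ i, Enc (Z i)] [∀ i, Fintype (Z i)] [∀ i, Nonempty (Z i)]
    {sk : ∀ i, Z i × Msgs (2 * ℓ i) → SkCirc F O padF i} (hsk : PEff sk) :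
    ∃ μ, Negl μ ∧ ∀ i z g y v, G.Good same i y →
      |(𝔼 s, 𝒜.game same b c i (fun M => sk i (z, M))
          (O.obf i (pkCircuit F G padC i (F.gen i g)) s) y v) -
        𝔼 s, 𝒜.game same b c i (fun M => sk i (z, M))
          (O.obf i (P.pk i (F.puncAt (F.gen i g) y)) s) y v| ≤ μ i := by
  have hn : PolyBdd fun lam => 2 * ℓ lam := (PolyBdd.const 2).mul hℓ
  have hZ : PolyBdd fun i => len (Z i) := hsk.dom.mono fun i => Nat.le_add_right _ _
  have hoC := O.outSize_poly (hℓ.add hn) (hn.add hn) (encSize_poly (F := F) (G := G) hℓ hC)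
  have hX : PolyBdd fun i => len ((Z i × ((Bits (2 * ℓ i) × Bits (2 * ℓ i)) ×
      (Bits (2 * ℓ i) × Bits (2 * ℓ i)))) × PkCirc F G O padC i) :=
    (hZ.add ((hn.add hn).add (hn.add hn))).add (.descLen (hℓ.add hn) (hn.add hn) hoC)
  have hi := PEff.id hX
  have hXM := hX.add 𝒜.msgs_poly
  have hj := PEff.id (X := fun i => ((Z i × ((Bits (2 * ℓ i) × Bits (2 * ℓ i)) ×
      (Bits (2 * ℓ i) × Bits (2 * ℓ i)))) × PkCirc F G O padC i) × Msgs (2 * ℓ i)) hXM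
  obtain ⟨μ, hμ, h⟩ := hO.fools (hℓ.add hn) (hn.add hn) (encSize_poly (F := F) (G := G) hℓ hC)
    (𝒜.game_qAcc same b c hF (hsk.comp (hj.fst.fst.fst.pair hj.snd)) hi.snd hi.fst.snd.fst
      hi.fst.snd.snd)
  refine ⟨μ, hμ, fun i z g y v hy => h i (z, y, v) _ _ fun x => ?_⟩
  rw [P.eval_pk]
  have := eval_pkCircuit F G padC i (F.gen i g) x.left x.right
  rw [Bits.append_left_right] at this
  rw [this, PuncPrf.puncAt, hP _ _ _ _ _ (hy.1 _) (hy.2.1 _)]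

/-- The decryption key may be replaced by an obfuscation of the patched circuit, as long as the
function is patched with its own values. -/
theorem game_sk_patched (P : PuncturedCircuits F G padC padF) (hℓ : PolyBdd ℓ)
    (hC : PolyBdd padC) (hF : PolyBdd padF) (hP : F.PunctureCorrect) (hO : O.IsIndist)
    (same : Bool) :
    ∃ μ, Negl μ ∧ ∀ i pk g y,
      |(𝔼 r, 𝒜.game same true true i (fun _ => O.obf i (skCircuit F padF i (F.gen i g)) r) pk y
          (F.app₂ (F.gen i g) y)) -
        𝔼 r, 𝒜.hybrid P same true i (F.puncAt (F.gen i g) y) y (F.app₂ (F.gen i g) y) r pk|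
          ≤ μ i := by
  have hn : PolyBdd fun lam => 2 * ℓ lam := (PolyBdd.const 2).mul hℓ
  have hoC := O.outSize_poly (hℓ.add hn) (hn.add hn) (encSize_poly (F := F) (G := G) hℓ hC)
  have hoF := O.outSize_poly hn hn (decSize_poly (F := F) hF)
  have hX : PolyBdd fun i => len ((PkCirc F G O padC i × ((Bits (2 * ℓ i) × Bits (2 * ℓ i)) ×
      (Bits (2 * ℓ i) × Bits (2 * ℓ i)))) × SkCirc F O padF i) :=
    (PolyBdd.add (.descLen (hℓ.add hn) (hn.add hn) hoC) ((hn.add hn).add (hn.add hn))).add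
      (.descLen hn hn hoF)
  have hi := PEff.id hX
  have hXM := hX.add 𝒜.msgs_poly
  have hj := PEff.id (X := fun i => ((PkCirc F G O padC i × ((Bits (2 * ℓ i) × Bits (2 * ℓ i)) ×
      (Bits (2 * ℓ i) × Bits (2 * ℓ i)))) × SkCirc F O padF i) × Msgs (2 * ℓ i)) hXM
  obtain ⟨μ, hμ, h⟩ := hO.fools hn hn (decSize_poly (F := F) hF)
    (𝒜.game_qAcc same true true hF hj.fst.snd hi.fst.fst hi.fst.snd.fst hi.fst.snd.snd)
  refine ⟨μ, hμ, fun i pk g y => ?_⟩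
  simp only [hybrid, Msgs.shift_true]
  refine h i (pk, y, F.app₂ (F.gen i g) y) _ _ fun x => ?_
  rw [eval_skCircuit, P.eval_sk, PuncPrf.patched]
  by_cases h1 : x = y.1
  · simp [h1]
  · by_cases h2 : x = y.2
    · rw [if_neg h1, if_pos h2, h2]
    · simp only [if_neg h1, if_neg h2]
      exact (hP _ _ _ _ _ h1 h2).symm

/-- The values at the punctured points may be replaced by uniform ones, which are equal if the
points are. -/
theorem hybrid_uniform (P : PuncturedCircuits F G padC padF) (hℓ : PolyBdd ℓ)
    (hC : PolyBdd padC) (hF : PolyBdd padF) (hS : F.PunctureSecure) (same c : Bool) :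
    ∃ μ, Negl μ ∧ ∀ i s r y,
      |(𝔼 g : Bits (F.coins i), 𝒜.hybrid P same c i (F.puncAt (F.gen i g) y) y
          (F.app₂ (F.gen i g) y) r (O.obf i (P.pk i (F.puncAt (F.gen i g) y)) s)) -
        𝔼 g : Bits (F.coins i), 𝔼 u₁, 𝔼 u₂, 𝒜.hybrid P same c i (F.puncAt (F.gen i g) y) y
          (u₁, if y.2 = y.1 then u₁ else u₂) r (O.obf i (P.pk i (F.puncAt (F.gen i g) y)) s)|
          ≤ μ i := by
  have hn : PolyBdd fun lam => 2 * ℓ lam := (PolyBdd.const 2).mul hℓ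
  have hsC := encSize_poly (F := F) (G := G) hℓ hC
  have hX : PolyBdd fun i => len ((Bits (O.coins i (ℓ i + 2 * ℓ i) (2 * ℓ i + 2 * ℓ i)
      (encSize F G padC i)) × Bits (O.coins i (2 * ℓ i) (2 * ℓ i) (decSize F padF i))) ×
        F.Patch i) :=
    ((O.coins_poly (hℓ.add hn) (hn.add hn) hsC).add (O.coins_poly hn hn (decSize_poly hF))).add
      (F.puncture_poly.2.1.add ((hn.add hn).add (hn.add hn)))
  have hi := PEff.id hX
  have hXM := hX.add 𝒜.msgs_poly
  have hj := PEff.id (X := fun i => ((Bits (O.coins i (ℓ i + 2 * ℓ i) (2 * ℓ i + 2 * ℓ i)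
      (encSize F G padC i)) × Bits (O.coins i (2 * ℓ i) (2 * ℓ i) (decSize F padF i))) ×
        F.Patch i) × Msgs (2 * ℓ i)) hXM
  obtain ⟨μ, hμ, h⟩ := hS.fools (𝒜.game_qAcc same true c hF
    (patchedObf_pEff O P hℓ hF same c hj.fst.snd.fst hj.fst.snd.snd.fst hj.fst.snd.snd.snd
      hj.fst.fst.snd hj.snd)
    ((O.pEff (hℓ.add hn) (hn.add hn) hsC).comp ((P.pk_pEff.comp hi.snd.fst).pair hi.fst.fst))
    hi.snd.snd.fst hi.snd.snd.snd)
  exact ⟨μ, hμ, fun i s r y => h i (s, r) y.1 y.2⟩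

/-- Shifting uniform values turns the messages with index `1` into those with index `0`. -/
theorem expect_hybrid_shift (P : PuncturedCircuits F G padC padF) (same : Bool) (i : ℕ)
    (κ : Bits (F.puncLen i)) (y : Bits (2 * ℓ i) × Bits (2 * ℓ i)) (hy : y.2 = y.1 → same = true)
    (r : Bits (O.coins i (2 * ℓ i) (2 * ℓ i) (decSize F padF i))) (pk : PkCirc F G O padC i) :
    (𝔼 u₁, 𝔼 u₂, 𝒜.hybrid P same true i κ y (u₁, if y.2 = y.1 then u₁ else u₂) r pk) =
      𝔼 u₁, 𝔼 u₂, 𝒜.hybrid P same false i κ y (u₁, if y.2 = y.1 then u₁ else u₂) r pk := by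
  simp only [hybrid, game, total, Finset.expect_sum_comm]
  refine Finset.sum_congr rfl fun M _ => ?_
  let dB : Bits (2 * ℓ i) := (M.toB false).xor (M.toB true)
  let dC : Bits (2 * ℓ i) := (M.toC same false).xor (M.toC same true)
  have e : ∀ d : Bits (2 * ℓ i), Function.Involutive fun u : Bits (2 * ℓ i) => u.xor d :=
    fun d u => Bits.xor_xor_cancel u d
  have hm : ∀ u m m' : Bits (2 * ℓ i), (u.xor (m.xor m')).xor m' = u.xor m := fun u m m' => by
    rw [Bits.xor_assoc, Bits.xor_xor_cancel]
  refine (Fintype.expect_bijective _ (e dB).bijective _ _ fun u₁ => ?_).symm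
  refine Fintype.expect_bijective _ (e dC).bijective _ _ fun u₂ => ?_
  have hu : (if y.2 = y.1 then u₁.xor dB else u₂.xor dC) =
      (if y.2 = y.1 then u₁ else u₂).xor dC := by
    by_cases h : y.2 = y.1
    · have : dC = dB := by simp only [dB, dC, Msgs.toC, hy h, if_true]
      rw [if_pos h, if_pos h, this]
    · rw [if_neg h, if_neg h]
  have hs : M.shift same true (u₁.xor dB, if y.2 = y.1 then u₁.xor dB else u₂.xor dC) =
      M.shift same false (u₁, if y.2 = y.1 then u₁ else u₂) := by
    rw [Msgs.shift_true, hu]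
    rfl
  simp only [hs]
  rw [hu, hm, hm]

/-- For good challenge points, the real experiment for the challenge bit `1` is as good as the one
in which the obfuscated circuit is patched at these points so that the ciphertexts decrypt to the
messages with index `1`, although they contain the messages with index `0`. -/
theorem game_real_sub_hybrid (P : PuncturedCircuits F G padC padF) (hℓ : PolyBdd ℓ)
    (hC : PolyBdd padC) (hF : PolyBdd padF) (hP : F.PunctureCorrect) (hS : F.PunctureSecure)
    (hO : O.IsIndist) (same : Bool) :
    ∃ μ, Negl μ ∧ ∀ i y, G.Good same i y →
      |(𝔼 g, 𝔼 s, 𝔼 r, 𝒜.game same true true i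
          (fun _ => O.obf i (skCircuit F padF i (F.gen i g)) r)
          (O.obf i (pkCircuit F G padC i (F.gen i g)) s) y (F.app₂ (F.gen i g) y)) -
        𝔼 g, 𝔼 s, 𝔼 r, 𝒜.hybrid P same false i (F.puncAt (F.gen i g) y) y
          (F.app₂ (F.gen i g) y) r (O.obf i (pkCircuit F G padC i (F.gen i g)) s)| ≤ μ i := by
  have hn : PolyBdd fun lam => 2 * ℓ lam := (PolyBdd.const 2).mul hℓ
  have hsF := decSize_poly (F := F) hF
  have hW : PolyBdd fun i => len (SkCirc F O padF i × Msgs (2 * ℓ i)) :=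
    PolyBdd.add (.descLen hn hn (O.outSize_poly hn hn hsF)) 𝒜.msgs_poly
  have hV : PolyBdd fun i => len ((F.Patch i × Bits (O.coins i (2 * ℓ i) (2 * ℓ i)
      (decSize F padF i))) × Msgs (2 * ℓ i)) :=
    ((F.puncture_poly.2.1.add ((hn.add hn).add (hn.add hn))).add
      (O.coins_poly hn hn hsF)).add 𝒜.msgs_poly
  have hv := PEff.id hV
  obtain ⟨μ₁, hμ₁, h₁⟩ := 𝒜.game_pk_punctured P hℓ hC hF hP hO same true true
    (Z := fun i => SkCirc F O padF i) (PEff.id hW).fst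
  obtain ⟨μ₂, hμ₂, h₂⟩ := 𝒜.game_sk_patched P hℓ hC hF hP hO same
  obtain ⟨μ₃, hμ₃, h₃⟩ := 𝒜.hybrid_uniform P hℓ hC hF hS same true
  obtain ⟨μ₄, hμ₄, h₄⟩ := 𝒜.hybrid_uniform P hℓ hC hF hS same false
  obtain ⟨μ₅, hμ₅, h₅⟩ := 𝒜.game_pk_punctured P hℓ hC hF hP hO same true false
    (patchedObf_pEff O P hℓ hF same false hv.fst.fst.fst hv.fst.fst.snd.fst hv.fst.fst.snd.snd
      hv.fst.snd hv.snd)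
  refine ⟨_, (((hμ₁.add hμ₂).add hμ₃).add hμ₄).add hμ₅, fun i y hy => ?_⟩
  have rot : ∀ f : Bits (F.coins i) → Bits (O.coins i (ℓ i + 2 * ℓ i) (2 * ℓ i + 2 * ℓ i)
      (encSize F G padC i)) → Bits (O.coins i (2 * ℓ i) (2 * ℓ i) (decSize F padF i)) → ℝ,
      (𝔼 g, 𝔼 s, 𝔼 r, f g s r) = 𝔼 s, 𝔼 r, 𝔼 g, f g s r := fun f => by
    rw [Finset.expect_comm]
    exact Finset.expect_congr rfl fun s _ => Finset.expect_comm _ _ _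
  have k₁ : |(𝔼 g, 𝔼 s, 𝔼 r, 𝒜.game same true true i
          (fun _ => O.obf i (skCircuit F padF i (F.gen i g)) r)
          (O.obf i (pkCircuit F G padC i (F.gen i g)) s) y (F.app₂ (F.gen i g) y)) -
        𝔼 g, 𝔼 s, 𝔼 r, 𝒜.game same true true i
          (fun _ => O.obf i (skCircuit F padF i (F.gen i g)) r)
          (O.obf i (P.pk i (F.puncAt (F.gen i g) y)) s) y (F.app₂ (F.gen i g) y)| ≤ μ₁ i := by
    refine abs_expect_sub_expect_le fun g => ?_
    rw [Finset.expect_comm]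
    refine le_of_eq_of_le (congrArg (fun t => |_ - t|) (Finset.expect_comm _ _ _)) ?_
    exact abs_expect_sub_expect_le fun r =>
      h₁ i (O.obf i (skCircuit F padF i (F.gen i g)) r) g y _ hy
  have k₂ : |(𝔼 g, 𝔼 s, 𝔼 r, 𝒜.game same true true i
          (fun _ => O.obf i (skCircuit F padF i (F.gen i g)) r)
          (O.obf i (P.pk i (F.puncAt (F.gen i g) y)) s) y (F.app₂ (F.gen i g) y)) -
        𝔼 g, 𝔼 s, 𝔼 r, 𝒜.hybrid P same true i (F.puncAt (F.gen i g) y) y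
          (F.app₂ (F.gen i g) y) r (O.obf i (P.pk i (F.puncAt (F.gen i g) y)) s)| ≤ μ₂ i :=
    abs_expect_sub_expect_le fun g => abs_expect_sub_expect_le fun s => h₂ i _ g y
  have k₃ := abs_expect_sub_expect_le fun s => abs_expect_sub_expect_le fun r => h₃ i s r y
  have k₄ := abs_expect_sub_expect_le fun s => abs_expect_sub_expect_le fun r => h₄ i s r y
  simp only [𝒜.expect_hybrid_shift P same i _ y hy.2.2] at k₃
  rw [← rot fun g s r => 𝒜.hybrid P same true i (F.puncAt (F.gen i g) y) y
    (F.app₂ (F.gen i g) y) r (O.obf i (P.pk i (F.puncAt (F.gen i g) y)) s)] at k₃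
  rw [← rot fun g s r => 𝒜.hybrid P same false i (F.puncAt (F.gen i g) y) y
    (F.app₂ (F.gen i g) y) r (O.obf i (P.pk i (F.puncAt (F.gen i g) y)) s)] at k₄
  have k₅ : |(𝔼 g, 𝔼 s, 𝔼 r, 𝒜.hybrid P same false i (F.puncAt (F.gen i g) y) y
          (F.app₂ (F.gen i g) y) r (O.obf i (pkCircuit F G padC i (F.gen i g)) s)) -
        𝔼 g, 𝔼 s, 𝔼 r, 𝒜.hybrid P same false i (F.puncAt (F.gen i g) y) y
          (F.app₂ (F.gen i g) y) r (O.obf i (P.pk i (F.puncAt (F.gen i g) y)) s)| ≤ μ₅ i := by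
    refine abs_expect_sub_expect_le fun g => ?_
    rw [Finset.expect_comm]
    refine le_of_eq_of_le (congrArg (fun t => |_ - t|) (Finset.expect_comm _ _ _)) ?_
    exact abs_expect_sub_expect_le fun r =>
      h₅ i ((F.puncAt (F.gen i g) y, y, F.app₂ (F.gen i g) y), r) g y _ hy
  rw [abs_le] at k₁ k₂ k₃ k₄ k₅ ⊢
  constructor <;> linarith [k₁.1, k₂.1, k₃.1, k₄.1, k₅.1, k₁.2, k₂.2, k₃.2, k₄.2, k₅.2]

end Attack

end HybridArgument

/-! ### Selective security of the scheme -/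

theorem Bits.expect_append {a b : ℕ} (f : Bits (a + b) → ℝ) :
    𝔼 z, f z = 𝔼 x : Bits a, 𝔼 y : Bits b, f (Fin.append x y) := by
  rw [Fintype.expect_eq_sum_div_card, Bits.sum_append]
  simp only [Fintype.expect_eq_sum_div_card, Finset.sum_div, div_div]
  refine Finset.sum_congr rfl fun x _ => Finset.sum_congr rfl fun y _ => ?_
  simp [pow_add, mul_comm]

theorem expect_bool (f : Bool → ℝ) : 𝔼 b, f b = (f false + f true) / 2 := by
  rw [Fintype.expect_eq_sum_div_card, Fintype.sum_bool, Fintype.card_bool, add_comm]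
  norm_num

namespace Sde

variable {S : Sde}

/-- The two distributions of the pair of challenge ciphertexts. -/
def ctDist (S : Sde) (same : Bool) : S.CtDist := if same then S.identical else S.idenBitIndMsg

theorem sum_ctDist (same : Bool) (i : ℕ) (pk : Bits (S.pkLen i)) (M : Msgs (S.msgLen i)) (b : Bool)
    (f : Bits (S.ctLen i) × Bits (S.ctLen i) → ℝ) :
    ∑ ct, (S.ctDist same i pk ⟨M.left.left, M.left.right, M.right.left, M.right.right⟩ b
        ct).toReal * f ct =
      𝔼 ρ : Bits (S.encCoins i) × Bits (S.encCoins i),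
        f (S.enc i pk (M.toB b) (diag same ρ).1, S.enc i pk (M.toC same b) (diag same ρ).2) := by
  cases same
  · refine (PMF.sum_map_uniform _ f).trans (Finset.expect_congr rfl fun ρ _ => ?_)
    cases b <;> rfl
  · refine (PMF.sum_map_uniform _ f).trans ?_
    refine Eq.trans ?_ (expect_fst (β := Bits (S.encCoins i)) fun r =>
      f (S.enc i pk (M.toB b) r, S.enc i pk (M.toB b) r)).symm
    exact Finset.expect_congr rfl fun ρ _ => by cases b <;> rfl

theorem selProb_eq_sum (𝒜 : S.SelAdversary) (same : Bool) (i : ℕ) :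
    selProb 𝒜 (S.ctDist same) i = ∑ M : Msgs (S.msgLen i), 𝔼 g : Bits (S.genCoins i), 𝔼 b : Bool,
      𝔼 ρ : Bits (S.encCoins i) × Bits (S.encCoins i), jointProb (𝒜.B i) (𝒜.C i)
        (S.enc i (S.gen i g).2 (M.toB b) (diag same ρ).1)
        (S.enc i (S.gen i g).2 (M.toC same b) (diag same ρ).2)
        ((𝒜.A₂ i).run (((𝒜.A₁ i).prepare.postMeasure M).tensor (S.view i g)))
        (Bits.single b) (Bits.single b) := by
  rw [Bits.sum_append, Bits.sum_append]
  unfold selProb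
  refine Finset.sum_congr rfl fun mB₀ _ => Finset.sum_congr rfl fun mB₁ _ => ?_
  rw [Bits.sum_append]
  refine Finset.sum_congr rfl fun mC₀ _ => Finset.sum_congr rfl fun mC₁ _ => ?_
  refine Finset.expect_congr rfl fun g _ => Finset.expect_congr rfl fun b _ => ?_
  have h := sum_ctDist same i (S.gen i g).2
    (Fin.append (Fin.append mB₀ mB₁) (Fin.append mC₀ mC₁)) b fun ct =>
      jointProb (𝒜.B i) (𝒜.C i) ct.1 ct.2 ((𝒜.A₂ i).run (((𝒜.A₁ i).prepare.postMeasure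
        (Fin.append (Fin.append mB₀ mB₁) (Fin.append mC₀ mC₁))).tensor (S.view i g)))
          (Bits.single b) (Bits.single b)
  simp only [Bits.left_append, Bits.right_append] at h
  exact h

end Sde

section Selective

variable {ℓ : ℕ → ℕ} {F : PuncPrf fun lam => 2 * ℓ lam} {G : Prg ℓ} {O : Obfuscator} {U : Upo}
  {padC padF : ℕ → ℕ}

/-- The selective adversaries of the scheme, in terms of lengths and numbers of qubits only. -/
def Sde.SelAdversary.toAttack (𝒜 : (sde F G O U padC padF).SelAdversary) :
    SdeAttack F G O U padC padF where
  st := 𝒜.st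
  β := 𝒜.β
  γ := 𝒜.γ
  A₁ := 𝒜.A₁
  A₂ := 𝒜.A₂
  B := 𝒜.B
  C := 𝒜.C
  A₁_qpt := 𝒜.A₁_qpt
  A₂_qpt := 𝒜.A₂_qpt
  B_qpt := 𝒜.B_qpt
  C_qpt := 𝒜.C_qpt

/-- The points in the challenge ciphertexts. -/
def Prg.points (G : Prg ℓ) (same : Bool) (i : ℕ) (ρ : Bits (ℓ i) × Bits (ℓ i)) :
    Bits (2 * ℓ i) × Bits (2 * ℓ i) :=
  ((G.circ i).eval (diag same ρ).1, (G.circ i).eval (diag same ρ).2)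

namespace Attack

variable (𝒜 : SdeAttack F G O U padC padF)

/-- The game with the real keys. -/
abbrev realGame (same b : Bool) (i : ℕ) (g : Bits (F.coins i))
    (s : Bits (O.coins i (ℓ i + 2 * ℓ i) (2 * ℓ i + 2 * ℓ i) (encSize F G padC i)))
    (r : Bits (O.coins i (2 * ℓ i) (2 * ℓ i) (decSize F padF i)))
    (y : Bits (2 * ℓ i) × Bits (2 * ℓ i)) : ℝ :=
  𝒜.game same b b i (fun _ => O.obf i (skCircuit F padF i (F.gen i g)) r)
    (O.obf i (pkCircuit F G padC i (F.gen i g)) s) y (F.app₂ (F.gen i g) y)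

/-- The hybrid game with the real public key. -/
abbrev patchedGame (P : PuncturedCircuits F G padC padF) (same : Bool) (i : ℕ)
    (g : Bits (F.coins i))
    (s : Bits (O.coins i (ℓ i + 2 * ℓ i) (2 * ℓ i + 2 * ℓ i) (encSize F G padC i)))
    (r : Bits (O.coins i (2 * ℓ i) (2 * ℓ i) (decSize F padF i)))
    (y : Bits (2 * ℓ i) × Bits (2 * ℓ i)) : ℝ :=
  𝒜.hybrid P same false i (F.puncAt (F.gen i g) y) y (F.app₂ (F.gen i g) y) r
    (O.obf i (pkCircuit F G padC i (F.gen i g)) s)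

end Attack

/-- For fixed messages, keys and coins of the encryption, the outcome of the selective experiment is
the average of the value of the attack over the coins of the obfuscated decryption circuit. -/
theorem sde_jointProb_eq (hO : O.IsIndist) (𝒜 : (sde F G O U padC padF).SelAdversary) (same : Bool)
    (i : ℕ) (M : Msgs (2 * ℓ i)) (b : Bool) (g : Bits ((sde F G O U padC padF).genCoins i))
    (ρ : Bits (ℓ i) × Bits (ℓ i)) :
    jointProb (𝒜.B i) (𝒜.C i)
        ((sde F G O U padC padF).enc i ((sde F G O U padC padF).gen i g).2
          (M.toB b) (diag same ρ).1)
        ((sde F G O U padC padF).enc i ((sde F G O U padC padF).gen i g).2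
          (M.toC same b) (diag same ρ).2)
        ((𝒜.A₂ i).run (((𝒜.A₁ i).prepare.postMeasure M).tensor
          ((sde F G O U padC padF).view i g))) (Bits.single b) (Bits.single b) =
      𝔼 r, 𝒜.toAttack.value i b M
        (U.obfState i (O.obf i (skCircuit F padF i (F.gen i (Bits.left g))) r))
        (O.obf i (pkCircuit F G padC i (F.gen i (Bits.left g))) (Bits.right g)).encode
        (Fin.append (G.points same i ρ).1
          ((F.app (F.gen i (Bits.left g)) (G.points same i ρ).1).xor (M.toB b)))
        (Fin.append (G.points same i ρ).2
          ((F.app (F.gen i (Bits.left g)) (G.points same i ρ).2).xor (M.toC same b))) := by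
  rw [← Attack.value_expect]
  have e1 := sde_enc (U := U) (padF := padF) hO i g (M.toB b) (diag same ρ).1
  have e2 := sde_enc (U := U) (padF := padF) hO i g (M.toC same b) (diag same ρ).2
  exact congrArg₂ (fun ct₁ ct₂ => jointProb (𝒜.B i) (𝒜.C i) ct₁ ct₂ ((𝒜.A₂ i).run
    (((𝒜.A₁ i).prepare.postMeasure M).tensor ((sde F G O U padC padF).view i g)))
      (Bits.single b) (Bits.single b)) e1 e2

theorem selProb_eq (hO : O.IsIndist) (𝒜 : (sde F G O U padC padF).SelAdversary) (same : Bool)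
    (i : ℕ) :
    Sde.selProb 𝒜 ((sde F G O U padC padF).ctDist same) i =
      ((𝔼 g, 𝔼 s, 𝔼 r, 𝔼 ρ, 𝒜.toAttack.realGame same false i g s r (G.points same i ρ)) +
        𝔼 g, 𝔼 s, 𝔼 r, 𝔼 ρ, 𝒜.toAttack.realGame same true i g s r (G.points same i ρ)) / 2 := by
  rw [Sde.selProb_eq_sum]
  simp only [Attack.realGame, Attack.game, Attack.total, Finset.expect_sum_comm,
    ← Finset.sum_add_distrib, Finset.sum_div]
  refine Finset.sum_congr rfl fun M _ => ?_
  rw [← expect_bool fun b => 𝔼 g, 𝔼 s, 𝔼 r, 𝔼 ρ, 𝒜.toAttack.value i b M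
        (U.obfState i (O.obf i (skCircuit F padF i (F.gen i g)) r))
        (O.obf i (pkCircuit F G padC i (F.gen i g)) s).encode
        (Fin.append (G.points same i ρ).1
          ((F.app (F.gen i g) (G.points same i ρ).1).xor (M.toB b)))
        (Fin.append (G.points same i ρ).2
          ((F.app (F.gen i g) (G.points same i ρ).2).xor (M.toC same b)))]
  rw [Finset.expect_comm]
  refine Finset.expect_congr rfl fun b _ => ?_
  refine (Bits.expect_append (a := F.coins i) _).trans ?_
  refine Finset.expect_congr rfl fun g _ => Finset.expect_congr rfl fun s _ => ?_
  rw [Finset.expect_comm]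
  refine Finset.expect_congr rfl fun ρ _ => ?_
  have h := sde_jointProb_eq hO 𝒜 same i M b (Fin.append g s) ρ
  rw [Bits.left_append, Bits.right_append] at h
  exact h

namespace Attack

variable (𝒜 : SdeAttack F G O U padC padF)

theorem realGame_qAcc (hℓ : PolyBdd ℓ) (hC : PolyBdd padC) (hF : PolyBdd padF) (same b : Bool) :
    QAcc (X := fun i => (Bits (F.keyLen i) × (SkCirc F O padF i × PkCirc F G O padC i)) ×
      (Bits (2 * ℓ i) × Bits (2 * ℓ i))) fun i x =>
        𝒜.game same b b i (fun _ => x.1.2.1) x.1.2.2 x.2 (F.app₂ x.1.1 x.2) := by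
  have hn : PolyBdd fun lam => 2 * ℓ lam := (PolyBdd.const 2).mul hℓ
  have hoC := O.outSize_poly (hℓ.add hn) (hn.add hn) (encSize_poly (F := F) (G := G) hℓ hC)
  have hoF := O.outSize_poly hn hn (decSize_poly (F := F) hF)
  have hX : PolyBdd fun i => len ((Bits (F.keyLen i) × (SkCirc F O padF i × PkCirc F G O padC i)) ×
      (Bits (2 * ℓ i) × Bits (2 * ℓ i))) :=
    (F.keyLen_poly.add (PolyBdd.add (.descLen hn hn hoF)
      (.descLen (hℓ.add hn) (hn.add hn) hoC))).add (hn.add hn)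
  have hi := PEff.id hX
  have hj := PEff.id (X := fun i => ((Bits (F.keyLen i) × (SkCirc F O padF i ×
    PkCirc F G O padC i)) × (Bits (2 * ℓ i) × Bits (2 * ℓ i))) × Msgs (2 * ℓ i))
      (hX.add 𝒜.msgs_poly)
  have h := 𝒜.game_qAcc same b b hF hj.fst.fst.snd.fst hi.fst.snd.snd hi.snd
    ((PuncPrf.app_pEff (F := F) hℓ hi.fst.fst hi.snd.fst).pair
      (PuncPrf.app_pEff (F := F) hℓ hi.fst.fst hi.snd.snd))
  exact h

theorem hybrid_qAcc (P : PuncturedCircuits F G padC padF) (hℓ : PolyBdd ℓ) (hC : PolyBdd padC)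
    (hF : PolyBdd padF) (same c : Bool) :
    QAcc (X := fun i => (Bits (O.coins i (2 * ℓ i) (2 * ℓ i) (decSize F padF i)) × F.Patch i) ×
      PkCirc F G O padC i) fun i x => 𝒜.hybrid P same c i x.1.2.1 x.1.2.2.1 x.1.2.2.2 x.1.1 x.2 := by
  have hn : PolyBdd fun lam => 2 * ℓ lam := (PolyBdd.const 2).mul hℓ
  have hoC := O.outSize_poly (hℓ.add hn) (hn.add hn) (encSize_poly (F := F) (G := G) hℓ hC)
  have hX : PolyBdd fun i => len ((Bits (O.coins i (2 * ℓ i) (2 * ℓ i) (decSize F padF i)) ×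
      F.Patch i) × PkCirc F G O padC i) :=
    ((O.coins_poly hn hn (decSize_poly hF)).add (F.puncture_poly.2.1.add
      ((hn.add hn).add (hn.add hn)))).add (.descLen (hℓ.add hn) (hn.add hn) hoC)
  have hi := PEff.id hX
  have hj := PEff.id (X := fun i => ((Bits (O.coins i (2 * ℓ i) (2 * ℓ i) (decSize F padF i)) ×
    F.Patch i) × PkCirc F G O padC i) × Msgs (2 * ℓ i)) (hX.add 𝒜.msgs_poly)
  have h := 𝒜.game_qAcc same true c hF (patchedObf_pEff O P hℓ hF same c hj.fst.fst.snd.fst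
    hj.fst.fst.snd.snd.fst hj.fst.fst.snd.snd.snd hj.fst.fst.fst hj.snd) hi.snd
      hi.fst.snd.snd.fst hi.fst.snd.snd.snd
  exact h

/-- The points in the ciphertexts may be replaced by uniform ones. -/
theorem realGame_points (hℓ : PolyBdd ℓ) (hC : PolyBdd padC) (hF : PolyBdd padF) (hG : G.Secure)
    (same b : Bool) :
    ∃ μ, Negl μ ∧ ∀ i g s r,
      |(𝔼 ρ, 𝒜.realGame same b i g s r (G.points same i ρ)) -
        𝔼 y, 𝒜.realGame same b i g s r (diag same y)| ≤ μ i := by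
  obtain ⟨μ, hμ, h⟩ := hG.fools_pair hℓ same (𝒜.realGame_qAcc hℓ hC hF same b)
  exact ⟨μ, hμ, fun i g s r => h i (F.gen i g, O.obf i (skCircuit F padF i (F.gen i g)) r,
    O.obf i (pkCircuit F G padC i (F.gen i g)) s)⟩

open scoped Classical in
/-- For uniform points and the challenge bit `1`, the obfuscated circuit may be patched: the points
are good except with negligible probability. -/
theorem realGame_patched (P : PuncturedCircuits F G padC padF) (hℓ : PolyBdd ℓ)
    (hℓ' : Negl fun lam => (1 / 2 : ℝ) ^ ℓ lam) (hC : PolyBdd padC) (hF : PolyBdd padF)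
    (hP : F.PunctureCorrect) (hS : F.PunctureSecure) (hO : O.IsIndist) (same : Bool) :
    ∃ μ, Negl μ ∧ ∀ i,
      |(𝔼 y, 𝔼 g, 𝔼 s, 𝔼 r, 𝒜.realGame same true i g s r (diag same y)) -
        𝔼 y, 𝔼 g, 𝔼 s, 𝔼 r, 𝒜.patchedGame P same i g s r (diag same y)| ≤ μ i := by
  obtain ⟨μ, hμ, h⟩ := 𝒜.game_real_sub_hybrid P hℓ hC hF hP hS hO same
  have hμ' : Negl fun i => |μ i| := Asymptotics.SuperpolynomialDecay.trans_abs_le hμ fun i => (abs_abs (μ i)).le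
  refine ⟨_, (hℓ'.const_mul 3).add hμ', fun i => ?_⟩
  refine (abs_expect_sub_expect_le_of_good (abs_nonneg (μ i))
    (fun y => G.Good same i (diag same y)) (fun y => ?_) (fun y => ?_)
      fun y hy => (h i _ hy).trans (le_abs_self _)).trans
        (add_le_add_left (G.expect_bad_le same i) _)
  · exact expect_mem_unit fun g => expect_mem_unit fun s => expect_mem_unit fun r =>
      (𝒜.realGame_qAcc hℓ hC hF same true).mem_unit i ((F.gen i g,
        O.obf i (skCircuit F padF i (F.gen i g)) r, O.obf i (pkCircuit F G padC i (F.gen i g)) s),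
          diag same y)
  · exact expect_mem_unit fun g => expect_mem_unit fun s => expect_mem_unit fun r =>
      (𝒜.hybrid_qAcc P hℓ hC hF same false).mem_unit i ((r, F.puncAt (F.gen i g) (diag same y),
        diag same y, F.app₂ (F.gen i g) (diag same y)), O.obf i (pkCircuit F G padC i (F.gen i g)) s)

/-- The two remaining games are the two worlds of the security experiment for the unclonable
obfuscation. -/
theorem realGame_add_patchedGame_le (P : PuncturedCircuits F G padC padF) (hℓ : PolyBdd ℓ)
    (hℓ' : Negl fun lam => (1 / 2 : ℝ) ^ ℓ lam) (hF : PolyBdd padF)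
    (hP : F.PunctureCorrect) (hO : O.IsIndist) (same : Bool) (hU : U.IsGenUpo (pairDist same))
    (g : ∀ i, Bits (F.coins i))
    (s : ∀ i, Bits (O.coins i (ℓ i + 2 * ℓ i) (2 * ℓ i + 2 * ℓ i) (encSize F G padC i)))
    (r : ∀ i, Bits (O.coins i (2 * ℓ i) (2 * ℓ i) (decSize F padF i))) :
    ∃ μ, Negl μ ∧ ∀ i,
      ((𝔼 y, 𝒜.realGame same false i (g i) (s i) (r i) (diag same y)) +
        𝔼 y, 𝒜.patchedGame P same i (g i) (s i) (r i) (diag same y)) / 2 ≤ 1 / 2 + μ i := by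
  have hn : PolyBdd fun lam => 2 * ℓ lam := (PolyBdd.const 2).mul hℓ
  obtain ⟨t, ht, D, hD, hDe⟩ := exists_maskCircuits F hℓ
  let 𝔠 := P.upoClass hℓ hℓ' hF hP hO ht
  have hM : PEff fun i (M : Msgs (2 * ℓ i)) => M := PEff.id 𝒜.msgs_poly
  have hk : PEff fun i (_ : Msgs (2 * ℓ i)) => F.gen i (g i) :=
    PEff.const 𝒜.msgs_poly F.keyLen_poly _
  have hv : PEff fun i (x : Bits (2 * ℓ i)) => F.app (F.gen i (g i)) x :=
    PuncPrf.app_pEff hℓ (PEff.const hn F.keyLen_poly _) (PEff.id hn)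
  obtain ⟨𝒜', h𝒜'⟩ := Attack.exists_upo_adversary U 𝔠 𝒜 same
    (fun i => Fin.append (g i) (r i)) (fun _ => Set.mem_univ _)
    (fun i => (O.obf i (pkCircuit F G padC i (F.gen i (g i))) (s i)).encode)
    (hD.comp (hk.pair ((Msgs.toB_pEff false hM).xor (Msgs.toB_pEff true hM))))
    (hD.comp (hk.pair ((Msgs.toC_pEff same false hM).xor (Msgs.toC_pEff same true hM)))) hv
  obtain ⟨μ, hμ, h⟩ := (hU 𝔠).2 𝒜'
  refine ⟨μ, hμ, fun i => le_of_eq_of_le ?_ (h i)⟩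
  have e0 := h𝒜' (pairDist same) i false
  have e1 := h𝒜' (pairDist same) i true
  simp only [Bool.false_eq_true, if_false, if_true] at e0 e1
  have e0' := e0.trans (sum_pairDist same (n := 2 * ℓ i) _)
  have e1' := e1.trans (sum_pairDist same (n := 2 * ℓ i) _)
  rw [e0', e1']
  refine (congrArg₂ (fun a b => (a + b) / 2) ?_ ?_).symm
  · refine Finset.expect_congr rfl fun y _ => ?_
    have e := P.upoClass_C hℓ hℓ' hF hP hO ht i (g i) (r i)
    exact congrArg (fun f => 𝒜.total same i false false (fun _ => U.obfState i f) _ _ _) e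
  · refine Finset.expect_congr rfl fun y _ => ?_
    have e := fun M : Msgs (2 * ℓ i) => P.upoClass_genPuncture hℓ hℓ' hF hP hO ht i (g i) (r i)
      (y := diag same y) (u := M.shift same false (F.app₂ (F.gen i (g i)) (diag same y)))
      (hDe i (F.gen i (g i), (M.toB false).xor (M.toB true)) _)
      (hDe i (F.gen i (g i), (M.toC same false).xor (M.toC same true)) _)
    refine Eq.trans ?_ (congrArg (fun f : Msgs (2 * ℓ i) → SkCirc F O padF i =>
      𝒜.game same true false i f (O.obf i (pkCircuit F G padC i (F.gen i (g i))) (s i))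
        (diag same y) (F.app₂ (F.gen i (g i)) (diag same y))) (funext e))
    rfl

end Attack

/-- Correctness of the unclonable obfuscation on the class of all obfuscations of the function family
is what the correctness of the scheme requires. -/
theorem sde_correct (P : PuncturedCircuits F G padC padF) (hℓ : PolyBdd ℓ)
    (hℓ' : Negl fun lam => (1 / 2 : ℝ) ^ ℓ lam) (hF : PolyBdd padF) (hP : F.PunctureCorrect)
    (hO : O.IsIndist) {𝒟 : ∀ n, PMF (Bits n × Bits n)} (hU : U.IsGenUpo 𝒟) :
    (sde F G O U padC padF).Correct := by
  obtain ⟨δ, hδ, h⟩ := (hU (P.upoClass hℓ hℓ' hF hP hO (PolyBdd.const 0))).1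
  refine ⟨δ, hδ, sde_correctWith hO fun i g r x => ?_⟩
  have h1 : 1 - δ i ≤ U.evalProb i (O.obf i (skCircuit F padF i
      (F.gen i (Bits.left (Fin.append g r)))) (Bits.right (Fin.append g r))) x :=
    h i (Fin.append g r) (Set.mem_univ _) x
  rw [Bits.left_append, Bits.right_append] at h1
  exact h1

/-- Selective security, for both distributions of the challenges. -/
theorem sde_selectiveCpaAntiPiracy (P : PuncturedCircuits F G padC padF) (hℓ : PolyBdd ℓ)
    (hℓ' : Negl fun lam => (1 / 2 : ℝ) ^ ℓ lam) (hC : PolyBdd padC) (hF : PolyBdd padF)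
    (hP : F.PunctureCorrect) (hS : F.PunctureSecure) (hG : G.Secure) (hO : O.IsIndist)
    (same : Bool) (hU : U.IsGenUpo (pairDist same)) :
    (sde F G O U padC padF).SelectiveCpaAntiPiracy ((sde F G O U padC padF).ctDist same) := by
  intro 𝒜'
  let 𝒜 := 𝒜'.toAttack
  obtain ⟨μ₀, hμ₀, h₀⟩ := 𝒜.realGame_points hℓ hC hF hG same false
  obtain ⟨μ₁, hμ₁, h₁⟩ := 𝒜.realGame_points hℓ hC hF hG same true
  obtain ⟨μ₂, hμ₂, h₂⟩ := 𝒜.realGame_patched P hℓ hℓ' hC hF hP hS hO same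
  -- the best coins are hardwired into the adversary against the unclonable obfuscation
  choose w hw using fun i => exists_expect_le fun w : Bits (F.coins i) ×
    (Bits (O.coins i (ℓ i + 2 * ℓ i) (2 * ℓ i + 2 * ℓ i) (encSize F G padC i)) ×
      Bits (O.coins i (2 * ℓ i) (2 * ℓ i) (decSize F padF i))) =>
    (𝔼 y, 𝒜.realGame same false i w.1 w.2.1 w.2.2 (diag same y)) +
      𝔼 y, 𝒜.patchedGame P same i w.1 w.2.1 w.2.2 (diag same y)
  obtain ⟨μ₃, hμ₃, h₃⟩ := 𝒜.realGame_add_patchedGame_le P hℓ hℓ' hF hP hO same hU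
    (fun i => (w i).1) (fun i => (w i).2.1) fun i => (w i).2.2
  refine ⟨_, (((hμ₀.add hμ₁).add hμ₂).const_mul (1 / 2)).add hμ₃, fun i => ?_⟩
  rw [selProb_eq hO]
  have k₀ := abs_expect_sub_expect_le fun g => abs_expect_sub_expect_le fun s =>
    abs_expect_sub_expect_le fun r => h₀ i g s r
  have k₁ := abs_expect_sub_expect_le fun g => abs_expect_sub_expect_le fun s =>
    abs_expect_sub_expect_le fun r => h₁ i g s r
  have k₂ := h₂ i
  have rot : ∀ f : Bits (F.coins i) → Bits (O.coins i (ℓ i + 2 * ℓ i) (2 * ℓ i + 2 * ℓ i)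
      (encSize F G padC i)) → Bits (O.coins i (2 * ℓ i) (2 * ℓ i) (decSize F padF i)) →
        Bits (2 * ℓ i) × Bits (2 * ℓ i) → ℝ,
      (𝔼 y, 𝔼 g, 𝔼 s, 𝔼 r, f g s r y) = 𝔼 g, 𝔼 s, 𝔼 r, 𝔼 y, f g s r y := fun f => by
    rw [Finset.expect_comm]
    refine Finset.expect_congr rfl fun g _ => ?_
    rw [Finset.expect_comm]
    exact Finset.expect_congr rfl fun s _ => Finset.expect_comm _ _ _
  rw [rot fun g s r y => 𝒜.realGame same true i g s r (diag same y),
    rot fun g s r y => 𝒜.patchedGame P same i g s r (diag same y)] at k₂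
  have k₃ := hw i
  rw [expect_prod] at k₃
  simp only [expect_prod (α := Bits (O.coins i (ℓ i + 2 * ℓ i) (2 * ℓ i + 2 * ℓ i)
    (encSize F G padC i))), Finset.expect_add_distrib] at k₃
  have k₄ := h₃ i
  have l₀ := (abs_le.1 k₀).2
  have l₁ := (abs_le.1 k₁).2
  have l₂ := (abs_le.1 k₂).2
  linarith

end Selective

/-! ### From selective security to search security -/

theorem Superop.feed_comp {a b c d : ℕ} (T : Superop c d) (S : Superop (a + b) c) (x : Bits a) :
    (T.comp S).feed x = T.comp (S.feed x) :=
  ext_apply fun ρ => by rw [feed_apply, apply_comp, apply_comp, feed_apply]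

theorem Superop.classical_tensor_classical {a b c d : ℕ} (f : Bits a → Bits b)
    (g : Bits c → Bits d) : (classical f).tensor (classical g) =
      classical fun z : Bits (a + c) => Fin.append (f z.left) (g z.right) := by
  refine ext_unitState fun x x' => ?_
  rw [classical_apply_unitState, ← Bits.append_left_right x, ← Bits.append_left_right x',
    ← QState.unitState_tensor, tensor_apply_tensor, classical_apply_unitState,
    classical_apply_unitState, Bits.left_append, Bits.right_append]
  by_cases h1 : x.left = x'.left
  · by_cases h2 : x.right = x'.right
    · rw [if_pos h1, if_pos h2, if_pos (Bits.append_inj.2 ⟨h1, h2⟩), QState.ket_tensor_ket]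
    · rw [if_neg h2, if_neg fun h => h2 (Bits.append_inj.1 h).2, QState.tensor_zero]
  · rw [if_neg h1, if_neg fun h => h1 (Bits.append_inj.1 h).1, QState.zero_tensor]

theorem Superop.prob_classical {a b : ℕ} (f : Bits a → Bits b) (ρ : QState a) (y : Bits b) :
    ((classical f).apply ρ).prob y = ∑ x, if f x = y then ρ.prob x else 0 := by
  rw [classical_apply, QState.prob, Matrix.sum_apply, Complex.re_sum]
  refine Finset.sum_congr rfl fun x _ => ?_
  by_cases h : f x = y
  · simp [ket, h, QState.prob]
  · simp [ket, h, Ne.symm h]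

section JointProb

variable {n n' β γ c d c' d' : ℕ}

/-- Classical functions, applied to the outcomes of both parties. -/
theorem jointProb_classical {B : QCirc (n + β) c} {C : QCirc (n' + γ) d} {B' : QCirc (n + β) c'}
    {C' : QCirc (n' + γ) d'} {f : Bits c → Bits c'} {g : Bits d → Bits d'}
    (hB : B'.op = (Superop.classical f).comp B.op) (hC : C'.op = (Superop.classical g).comp C.op)
    (x : Bits n) (y : Bits n') (σ : QState (β + γ)) (u : Bits c') (v : Bits d') :
    jointProb B' C' x y σ u v =
      ∑ u', ∑ v', if f u' = u ∧ g v' = v then jointProb B C x y σ u' v' else 0 := by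
  rw [jointProb, hB, hC, Superop.feed_comp, Superop.feed_comp, Superop.tensor_comp_tensor,
    Superop.apply_comp, Superop.classical_tensor_classical, Superop.prob_classical, Bits.sum_append]
  simp only [Bits.left_append, Bits.right_append, Bits.append_inj]
  rfl

theorem jointProb_nonneg (B : QCirc (n + β) c) (C : QCirc (n' + γ) d) (x : Bits n) (y : Bits n')
    {σ : QState (β + γ)} (hσ : σ.IsState) (u : Bits c) (v : Bits d) :
    0 ≤ jointProb B C x y σ u v :=
  (((B.isChannel.feed x).tensor (C.isChannel.feed y)).isState hσ).prob_nonneg _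

theorem sum_jointProb (B : QCirc (n + β) c) (C : QCirc (n' + γ) d) (x : Bits n) (y : Bits n')
    {σ : QState (β + γ)} (hσ : σ.IsState) : ∑ u, ∑ v, jointProb B C x y σ u v = 1 := by
  rw [← (((B.isChannel.feed x).tensor (C.isChannel.feed y)).isState hσ).sum_prob, Bits.sum_append]
  rfl

/-- A random pair of strings is rarely hit by either party if the parties know nothing about it. -/
theorem le_expect_jointProb_ne (B : QCirc (n + β) c) (C : QCirc (n' + γ) c) (x : Bits n)
    (y : Bits n') {σ : QState (β + γ)} (hσ : σ.IsState) :
    1 - 2 * (1 / 2 : ℝ) ^ c ≤ 𝔼 m : Bits c × Bits c,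
      ∑ u, ∑ v, if u ≠ m.1 ∧ v ≠ m.2 then jointProb B C x y σ u v else 0 := by
  have hpt : ∀ u : Bits c, (𝔼 z : Bits c, if u = z then (1 : ℝ) else 0) = (1 / 2 : ℝ) ^ c := by
    intro u
    rw [Fintype.expect_eq_sum_div_card]
    simp
  have h : ∀ u v : Bits c, 1 - 2 * (1 / 2 : ℝ) ^ c ≤
      𝔼 m : Bits c × Bits c, if u ≠ m.1 ∧ v ≠ m.2 then 1 else 0 := by
    intro u v
    have e : (𝔼 m : Bits c × Bits c, ((1 : ℝ) - (if u = m.1 then 1 else 0) -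
        if v = m.2 then 1 else 0)) = 1 - 2 * (1 / 2 : ℝ) ^ c := by
      rw [Finset.expect_sub_distrib, Finset.expect_sub_distrib, Fintype.expect_const,
        expect_fst fun z => if u = z then (1 : ℝ) else 0,
        expect_snd fun z => if v = z then (1 : ℝ) else 0, hpt, hpt]
      ring
    rw [← e]
    refine Finset.expect_le_expect fun m _ => ?_
    by_cases h1 : u = m.1 <;> by_cases h2 : v = m.2 <;> simp [h1, h2]
  calc 1 - 2 * (1 / 2 : ℝ) ^ c
      = ∑ u, ∑ v, jointProb B C x y σ u v * (1 - 2 * (1 / 2 : ℝ) ^ c) := by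
        simp only [← Finset.sum_mul]
        rw [sum_jointProb B C x y hσ, one_mul]
    _ ≤ ∑ u, ∑ v, jointProb B C x y σ u v *
          𝔼 m : Bits c × Bits c, if u ≠ m.1 ∧ v ≠ m.2 then 1 else 0 :=
        Finset.sum_le_sum fun u _ => Finset.sum_le_sum fun v _ =>
          mul_le_mul_of_nonneg_left (h u v) (jointProb_nonneg B C x y hσ u v)
    _ = _ := by
        simp only [Finset.expect_sum_comm, Finset.mul_expect, mul_ite, mul_one, mul_zero]

end JointProb

namespace Sde

variable {S : Sde}

theorem Efficient.view_isState (hS : S.Efficient) (i : ℕ) (g : Bits (S.genCoins i)) :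
    (S.view i g).IsState := by
  obtain ⟨Q, -, hQ⟩ := hS.2.2.2.2.2.1
  rw [view, ← hQ]
  exact ((Q i).isChannel.isState (.ket _)).tensor_ket _

/-- Four messages in a row: `m` for the challenge bit `0`, and zeros for the challenge bit `1`. -/
def searchMsgs {n : ℕ} (m : Bits n × Bits n) : Msgs n :=
  Fin.append (Fin.append m.1 fun _ => false) (Fin.append m.2 fun _ => false)

/-- A search adversary yields a selective one: it announces the messages `m` and zeros, and each
party outputs `0` if it finds its message. -/
theorem SearchAdversary.exists_selAdversary (𝒜 : S.SearchAdversary)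
    (m : ∀ i, Bits (S.msgLen i) × Bits (S.msgLen i)) :
    ∃ 𝒜' : S.SelAdversary, ∀ i, selProb 𝒜' S.idenBitIndMsg i =
      ((𝔼 g, 𝔼 ρ : Bits (S.encCoins i) × Bits (S.encCoins i), jointProb (𝒜.B i) (𝒜.C i)
          (S.enc i (S.gen i g).2 (m i).1 ρ.1) (S.enc i (S.gen i g).2 (m i).2 ρ.2)
          ((𝒜.A i).run (S.view i g)) (m i).1 (m i).2) +
        𝔼 g, 𝔼 ρ : Bits (S.encCoins i) × Bits (S.encCoins i), ∑ u, ∑ v,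
          if u ≠ (m i).1 ∧ v ≠ (m i).2 then jointProb (𝒜.B i) (𝒜.C i)
            (S.enc i (S.gen i g).2 (fun _ => false) ρ.1)
            (S.enc i (S.gen i g).2 (fun _ => false) ρ.2) ((𝒜.A i).run (S.view i g)) u v
          else 0) / 2 := by
  have hn : PolyBdd S.msgLen := 𝒜.B_qpt.cod
  have h0 : PolyBdd fun _ => len (Bits 0) := .const 0
  have hM : PolyBdd fun i => ((S.msgLen i + S.msgLen i) + (S.msgLen i + S.msgLen i)) + 0 :=
    ((hn.add hn).add (hn.add hn)).add (.const 0)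
  obtain ⟨A₁, hA₁, hA₁op⟩ := (PEff.const (X := fun _ => Bits 0) (Y := fun i => Bits
    (((S.msgLen i + S.msgLen i) + (S.msgLen i + S.msgLen i)) + 0)) h0 hM fun i =>
      Fin.append (searchMsgs (m i)) Fin.elim0).exists_qpt_classical
  obtain ⟨A₂, hA₂, hA₂op⟩ := CEff.const (X := fun _ => Bits 0) 𝒜.A_qpt h0
  have hf : ∀ y : ∀ i, Bits (S.msgLen i), PEff fun i (u : Bits (S.msgLen i)) =>
      if u = y i then Bits.single false else Bits.single true := fun y =>
    (PEff.id (X := fun i => Bits (S.msgLen i)) hn).ite_eq (.const hn hn y)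
      (.const (Y := fun _ => Bits 1) hn (.const 1) _) (.const (Y := fun _ => Bits 1) hn (.const 1) _)
  obtain ⟨TB, hTB, hTBop⟩ := (hf fun i => (m i).1).exists_qpt_classical
  obtain ⟨TC, hTC, hTCop⟩ := (hf fun i => (m i).2).exists_qpt_classical
  let 𝒜' : S.SelAdversary :=
    { st := fun _ => 0
      β := 𝒜.β
      γ := 𝒜.γ
      A₁ := A₁
      A₂ := A₂
      B := fun i => (𝒜.B i).seq (TB i)
      C := fun i => (𝒜.C i).seq (TC i)
      A₁_qpt := hA₁
      A₂_qpt := hA₂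
      B_qpt := 𝒜.B_qpt.seq hTB
      C_qpt := 𝒜.C_qpt.seq hTC }
  refine ⟨𝒜', fun i => ?_⟩
  have hpost : ∀ M, (A₁ i).prepare.postMeasure M =
      if M = searchMsgs (m i) then ket Fin.elim0 else 0 := fun M => by
    rw [QCirc.prepare, QCirc.run, hA₁op, Superop.classical_apply_ket, ← QState.ket_tensor_ket,
      QState.postMeasure_ket_tensor]
  have hrun : ∀ σ, (A₂ i).run ((ket Fin.elim0).tensor σ) = (𝒜.A i).run σ := fun σ =>
    (Superop.feed_apply _ _ _).symm.trans (congrArg (Superop.apply · σ) (hA₂op i Fin.elim0))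
  have hsingle : ∀ (u y : Bits (S.msgLen i)), (if u = y then Bits.single false else
      Bits.single true) = Bits.single false ↔ u = y := fun u y => by
    by_cases h : u = y <;> simp [h, Bits.single_injective.eq_iff]
  have hsingle' : ∀ (u y : Bits (S.msgLen i)), (if u = y then Bits.single false else
      Bits.single true) = Bits.single true ↔ u ≠ y := fun u y => by
    by_cases h : u = y <;> simp [h, Bits.single_injective.eq_iff]
  have hB : ((𝒜.B i).seq (TB i)).op = (Superop.classical _).comp (𝒜.B i).op :=
    congrArg (Superop.comp · (𝒜.B i).op) (hTBop i)
  have hC : ((𝒜.C i).seq (TC i)).op = (Superop.classical _).comp (𝒜.C i).op :=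
    congrArg (Superop.comp · (𝒜.C i).op) (hTCop i)
  refine (selProb_eq_sum 𝒜' false i).trans ?_
  rw [Finset.sum_eq_single (searchMsgs (m i))]
  · rw [Finset.expect_comm, expect_bool]
    refine congrArg₂ (fun a b => (a + b) / 2) ?_ ?_
    · refine Finset.expect_congr rfl fun g _ => Finset.expect_congr rfl fun ρ _ => ?_
      change jointProb ((𝒜.B i).seq (TB i)) ((𝒜.C i).seq (TC i)) _ _ ((A₂ i).run
        (((A₁ i).prepare.postMeasure _).tensor _)) _ _ = _
      rw [hpost, if_pos rfl, hrun, jointProb_classical hB hC]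
      simp only [hsingle]
      rw [Finset.sum_eq_single (m i).1, Finset.sum_eq_single (m i).2]
      · simp [searchMsgs, Msgs.toB, Msgs.toC, diag]
      · intro v _ hv; simp [hv]
      · simp
      · intro u _ hu; simp [hu]
      · simp
    · refine Finset.expect_congr rfl fun g _ => Finset.expect_congr rfl fun ρ _ => ?_
      change jointProb ((𝒜.B i).seq (TB i)) ((𝒜.C i).seq (TC i)) _ _ ((A₂ i).run
        (((A₁ i).prepare.postMeasure _).tensor _)) _ _ = _
      rw [hpost, if_pos rfl, hrun, jointProb_classical hB hC]
      simp only [hsingle']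
      simp [searchMsgs, Msgs.toB, Msgs.toC, diag]
  · intro M _ hne
    refine (Finset.expect_congr rfl fun g _ => Finset.expect_congr rfl fun b _ =>
      Finset.expect_congr rfl fun ρ _ => ?_).trans (by simp : (𝔼 g : Bits (S.genCoins i),
        𝔼 b : Bool, 𝔼 ρ : Bits (S.encCoins i) × Bits (S.encCoins i), (0 : ℝ)) = 0)
    change jointProb _ _ _ _ ((A₂ i).run (((A₁ i).prepare.postMeasure M).tensor _)) _ _ = _
    rw [hpost, if_neg hne, QState.zero_tensor]
    simp [jointProb, QCirc.run, QState.prob, Superop.apply]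
  · simp

/-- Search adversaries succeed with negligible probability if the messages cannot be guessed and
selective adversaries have a negligible advantage: encryptions of zeros do not depend on the
messages that were to be found. -/
theorem SelectiveCpaAntiPiracy.searchAntiPiracy (hS : S.Efficient)
    (hn : Negl fun i => (1 / 2 : ℝ) ^ S.msgLen i)
    (h : S.SelectiveCpaAntiPiracy S.idenBitIndMsg) : S.SearchAntiPiracy unifPair := by
  intro 𝒜
  let W : ∀ i, Bits (S.msgLen i) × Bits (S.msgLen i) → ℝ := fun i m =>
    𝔼 g, 𝔼 ρ : Bits (S.encCoins i) × Bits (S.encCoins i), jointProb (𝒜.B i) (𝒜.C i)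
      (S.enc i (S.gen i g).2 m.1 ρ.1) (S.enc i (S.gen i g).2 m.2 ρ.2)
      ((𝒜.A i).run (S.view i g)) m.1 m.2
  let W' : ∀ i, Bits (S.msgLen i) × Bits (S.msgLen i) → ℝ := fun i m =>
    𝔼 g, 𝔼 ρ : Bits (S.encCoins i) × Bits (S.encCoins i), ∑ u, ∑ v,
      if u ≠ m.1 ∧ v ≠ m.2 then jointProb (𝒜.B i) (𝒜.C i)
        (S.enc i (S.gen i g).2 (fun _ => false) ρ.1) (S.enc i (S.gen i g).2 (fun _ => false) ρ.2)
        ((𝒜.A i).run (S.view i g)) u v else 0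
  choose m hm using fun i => exists_expect_le fun m => W i m + W' i m
  obtain ⟨𝒜', h𝒜'⟩ := 𝒜.exists_selAdversary m
  obtain ⟨μ, hμ, hsel⟩ := h 𝒜'
  refine ⟨_, (hμ.add hn).const_mul 2, fun i => ?_⟩
  have e0 : searchProb 𝒜 unifPair i = 𝔼 m, W i m := by
    rw [Finset.expect_comm]
    refine Finset.expect_congr rfl fun g _ => ?_
    refine (sum_pairDist false _).trans (Finset.expect_congr rfl fun m _ => ?_)
    exact (expect_prod fun ρ : Bits (S.encCoins i) × Bits (S.encCoins i) => jointProb (𝒜.B i)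
      (𝒜.C i) (S.enc i (S.gen i g).2 m.1 ρ.1) (S.enc i (S.gen i g).2 m.2 ρ.2)
      ((𝒜.A i).run (S.view i g)) m.1 m.2).symm
  have e1 : 1 - 2 * (1 / 2 : ℝ) ^ S.msgLen i ≤ 𝔼 m, W' i m := by
    rw [Finset.expect_comm]
    refine Finset.le_expect Finset.univ_nonempty fun g _ => ?_
    rw [Finset.expect_comm]
    exact Finset.le_expect Finset.univ_nonempty fun ρ _ =>
      le_expect_jointProb_ne _ _ _ _ ((𝒜.A i).isChannel.isState (hS.view_isState i g))
  have e2 := hm i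
  rw [Finset.expect_add_distrib] at e2
  have e3 : (W i (m i) + W' i (m i)) / 2 ≤ 1 / 2 + μ i := (h𝒜' i).symm.trans_le (hsel i)
  linarith

end Sde

end

theorem mainTheorem7
    (ℓ : ℕ → ℕ) (hℓ_poly : PolyBdd ℓ) (hℓ_large : Negl fun lam => (1 / 2 : ℝ) ^ ℓ lam)
    (F : PuncPrf fun lam => 2 * ℓ lam) (hF : F.PunctureCorrect ∧ F.PunctureSecure)
    (G : Prg ℓ) (hG : G.Secure) :
    ∃ p₀ : ℕ → ℕ, PolyBdd p₀ ∧
      ∀ padC padF : ℕ → ℕ, PolyBdd padC → PolyBdd padF →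
        (∀ lam, p₀ lam ≤ padC lam) → (∀ lam, p₀ lam ≤ padF lam) →
        ∀ O : Obfuscator, O.IsIndist → ∀ U : Upo,
          (sde F G O U padC padF).Efficient ∧
          (∀ δ : ℕ → ℝ,
            (∀ lam g r x, 1 - δ lam ≤
              U.evalProb lam (O.obf lam (decCircuit F padF lam (F.gen lam g)) r) x) →
            (sde F G O U padC padF).CorrectWith δ) ∧
          (U.IsGenUpo unifPair →
            (sde F G O U padC padF).Correct ∧
            (sde F G O U padC padF).SearchAntiPiracy unifPair ∧
            (sde F G O U padC padF).SelectiveCpaAntiPiracy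
              (sde F G O U padC padF).idenBitIndMsg) ∧
          (U.IsGenUpo idenPair →
            (sde F G O U padC padF).Correct ∧
            (sde F G O U padC padF).SelectiveCpaAntiPiracy
              (sde F G O U padC padF).identical) := by
  obtain ⟨hP, hS⟩ := hF
  have hn : Negl fun lam => (1 / 2 : ℝ) ^ (2 * ℓ lam) :=
    hℓ_large.mono (fun _ => by positivity) fun lam =>
      pow_le_pow_of_le_one (by norm_num) (by norm_num) (by omega)
  obtain ⟨p₀, hp₀, h⟩ := exists_puncturedCircuits F G hℓ_poly
  refine ⟨p₀, hp₀, fun padC padF hpC hpF hC hF O hO U => ?_⟩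
  obtain ⟨P⟩ := h padC padF hpC hpF hC hF
  have heff : (sde F G O U padC padF).Efficient := sde_efficient hℓ_poly hpC hpF
  refine ⟨heff, fun δ hδ => sde_correctWith hO hδ, fun hU => ?_, fun hU => ?_⟩
  · have hsel := sde_selectiveCpaAntiPiracy P hℓ_poly hℓ_large hpC hpF hP hS hG hO false hU
    exact ⟨sde_correct P hℓ_poly hℓ_large hpF hP hO hU,
      Sde.SelectiveCpaAntiPiracy.searchAntiPiracy heff hn hsel, hsel⟩
  · exact ⟨sde_correct P hℓ_poly hℓ_large hpF hP hO hU,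
      sde_selectiveCpaAntiPiracy P hℓ_poly hℓ_large hpC hpF hP hS hG hO true hU⟩
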